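/- **Problem and machine.** An instance of the matrix query consists of two finite relations $R_1(A,B)$ and $R_2(B,C)$; its query result is $\{(a,c)\mid \exists b:\ (a,b)\in R_1,\ (b,c)\in R_2\}$. Let $N=|R_1|+|R_2|$ be the input size and $\mathrm{OUT}$ the size of the query result. A number $\widehat V$ is an $\epsilon$-approximation of $V\ge 0$ if $(1-\epsilon)V\le\widehat V\le(1+\epsilon)V$. The machine is a randomized word RAM with words of $w=\Omega(\log N)$ bits, i.e. $w\ge\kappa\log_2(N+1)$ for a constant $\kappa$ of the algorithm, such that the attribute values and the parameters, given as the integers $\lceil 1/\epsilon\rceil$ and $\lceil 1/\delta\rceil$, fit into single words. The memory (registers and a fixed number of word arrays) is initially zero apart from the two parameters. In unit time the machine performs a memory access, a comparison, an arithmetic operation on two words (addition, subtraction, multiplication, division, remainder), draws a uniformly random integer from a range $[u,v]$, or executes one of the following primitives for a relation $R\in\{R_1,R_2\}$ and a tuple $t$ on a (possibly empty) subset of its attributes: return a uniformly random tuple of $R$ (if $R\neq\emptyset$); return the number of tuples of $R$ that agree with $t$; return the $j$-th tuple of $R$ that agrees with $t$ under a fixed, arbitrary ordering; test whether a given tuple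 is in $R$. There is no other access to the relations. **Theorem.** There are an algorithm (a single program) for this machine and absolute constants $C,\kappa$ such that for all real parameters $0<\epsilon,\delta<1$, every instance of the matrix query with $N\ge 1$, all orderings used by the primitives, and every word length $w$ as above, with probability at least $1-\delta$ the algorithm halts within $$C\cdot\frac{N\cdot\log_2(2N/\delta)\cdot\log_2(2/\delta)}{\epsilon^{2.5}\,\sqrt{\max\{1,\mathrm{OUT}\}}}$$ steps and its output (a fraction of two words) is an $\epsilon$-approximation of $\mathrm{OUT}$. -/

import Mathlib

noncomputable section

namespace MatrixCount

/-! ### Relations, instances and the matrix query -/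

/-- A tuple `t` of a binary relation agrees with a tuple defined on a subset of the two attributes:
`none` means that the attribute is left out of the subset. -/
def Matches (p q : Option ℕ) (t : ℕ × ℕ) : Prop :=
  (∀ v, p = some v → t.1 = v) ∧ (∀ v, q = some v → t.2 = v)

/-- A binary relation together with the fixed orderings used by the "access neighbor" primitive:
`nbrs p q` lists, without repetition and in an arbitrary order (which may differ from one partial
tuple `(p, q)` to another), the tuples that agree with `(p, q)`. -/
structure StoredRel where
  tuples : Finset (ℕ × ℕ)
  nbrs : Option ℕ → Option ℕ → List (ℕ × ℕ)
  nbrs_nodup : ∀ p q, (nbrs p q).Nodup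
  mem_nbrs : ∀ p q t, t ∈ nbrs p q ↔ t ∈ tuples ∧ Matches p q t

open Classical in
/-- The number of tuples of the relation that agree with the partial tuple `(p, q)`. -/
def StoredRel.degree (R : StoredRel) (p q : Option ℕ) : ℕ :=
  (R.tuples.filter (Matches p q)).card

/-- The names of the two relations `R₁(A, B)` and `R₂(B, C)`. -/
inductive RelName
  | R₁
  | R₂

/-- An instance of the matrix query: `R₁(A, B)`, with tuples `(a, b)`, and `R₂(B, C)`, with
tuples `(b, c)`. -/
structure Instance where
  R₁ : StoredRel
  R₂ : StoredRel

def Instance.rel (I : Instance) : RelName → StoredRel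
  | .R₁ => I.R₁
  | .R₂ => I.R₂

/-- The input size `N = |R₁| + |R₂|`. -/
def Instance.size (I : Instance) : ℕ := I.R₁.tuples.card + I.R₂.tuples.card

/-- The result of the matrix query: the set of the pairs `(a, c)` such that `(a, b) ∈ R₁` and
`(b, c) ∈ R₂` for some `b`. -/
def Instance.result (I : Instance) : Finset (ℕ × ℕ) :=
  ((I.R₁.tuples ×ˢ I.R₂.tuples).filter (fun t => t.1.2 = t.2.1)).image
    (fun t => (t.1.1, t.2.2))

/-- The output size `OUT`. -/
def Instance.out (I : Instance) : ℕ := I.result.card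

/-- All attribute values are `w`-bit words. -/
def Instance.FitsWord (I : Instance) (w : ℕ) : Prop :=
  ∀ r, ∀ t ∈ (I.rel r).tuples, t.1 < 2 ^ w ∧ t.2 < 2 ^ w

/-! ### The randomized word RAM with access to the relations -/

/-- The content of the memory: word registers `reg x` and arrays of words; `mem A i` is cell `i` of
array `A`.  Every program names finitely many registers and arrays. -/
structure Store where
  reg : ℕ → ℕ
  mem : ℕ → ℕ → ℕ

inductive Operand
  | const (n : ℕ)
  | reg (x : ℕ)

/-- Basic arithmetic on two words. -/
inductive BinOp
  | add
  | sub
  | mul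
  | div
  | mod

inductive Cmp
  | lt
  | eq

/-- Programs.  Every statement other than the control structures `seq`, `ite`, `loop` performs one
operation on a bounded number of words. -/
inductive Program
  /-- do nothing -/
  | skip
  /-- first `P`, then `Q` -/
  | seq (P Q : Program)
  /-- if `u c v` then `P` else `Q` -/
  | ite (c : Cmp) (u v : Operand) (P Q : Program)
  /-- while `u c v` do `P` -/
  | loop (c : Cmp) (u v : Operand) (P : Program)
  /-- `x ← u o v` -/
  | op (o : BinOp) (x : ℕ) (u v : Operand)
  /-- `x ← A[i]` -/
  | load (x A : ℕ) (i : Operand)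
  /-- `A[i] ← u` -/
  | store (A : ℕ) (i u : Operand)
  /-- `x ← RandInt(u, v)` -/
  | randInt (x : ℕ) (u v : Operand)
  /-- (sample tuple) `(x, y) ←` a uniformly random tuple of `r` -/
  | sample (r : RelName) (x y : ℕ)
  /-- (compute degree) `x ←` the number of tuples of `r` that agree with the partial tuple
  `(p, q)` -/
  | degree (r : RelName) (p q : Option Operand) (x : ℕ)
  /-- (access neighbor) `(x, y) ←` the `j`-th (counted from `1`) tuple of `r` that agrees with the
  partial tuple `(p, q)` -/
  | neighbor (r : RelName) (p q : Option Operand) (j : Operand) (x y : ℕ)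
  /-- (test tuple) `x ← 1` if `(u, v)` is a tuple of `r`, and `x ← 0` otherwise -/
  | test (r : RelName) (u v : Operand) (x : ℕ)

/-- Writing to a register keeps the last `w` bits. -/
def Store.setReg (w : ℕ) (s : Store) (x v : ℕ) : Store :=
  { s with reg := Function.update s.reg x (v % 2 ^ w) }

/-- Writing to an array cell keeps the last `w` bits. -/
def Store.setMem (w : ℕ) (s : Store) (A i v : ℕ) : Store :=
  { s with mem := Function.update s.mem A (Function.update (s.mem A) i (v % 2 ^ w)) }

def Operand.eval (w : ℕ) (s : Store) : Operand → ℕ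
  | .const n => n % 2 ^ w
  | .reg x => s.reg x

/-- Subtraction is modulo `2 ^ w`, division rounds down, and division by `0` gives `0`. -/
def BinOp.eval (w : ℕ) : BinOp → ℕ → ℕ → ℕ
  | .add, a, b => a + b
  | .sub, a, b => a + (2 ^ w - b)
  | .mul, a, b => a * b
  | .div, a, b => a / b
  | .mod, a, b => a % b

def Cmp.eval : Cmp → ℕ → ℕ → Bool
  | .lt, a, b => decide (a < b)
  | .eq, a, b => decide (a = b)

/-- A configuration: the stack of the programs that remain to be executed, and the memory. -/
structure Config where
  todo : List Program
  st : Store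

/-- The effect of a single statement (the head of the stack), as a distribution over the next
configurations; `k` is the rest of the stack.  Sampling from an empty relation, drawing from an
empty range and accessing a neighbor that does not exist have no effect. -/
def exec (w : ℕ) (I : Instance) (s : Store) (k : List Program) : Program → PMF Config
  | .skip => PMF.pure ⟨k, s⟩
  | .seq P Q => PMF.pure ⟨P :: Q :: k, s⟩
  | .ite c u v P Q =>
      PMF.pure ⟨(if c.eval (u.eval w s) (v.eval w s) then P else Q) :: k, s⟩
  | .loop c u v P =>
      PMF.pure ⟨if c.eval (u.eval w s) (v.eval w s) then P :: .loop c u v P :: k else k, s⟩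
  | .op o x u v => PMF.pure ⟨k, s.setReg w x (o.eval w (u.eval w s) (v.eval w s))⟩
  | .load x A i => PMF.pure ⟨k, s.setReg w x (s.mem A (i.eval w s))⟩
  | .store A i u => PMF.pure ⟨k, s.setMem w A (i.eval w s) (u.eval w s)⟩
  | .randInt x u v =>
      if h : (Finset.Icc (u.eval w s) (v.eval w s)).Nonempty then
        (PMF.uniformOfFinset (Finset.Icc (u.eval w s) (v.eval w s)) h).map
          (fun n => ⟨k, s.setReg w x n⟩)
      else PMF.pure ⟨k, s⟩
  | .sample r x y =>
      if h : (I.rel r).tuples.Nonempty then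
        (PMF.uniformOfFinset (I.rel r).tuples h).map
          (fun t => ⟨k, (s.setReg w x t.1).setReg w y t.2⟩)
      else PMF.pure ⟨k, s⟩
  | .degree r p q x =>
      PMF.pure ⟨k, s.setReg w x
        ((I.rel r).degree (p.map (Operand.eval w s)) (q.map (Operand.eval w s)))⟩
  | .neighbor r p q j x y =>
      match j.eval w s with
      | 0 => PMF.pure ⟨k, s⟩
      | i + 1 =>
        match ((I.rel r).nbrs (p.map (Operand.eval w s)) (q.map (Operand.eval w s)))[i]? with
        | none => PMF.pure ⟨k, s⟩
        | some t => PMF.pure ⟨k, (s.setReg w x t.1).setReg w y t.2⟩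
  | .test r u v x =>
      PMF.pure ⟨k, s.setReg w x
        (if (u.eval w s, v.eval w s) ∈ (I.rel r).tuples then 1 else 0)⟩

/-- One step of the machine with word length `w` on the instance `I`; it costs one time unit.
A configuration with an empty stack has halted. -/
def step (w : ℕ) (I : Instance) (c : Config) : PMF Config :=
  match c.todo with
  | [] => PMF.pure c
  | P :: k => exec w I c.st k P

/-- The distribution of the configuration after `T` steps. -/
def run (w : ℕ) (I : Instance) : ℕ → Config → PMF Config
  | 0, c => PMF.pure c
  | T + 1, c => (step w I c).bind (run w I T)

/-- The start of program `P`: registers `0` and `1` hold the two parameters `e` and `d`, all other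
registers and all array cells are zero. -/
def start (P : Program) (e d : ℕ) : Config :=
  ⟨[P], ⟨fun x => if x = 0 then e else if x = 1 then d else 0, fun _ _ => 0⟩⟩

/-! ### Approximation and time bound -/

/-- `V'` is an `ε`-approximation of `V`. -/
def IsApprox (ε V V' : ℝ) : Prop := (1 - ε) * V ≤ V' ∧ V' ≤ (1 + ε) * V

/-- The program has halted, and its output, the fraction with numerator in register `0` and nonzero
denominator in register `1`, is an `ε`-approximation of the output size. -/
def Good (ε : ℝ) (I : Instance) (c : Config) : Prop :=
  c.todo = [] ∧ c.st.reg 1 ≠ 0 ∧ IsApprox ε I.out ((c.st.reg 0 : ℝ) / (c.st.reg 1 : ℝ))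

/-- `N log(2N/δ) log(2/δ) / (ε ^ 2.5 √(max 1 OUT))`, with logarithms to base `2`. -/
def timeBound (N OUT : ℕ) (ε δ : ℝ) : ℝ :=
  (N : ℝ) * Real.logb 2 (2 * N / δ) * Real.logb 2 (2 / δ) /
    (ε ^ (5 / 2 : ℝ) * √(max 1 (OUT : ℝ)))

end MatrixCount

end

/-! Write W(a,c) for the number of witnesses b of a pair (a,c). Giving each join result (a,b,c) the
weight 1/W(a,c) makes the total weight OUT (`sum_joined_div_wit`), so it suffices to sample join
results uniformly and to accept each with probability 1/W.

Uniform sampling: fix τ with OUT ≤ τ². The two degrees of any b have product at most OUT, so the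
smaller one is at most τ. A uniform tuple among all N tuples is extended by its v-th match, v
uniform in [1,τ], provided that it points in the direction in which its b has fewer extensions.
Every join result then appears with probability exactly 1/(Nτ) (`sum_pick`). Acceptance with
probability 1/W needs no knowledge of W: tuples at the endpoint of smaller degree d are drawn until
one yields a witness, and the sample is accepted if this witness is b itself. Hence a sample is
accepted with probability OUT/(Nτ), and S accepted ones among k estimate OUT by S·Nτ/k.

Time: a search takes d/W trials on average, and averaging over the draw leaves (∑ d)/(Nτ), summed
over the query result. This is at most 1 by Cauchy–Schwarz (`sum_minDeg_le`). Cutting each search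
off after B trials costs only a small relative error on the levels whose estimate matters.

Levels: τ starts near N and is halved, with twice as many samples, until h samples are accepted. A
level with τ² ≤ 4·OUT stops with high probability, so the condition OUT ≤ τ² is never left, and the
geometric sum of the costs is of the order of N/√OUT (`bad_levels_le`).

Tails: exponential potentials for too many acceptances, too few acceptances and too much time do not
grow in expectation. A sum of them dominates the indicator of failure and starts below 3·exp(-2l)
(`exists_potential`). The link to the machine is `bad_le_wp` together with `wp_body_le`: one pass
through the loop body is one step of the abstract process.

Words: 1/ε is replaced by e ≤ 4N², so that all numbers fit. If this truncates, the error is at most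
1/4 and rounding makes the output exact (`bad_finish_le`). -/

noncomputable section

namespace MatrixCount

/-! ### Failure probability, and expectations over loop-free programs. -/

/-- The probability that the configuration `c` is not `Good` after `T` further steps. -/
def bad (w : ℕ) (I : Instance) (ε : ℝ) (T : ℕ) (c : Config) : ℝ :=
  ((run w I T c).toOuterMeasure {c | ¬ Good ε I c}).toReal

section

variable {w : ℕ} {I : Instance} {ε : ℝ}

lemma toOuterMeasure_le_one {α : Type*} (p : PMF α) (s : Set α) : p.toOuterMeasure s ≤ 1 := by
  rw [PMF.toOuterMeasure_apply, ← p.tsum_coe]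
  exact ENNReal.tsum_le_tsum fun a => Set.indicator_le_self _ _ a

lemma ofReal_bad (T : ℕ) (c : Config) :
    ENNReal.ofReal (bad w I ε T c) = (run w I T c).toOuterMeasure {c | ¬ Good ε I c} :=
  ENNReal.ofReal_toReal (ne_top_of_le_ne_top ENNReal.one_ne_top (toOuterMeasure_le_one _ _))

lemma bad_nonneg (T : ℕ) (c : Config) : 0 ≤ bad w I ε T c := ENNReal.toReal_nonneg

lemma bad_le_one (T : ℕ) (c : Config) : bad w I ε T c ≤ 1 := by
  have := ENNReal.toReal_mono ENNReal.one_ne_top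
    (toOuterMeasure_le_one (run w I T c) {c | ¬ Good ε I c})
  simpa [bad] using this

lemma bad_zero_of_good {c : Config} (hc : Good ε I c) : bad w I ε 0 c = 0 := by
  simp [bad, run, hc]

lemma bad_zero_of_not_good {c : Config} (hc : ¬ Good ε I c) : bad w I ε 0 c = 1 := by
  simp [bad, run, hc]

lemma bad_succ_of_step_pure {T : ℕ} {c c' : Config} (h : step w I c = PMF.pure c') :
    bad w I ε (T + 1) c = bad w I ε T c' := by
  simp [bad, run, h]

lemma bad_succ_of_step_uniform {T : ℕ} {c : Config} {α : Type*} {s : Finset α}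
    (hs : s.Nonempty) (g : α → Config)
    (h : step w I c = (PMF.uniformOfFinset s hs).map g) :
    bad w I ε (T + 1) c = (∑ n ∈ s, bad w I ε T (g n)) / s.card := by
  classical
  unfold bad
  rw [run, h, PMF.bind_map, PMF.toOuterMeasure_bind_apply,
    tsum_eq_sum (s := s) (fun b hb => by simp [PMF.uniformOfFinset_apply, hb]),
    ENNReal.toReal_sum, Finset.sum_div]
  · refine Finset.sum_congr rfl fun n hn => ?_
    simp [PMF.uniformOfFinset_apply, hn, ENNReal.toReal_mul, div_eq_inv_mul]
  · intro a ha
    exact ENNReal.mul_ne_top (PMF.apply_ne_top _ _)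
      (ne_top_of_le_ne_top ENNReal.one_ne_top (toOuterMeasure_le_one _ _))

/-- A good configuration has an empty stack and is therefore never left. This allows all time bounds
to be rounded up freely. -/
lemma bad_succ_le (T : ℕ) (c : Config) : bad w I ε (T + 1) c ≤ bad w I ε T c := by
  induction T generalizing c with
  | zero =>
    by_cases hc : Good ε I c
    · rw [bad_succ_of_step_pure (c' := c) (by simp [step, hc.1])]
    · rw [bad_zero_of_not_good hc]
      exact bad_le_one _ _
  | succ T ih =>
    have key : (run w I (T + 1 + 1) c).toOuterMeasure {c | ¬ Good ε I c} ≤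
        (run w I (T + 1) c).toOuterMeasure {c | ¬ Good ε I c} := by
      rw [run, run, PMF.toOuterMeasure_bind_apply, PMF.toOuterMeasure_bind_apply]
      refine ENNReal.tsum_le_tsum fun a => ?_
      refine mul_le_mul' le_rfl ?_
      rw [← ofReal_bad, ← ofReal_bad]
      exact ENNReal.ofReal_le_ofReal (ih a)
    exact ENNReal.toReal_mono
      (ne_top_of_le_ne_top ENNReal.one_ne_top (toOuterMeasure_le_one _ _)) key

lemma bad_antitone (c : Config) : Antitone fun T => bad w I ε T c :=
  antitone_nat_of_succ_le fun T => bad_succ_le T c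

/-- An upper bound for the number of steps of a program without loops. -/
def cost : Program → ℕ
  | .seq P Q => cost P + cost Q + 1
  | .ite _ _ _ P Q => max (cost P) (cost Q) + 1
  | .loop _ _ _ _ => 0
  | _ => 1

/-- The expected value of `F`, a function with values in `[0, 1]`, after the execution of a
program.  For the statements `loop` and `sample` this is the trivial bound `1`. -/
def wp (w : ℕ) (I : Instance) : Program → (Store → ℝ) → Store → ℝ
  | .skip, F, s => F s
  | .seq P Q, F, s => wp w I P (wp w I Q F) s
  | .ite c u v P Q, F, s =>
      if c.eval (u.eval w s) (v.eval w s) then wp w I P F s else wp w I Q F s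
  | .loop _ _ _ _, _, _ => 1
  | .op o x u v, F, s => F (s.setReg w x (o.eval w (u.eval w s) (v.eval w s)))
  | .load x A i, F, s => F (s.setReg w x (s.mem A (i.eval w s)))
  | .store A i u, F, s => F (s.setMem w A (i.eval w s) (u.eval w s))
  | .randInt x u v, F, s =>
      if (Finset.Icc (u.eval w s) (v.eval w s)).Nonempty then
        (∑ n ∈ Finset.Icc (u.eval w s) (v.eval w s), F (s.setReg w x n)) /
          (Finset.Icc (u.eval w s) (v.eval w s)).card
      else F s
  | .sample _ _ _, _, _ => 1
  | .degree r p q x, F, s => F (s.setReg w x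
        ((I.rel r).degree (p.map (Operand.eval w s)) (q.map (Operand.eval w s))))
  | .neighbor r p q j x y, F, s =>
      match j.eval w s with
      | 0 => F s
      | i + 1 =>
        match ((I.rel r).nbrs (p.map (Operand.eval w s)) (q.map (Operand.eval w s)))[i]? with
        | none => F s
        | some t => F ((s.setReg w x t.1).setReg w y t.2)
  | .test r u v x, F, s => F (s.setReg w x
        (if (u.eval w s, v.eval w s) ∈ (I.rel r).tuples then 1 else 0))

lemma wp_mono (P : Program) {F G : Store → ℝ} (h : ∀ s, F s ≤ G s) (s : Store) :
    wp w I P F s ≤ wp w I P G s := by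
  induction P generalizing F G s with
  | seq P Q hP hQ => exact hP (fun s => hQ h s) s
  | ite c u v P Q hP hQ =>
    simp only [wp]
    split_ifs
    exacts [hP h s, hQ h s]
  | randInt x u v =>
    simp only [wp]
    split_ifs
    · gcongr
      exact h _
    · exact h s
  | neighbor r p q j x y =>
    simp only [wp]
    split
    · exact h s
    · split <;> exact h _
  | _ => first | exact h _ | exact le_rfl

/-- The bridge from the step semantics to expectations: the failure probability of the continuation
`k` serves as the postcondition. Branches shorter than the allotted time are padded by
`bad_antitone`; `loop` and `sample` are covered only by the trivial value 1, so loops have to be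
unrolled separately. -/
lemma bad_le_wp (P : Program) (k : List Program) (T : ℕ) (s : Store) :
    bad w I ε (T + cost P) ⟨P :: k, s⟩ ≤ wp w I P (fun s' => bad w I ε T ⟨k, s'⟩) s := by
  induction P generalizing k T s with
  | seq P Q hP hQ =>
    have : T + cost (.seq P Q) = (T + cost Q + cost P) + 1 := by simp [cost]; ring
    rw [this, bad_succ_of_step_pure (c' := ⟨P :: Q :: k, s⟩) rfl]
    exact (hP _ _ _).trans (wp_mono P (fun s => hQ _ _ _) s)
  | ite c u v P Q hP hQ =>
    rw [show T + cost (.ite c u v P Q) = (T + max (cost P) (cost Q)) + 1 from rfl,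
      bad_succ_of_step_pure rfl]
    simp only [wp]
    split_ifs
    · exact (bad_antitone _ (by gcongr; exact le_max_left _ _)).trans (hP _ _ _)
    · exact (bad_antitone _ (by gcongr; exact le_max_right _ _)).trans (hQ _ _ _)
  | randInt x u v =>
    simp only [wp, cost]
    split_ifs with h
    · exact (bad_succ_of_step_uniform h _ (by simp only [step, exec, dif_pos h])).le
    · exact (bad_succ_of_step_pure (by simp only [step, exec, dif_neg h])).le
  | neighbor r p q j x y =>
    simp only [wp, cost]
    split
    · rename_i hj
      exact (bad_succ_of_step_pure (by simp only [step, exec, hj])).le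
    · rename_i i hj
      split
      · rename_i ht
        exact (bad_succ_of_step_pure (by simp only [step, exec, hj, ht])).le
      · rename_i t ht
        exact (bad_succ_of_step_pure (by simp only [step, exec, hj, ht])).le
  | loop c u v P => exact bad_le_one _ _
  | sample r x y => exact bad_le_one _ _
  | _ => exact (bad_succ_of_step_pure rfl).le

lemma bad_loop_of_true {c : Cmp} {u v : Operand} {P : Program} {k : List Program} {T : ℕ}
    {s : Store} (h : c.eval (u.eval w s) (v.eval w s) = true) :
    bad w I ε (T + 1) ⟨.loop c u v P :: k, s⟩ = bad w I ε T ⟨P :: .loop c u v P :: k, s⟩ :=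
  bad_succ_of_step_pure (by simp only [step, exec, h, if_true])

lemma bad_loop_of_false {c : Cmp} {u v : Operand} {P : Program} {k : List Program} {T : ℕ}
    {s : Store} (h : c.eval (u.eval w s) (v.eval w s) = false) :
    bad w I ε (T + 1) ⟨.loop c u v P :: k, s⟩ = bad w I ε T ⟨k, s⟩ :=
  bad_succ_of_step_pure (by simp only [step, exec, h, if_false, Bool.false_eq_true])

lemma bad_nil_of_good {T : ℕ} {s : Store} (h : Good ε I ⟨[], s⟩) :
    bad w I ε T ⟨[], s⟩ = 0 :=
  le_antisymm ((bad_antitone _ (Nat.zero_le T)).trans_eq (bad_zero_of_good h)) (bad_nonneg _ _)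

lemma one_sub_bad_le (T : ℕ) (c : Config) {δ : ℝ} (h : bad w I ε T c ≤ δ) :
    ENNReal.ofReal (1 - δ) ≤ (run w I T c).toOuterMeasure {c | Good ε I c} := by
  have h1 : (1 : ENNReal) ≤ (run w I T c).toOuterMeasure {c | Good ε I c} +
      (run w I T c).toOuterMeasure {c | ¬ Good ε I c} := by
    have hu : (run w I T c).toOuterMeasure Set.univ = 1 := by
      rw [PMF.toOuterMeasure_apply_eq_one_iff]; exact Set.subset_univ _
    rw [← hu]
    refine le_trans (le_of_eq ?_) (MeasureTheory.measure_union_le _ _)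
    congr 1
    ext c
    simp [em]
  rw [← ofReal_bad] at h1
  have h2 := bad_nonneg (w := w) (I := I) (ε := ε) T c
  rw [ENNReal.ofReal_sub _ (h2.trans h), ENNReal.ofReal_one, tsub_le_iff_right]
  exact h1.trans (by gcongr)

end

/-! ### The join and its projection -/

lemma StoredRel.degree_eq_length (R : StoredRel) (p q : Option ℕ) :
    R.degree p q = (R.nbrs p q).length := by
  classical
  rw [← List.toFinset_card_of_nodup (R.nbrs_nodup p q), StoredRel.degree]
  congr 1
  ext t
  simp [R.mem_nbrs]

lemma StoredRel.degree_le (R : StoredRel) (p q : Option ℕ) : R.degree p q ≤ R.tuples.card := by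
  classical
  exact Finset.card_filter_le _ _

lemma StoredRel.length_nbrs_none (R : StoredRel) :
    (R.nbrs none none).length = R.tuples.card := by
  rw [← List.toFinset_card_of_nodup (R.nbrs_nodup _ _)]
  congr 1
  ext t
  simp [R.mem_nbrs, Matches]

lemma StoredRel.toFinset_nbrs_none (R : StoredRel) : (R.nbrs none none).toFinset = R.tuples := by
  ext t
  simp [R.mem_nbrs, Matches]

lemma StoredRel.toFinset_nbrs_left (R : StoredRel) (a : ℕ) :
    (R.nbrs (some a) none).toFinset = R.tuples.filter (fun t => t.1 = a) := by
  ext t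
  simp [R.mem_nbrs, Matches, eq_comm]

lemma StoredRel.toFinset_nbrs_right (R : StoredRel) (a : ℕ) :
    (R.nbrs none (some a)).toFinset = R.tuples.filter (fun t => t.2 = a) := by
  ext t
  simp [R.mem_nbrs, Matches, eq_comm]

lemma StoredRel.degree_left (R : StoredRel) (a : ℕ) :
    R.degree (some a) none = (R.tuples.filter (fun t => t.1 = a)).card := by
  rw [R.degree_eq_length, ← List.toFinset_card_of_nodup (R.nbrs_nodup _ _), R.toFinset_nbrs_left]

lemma StoredRel.degree_right (R : StoredRel) (a : ℕ) :
    R.degree none (some a) = (R.tuples.filter (fun t => t.2 = a)).card := by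
  rw [R.degree_eq_length, ← List.toFinset_card_of_nodup (R.nbrs_nodup _ _), R.toFinset_nbrs_right]

lemma sum_Icc_one (K : ℕ) (f : ℕ → ℝ) :
    ∑ v ∈ Finset.Icc 1 K, f v = ∑ i ∈ Finset.range K, f (i + 1) := by
  rw [Finset.range_eq_Ico, Finset.sum_Ico_add' f 0 K 1]
  rfl

/-- Indices beyond the end of the list contribute `H none = 0`. Thus a uniform index from a range
longer than a neighbor list still hits every neighbor equally often. -/
lemma sum_range_getElem? {α : Type*} [DecidableEq α] (l : List α) (hl : l.Nodup) (K : ℕ)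
    (hK : l.length ≤ K) (H : Option α → ℝ) (h0 : H none = 0) :
    ∑ i ∈ Finset.range K, H l[i]? = ∑ t ∈ l.toFinset, H (some t) := by
  induction l generalizing K with
  | nil => simp [h0]
  | cons a l ih =>
    obtain ⟨K, rfl⟩ : ∃ K', K = K' + 1 := ⟨K - 1, by simp at hK; omega⟩
    rw [List.nodup_cons] at hl
    rw [Finset.sum_range_succ', List.toFinset_cons, Finset.sum_insert (by simpa using hl.1),
      add_comm]
    simp only [List.getElem?_cons_succ, List.getElem?_cons_zero]
    rw [ih hl.2 K (by simpa using hK)]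

lemma sum_Icc_getElem? {α : Type*} [DecidableEq α] (l : List α) (hl : l.Nodup) (K : ℕ)
    (hK : l.length ≤ K) (H : Option α → ℝ) (h0 : H none = 0) :
    ∑ v ∈ Finset.Icc 1 K, H l[v - 1]? = ∑ t ∈ l.toFinset, H (some t) := by
  rw [sum_Icc_one, ← sum_range_getElem? l hl K hK H h0]
  simp

/-- A result of the natural join, given by its tuples of `R₁` and `R₂`. -/
abbrev JoinTuple := (ℕ × ℕ) × (ℕ × ℕ)

/-- The pair of `A`- and `C`-values of a join result. -/
def JoinTuple.ends (x : JoinTuple) : ℕ × ℕ := (x.1.1, x.2.2)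

namespace Instance

variable (I : Instance)

/-- The natural join of the two relations. -/
def joined : Finset JoinTuple :=
  (I.R₁.tuples ×ˢ I.R₂.tuples).filter (fun t => t.1.2 = t.2.1)

/-- The number of join results over a pair of `A`- and `C`-values. -/
def wit (p : ℕ × ℕ) : ℕ := (I.joined.filter (fun x => x.ends = p)).card

/-- The smaller degree of a pair of `A`- and `C`-values. -/
def minDeg (p : ℕ × ℕ) : ℕ := min (I.R₁.degree (some p.1) none) (I.R₂.degree none (some p.2))

/-- The join result that is found from the `u`-th tuple of the two relations and the `v`-th tuple
of the other relation that joins with it, where every `B`-value is used in the direction in which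
it has fewer extensions. -/
def pick (u v : ℕ) : Option JoinTuple :=
  if I.R₁.tuples.card < u then
    (I.R₂.nbrs none none)[u - I.R₁.tuples.card - 1]?.bind fun t =>
      if I.R₁.degree none (some t.1) < I.R₂.degree (some t.1) none then
        (I.R₁.nbrs none (some t.1))[v - 1]?.map fun t' => (t', t)
      else none
  else
    (I.R₁.nbrs none none)[u - 1]?.bind fun t =>
      if I.R₁.degree none (some t.2) < I.R₂.degree (some t.2) none then none
      else (I.R₂.nbrs (some t.2) none)[v - 1]?.map fun t' => (t, t')

lemma ends_mem_result {x : JoinTuple} (hx : x ∈ I.joined) : x.ends ∈ I.result :=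
  Finset.mem_image_of_mem _ hx

lemma mem_joined {x : JoinTuple} :
    x ∈ I.joined ↔ (x.1 ∈ I.R₁.tuples ∧ x.2 ∈ I.R₂.tuples) ∧ x.1.2 = x.2.1 := by
  simp [joined]

/-- Each join result arises from exactly one pair (u,v): the degrees of its b decide which of its
two tuples is numbered by u (a tie favors R₁), and v is the position of the other tuple among the
matches, at most τ by `hτ`. After division by N·τ this is uniform sampling. -/
lemma sum_pick (τ : ℕ) (H : Option JoinTuple → ℝ) (h0 : H none = 0)
    (hτ : ∀ b, min (I.R₁.degree none (some b)) (I.R₂.degree (some b) none) ≤ τ) :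
    ∑ u ∈ Finset.Icc 1 I.size, ∑ v ∈ Finset.Icc 1 τ, H (I.pick u v) =
      ∑ x ∈ I.joined, H (some x) := by
  have h1 : ∀ t ∈ I.R₁.tuples, (∑ v ∈ Finset.Icc 1 τ,
      H (if I.R₁.degree none (some t.2) < I.R₂.degree (some t.2) none then none
      else (I.R₂.nbrs (some t.2) none)[v - 1]?.map fun t' => (t, t'))) =
      ∑ t' ∈ I.R₂.tuples, if t.2 = t'.1 then
        (if I.R₁.degree none (some t.2) < I.R₂.degree (some t.2) none then 0
          else H (some (t, t'))) else 0 := by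
    intro t _
    split_ifs with h
    · simp [h0]
    · have := hτ t.2
      rw [min_eq_right (not_lt.1 h), StoredRel.degree_eq_length] at this
      rw [sum_Icc_getElem? _ (I.R₂.nbrs_nodup _ _) τ this (fun o => H (o.map fun t' => (t, t')))
        (by simp [h0]), StoredRel.toFinset_nbrs_left, Finset.sum_filter]
      simp [eq_comm]
  have h2 : ∀ t ∈ I.R₂.tuples, (∑ v ∈ Finset.Icc 1 τ,
      H (if I.R₁.degree none (some t.1) < I.R₂.degree (some t.1) none then
        (I.R₁.nbrs none (some t.1))[v - 1]?.map fun t' => (t', t) else none)) =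
      ∑ t' ∈ I.R₁.tuples, if t'.2 = t.1 then
        (if I.R₁.degree none (some t'.2) < I.R₂.degree (some t'.2) none then H (some (t', t))
          else 0) else 0 := by
    intro t _
    split_ifs with h
    · have := hτ t.1
      rw [min_eq_left h.le, StoredRel.degree_eq_length] at this
      rw [sum_Icc_getElem? _ (I.R₁.nbrs_nodup _ _) τ this (fun o => H (o.map fun t' => (t', t)))
        (by simp [h0]), StoredRel.toFinset_nbrs_right, Finset.sum_filter]
      refine Finset.sum_congr rfl fun t' _ => ?_
      split_ifs with h3 h4
      · rfl
      · rw [h3] at h4; exact absurd h h4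
      · rfl
    · rw [Finset.sum_eq_zero (fun v _ => h0), Finset.sum_eq_zero]
      intro t' _
      split_ifs with h3 h4
      · rw [h3] at h4; exact absurd h4 h
      · rfl
      · rfl
  rw [sum_Icc_one, Instance.size, Finset.sum_range_add, joined, Finset.sum_filter,
    Finset.sum_product]
  -- The inner sums as functions of an optional tuple, so that the lemma on list indices also
  -- applies to the outer index u.
  let G₁ : Option (ℕ × ℕ) → ℝ := fun o => ∑ v ∈ Finset.Icc 1 τ, H (o.bind fun t =>
    if I.R₁.degree none (some t.2) < I.R₂.degree (some t.2) none then none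
    else (I.R₂.nbrs (some t.2) none)[v - 1]?.map fun t' => (t, t'))
  let G₂ : Option (ℕ × ℕ) → ℝ := fun o => ∑ v ∈ Finset.Icc 1 τ, H (o.bind fun t =>
    if I.R₁.degree none (some t.1) < I.R₂.degree (some t.1) none then
      (I.R₁.nbrs none (some t.1))[v - 1]?.map fun t' => (t', t) else none)
  have e1 : ∀ i ∈ Finset.range I.R₁.tuples.card, ∑ v ∈ Finset.Icc 1 τ, H (I.pick (i + 1) v) =
      G₁ (I.R₁.nbrs none none)[i]? := by
    intro i hi
    rw [Finset.mem_range] at hi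
    simp only [G₁, pick, if_neg (show ¬ I.R₁.tuples.card < i + 1 by omega), Nat.add_sub_cancel]
  have e2 : ∀ i ∈ Finset.range I.R₂.tuples.card,
      ∑ v ∈ Finset.Icc 1 τ, H (I.pick (I.R₁.tuples.card + i + 1) v) =
      G₂ (I.R₂.nbrs none none)[i]? := by
    intro i _
    simp only [G₂, pick, if_pos (show I.R₁.tuples.card < I.R₁.tuples.card + i + 1 by omega),
      show I.R₁.tuples.card + i + 1 - I.R₁.tuples.card - 1 = i by omega]
  rw [Finset.sum_congr rfl e1, Finset.sum_congr rfl e2,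
    sum_range_getElem? _ (I.R₁.nbrs_nodup _ _) _ I.R₁.length_nbrs_none.le G₁ (by simp [G₁, h0]),
    sum_range_getElem? _ (I.R₂.nbrs_nodup _ _) _ I.R₂.length_nbrs_none.le G₂ (by simp [G₂, h0]),
    StoredRel.toFinset_nbrs_none, StoredRel.toFinset_nbrs_none]
  simp only [G₁, G₂, Option.bind_some]
  rw [Finset.sum_congr rfl h1, Finset.sum_congr rfl h2, Finset.sum_comm (s := I.R₂.tuples),
    ← Finset.sum_add_distrib]
  refine Finset.sum_congr rfl fun t _ => ?_
  rw [← Finset.sum_add_distrib]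
  refine Finset.sum_congr rfl fun t' _ => ?_
  -- The two orientation tests are complementary, so exactly one of the two summands survives for a
  -- joining pair.
  split_ifs <;> simp

lemma pick_mem_joined {u v : ℕ} {x : JoinTuple} (h : I.pick u v = some x) : x ∈ I.joined := by
  unfold pick at h
  rw [mem_joined]
  split_ifs at h with h1
  · simp only [Option.bind_eq_some_iff] at h
    obtain ⟨t, ht, h⟩ := h
    split_ifs at h with h2
    simp only [Option.map_eq_some_iff] at h
    obtain ⟨t', ht', rfl⟩ := h
    have h3 := (I.R₂.mem_nbrs _ _ _).1 (List.mem_of_getElem? ht)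
    have h4 := (I.R₁.mem_nbrs _ _ _).1 (List.mem_of_getElem? ht')
    exact ⟨⟨h4.1, h3.1⟩, h4.2.2 _ rfl⟩
  · simp only [Option.bind_eq_some_iff] at h
    obtain ⟨t, ht, h⟩ := h
    split_ifs at h with h2
    simp only [Option.map_eq_some_iff] at h
    obtain ⟨t', ht', rfl⟩ := h
    have h3 := (I.R₁.mem_nbrs _ _ _).1 (List.mem_of_getElem? ht)
    have h4 := (I.R₂.mem_nbrs _ _ _).1 (List.mem_of_getElem? ht')
    exact ⟨⟨h3.1, h4.1⟩, (h4.2.1 _ rfl).symm⟩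

lemma wit_pos {x : JoinTuple} (hx : x ∈ I.joined) : 0 < I.wit x.ends :=
  Finset.card_pos.2 ⟨x, by simp [hx]⟩

/-- Averaging over the witnesses turns a sum over the join into a sum over the query result. -/
lemma sum_joined_div_wit (g : ℕ × ℕ → ℝ) :
    ∑ x ∈ I.joined, g x.ends / I.wit x.ends = ∑ p ∈ I.result, g p := by
  rw [← Finset.sum_fiberwise_of_maps_to (fun x hx => I.ends_mem_result hx)]
  refine Finset.sum_congr rfl fun p hp => ?_
  rw [Finset.sum_congr rfl (g := fun _ => g p / I.wit p)
    (fun x hx => by rw [(Finset.mem_filter.1 hx).2]), Finset.sum_const, nsmul_eq_mul]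
  obtain ⟨x, hx, rfl⟩ := Finset.mem_image.1 hp
  have : (I.wit (x.1.1, x.2.2) : ℝ) ≠ 0 := by
    have := I.wit_pos hx
    exact_mod_cast this.ne'
  change (I.wit (x.1.1, x.2.2) : ℝ) * _ = _
  field_simp

/-- A join result over (a,c) is determined by its tuple of R₁. Hence a uniform tuple with A-value a
passes the membership test with probability W divided by the degree of a. -/
lemma wit_eq_left (a c : ℕ) : I.wit (a, c) =
    ((I.R₁.tuples.filter (fun t => t.1 = a)).filter (fun t => (t.2, c) ∈ I.R₂.tuples)).card := by
  refine Finset.card_bij' (fun x _ => x.1) (fun t _ => (t, (t.2, c))) ?_ ?_ ?_ ?_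
  · rintro ⟨⟨a', b⟩, ⟨b', c'⟩⟩ hx
    simp only [Finset.mem_filter, mem_joined, JoinTuple.ends, Prod.mk.injEq] at hx ⊢
    obtain ⟨⟨⟨h1, h2⟩, rfl⟩, rfl, rfl⟩ := hx
    exact ⟨⟨h1, rfl⟩, h2⟩
  · rintro ⟨a', b⟩ hx
    simp only [Finset.mem_filter, mem_joined, JoinTuple.ends, Prod.mk.injEq] at hx ⊢
    obtain ⟨⟨h1, rfl⟩, h2⟩ := hx
    simp [h1, h2]
  · rintro ⟨⟨a', b⟩, ⟨b', c'⟩⟩ hx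
    simp only [Finset.mem_filter, mem_joined, JoinTuple.ends, Prod.mk.injEq] at hx ⊢
    simp_all
  · intros; rfl

lemma wit_eq_right (a c : ℕ) : I.wit (a, c) =
    ((I.R₂.tuples.filter (fun t => t.2 = c)).filter (fun t => (a, t.1) ∈ I.R₁.tuples)).card := by
  refine Finset.card_bij' (fun x _ => x.2) (fun t _ => ((a, t.1), t)) ?_ ?_ ?_ ?_
  · rintro ⟨⟨a', b⟩, ⟨b', c'⟩⟩ hx
    simp only [Finset.mem_filter, mem_joined, JoinTuple.ends, Prod.mk.injEq] at hx ⊢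
    obtain ⟨⟨⟨h1, h2⟩, rfl⟩, rfl, rfl⟩ := hx
    exact ⟨⟨h2, rfl⟩, h1⟩
  · rintro ⟨a', b⟩ hx
    simp only [Finset.mem_filter, mem_joined, JoinTuple.ends, Prod.mk.injEq] at hx ⊢
    obtain ⟨⟨h1, rfl⟩, h2⟩ := hx
    simp [h1, h2]
  · rintro ⟨⟨a', b⟩, ⟨b', c'⟩⟩ hx
    simp only [Finset.mem_filter, mem_joined, JoinTuple.ends, Prod.mk.injEq] at hx ⊢
    simp_all
  · intros; rfl

/-! ### Degrees against the output size. -/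

lemma wit_le_minDeg (p : ℕ × ℕ) : I.wit p ≤ I.minDeg p := by
  obtain ⟨a, c⟩ := p
  refine le_min ?_ ?_
  · rw [wit_eq_left, StoredRel.degree_left]
    exact Finset.card_le_card (Finset.filter_subset _ _)
  · rw [wit_eq_right, StoredRel.degree_right]
    exact Finset.card_le_card (Finset.filter_subset _ _)

/-- Every A-neighbor of b combines with every C-neighbor of b to a result, and for fixed b different
combinations give different results. -/
lemma degree_mul_degree_le_out (b : ℕ) :
    I.R₁.degree none (some b) * I.R₂.degree (some b) none ≤ I.out := by
  rw [StoredRel.degree_left, StoredRel.degree_right, ← Finset.card_product]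
  refine Finset.card_le_card_of_injOn JoinTuple.ends ?_ ?_
  · rintro ⟨⟨a, b₁⟩, ⟨b₂, c⟩⟩ hx
    simp only [Finset.coe_product, Finset.coe_filter, Set.mem_prod, Set.mem_ofPred_eq] at hx
    exact I.ends_mem_result (I.mem_joined.2 ⟨⟨hx.1.1, hx.2.1⟩, hx.1.2.trans hx.2.2.symm⟩)
  · rintro ⟨⟨a, b₁⟩, ⟨b₂, c⟩⟩ hx ⟨⟨a', b₁'⟩, ⟨b₂', c'⟩⟩ hx' h
    simp only [Finset.coe_product, Finset.coe_filter, Set.mem_prod, Set.mem_ofPred_eq] at hx hx'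
    simp only [JoinTuple.ends, Prod.mk.injEq] at h ⊢
    exact ⟨⟨h.1, hx.1.2.trans hx'.1.2.symm⟩, hx.2.2.trans hx'.2.2.symm, h.2⟩

lemma min_degree_le {τ : ℕ} (hτ : I.out ≤ τ ^ 2) (b : ℕ) :
    min (I.R₁.degree none (some b)) (I.R₂.degree (some b) none) ≤ τ := by
  refine (Nat.pow_le_pow_iff_left two_ne_zero).1 ?_
  calc _ ≤ I.R₁.degree none (some b) * I.R₂.degree (some b) none := by
        rw [sq]; exact Nat.mul_le_mul (min_le_left _ _) (min_le_right _ _)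
    _ ≤ _ := (I.degree_mul_degree_le_out b).trans hτ

lemma out_le_card_mul_card : I.out ≤ I.R₁.tuples.card * I.R₂.tuples.card :=
  Finset.card_image_le.trans ((Finset.card_filter_le _ _).trans (Finset.card_product _ _).le)

lemma out_le_size_sq : I.out ≤ I.size ^ 2 :=
  I.out_le_card_mul_card.trans (by
    rw [sq]; exact Nat.mul_le_mul (Nat.le_add_right _ _) (Nat.le_add_left _ _))

/-- The product of the two degrees of (a,c) counts the pairs of tuples with these outer values,
whether they join or not; these sets are disjoint parts of R₁ × R₂. -/
lemma sum_degree_mul_degree_le : ∑ p ∈ I.result,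
    I.R₁.degree (some p.1) none * I.R₂.degree none (some p.2) ≤
      I.R₁.tuples.card * I.R₂.tuples.card := by
  rw [← Finset.card_product]
  calc _ = ∑ p ∈ I.result,
        ((I.R₁.tuples ×ˢ I.R₂.tuples).filter (fun t => (t.1.1, t.2.2) = p)).card := by
        refine Finset.sum_congr rfl fun p _ => ?_
        rw [StoredRel.degree_left, StoredRel.degree_right, ← Finset.card_product]
        congr 1
        ext ⟨⟨a, b⟩, ⟨b', c⟩⟩
        simp only [Finset.mem_product, Finset.mem_filter, Prod.ext_iff]
        tauto
    _ = ((I.R₁.tuples ×ˢ I.R₂.tuples).filter (fun t => (t.1.1, t.2.2) ∈ I.result)).card := by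
        refine Eq.symm ((Finset.card_eq_sum_card_fiberwise
          (f := fun t : JoinTuple => (t.1.1, t.2.2)) (t := I.result)
          (fun x hx => (Finset.mem_filter.1 hx).2)).trans ?_)
        refine Finset.sum_congr rfl fun p hp => ?_
        rw [Finset.filter_filter]
        congr 1
        ext x
        simp only [Finset.mem_filter]
        constructor
        · rintro ⟨h1, _, rfl⟩; exact ⟨h1, rfl⟩
        · rintro ⟨h1, rfl⟩; exact ⟨h1, hp, rfl⟩
    _ ≤ _ := Finset.card_filter_le _ _

/-- Cauchy–Schwarz over the OUT results, with the square of the smaller degree bounded by the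
product of both. -/
lemma sum_minDeg_sq_le :
    (∑ p ∈ I.result, (I.minDeg p : ℝ)) ^ 2 ≤ I.out * (I.size : ℝ) ^ 2 := by
  refine (sq_sum_le_card_mul_sum_sq).trans ?_
  have h : ∑ p ∈ I.result, I.minDeg p ^ 2 ≤ I.size ^ 2 := by
    calc _ ≤ ∑ p ∈ I.result, I.R₁.degree (some p.1) none * I.R₂.degree none (some p.2) :=
          Finset.sum_le_sum fun p _ => by
            rw [sq]; exact Nat.mul_le_mul (min_le_left _ _) (min_le_right _ _)
      _ ≤ _ := I.sum_degree_mul_degree_le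
      _ ≤ _ := by rw [sq]; exact Nat.mul_le_mul (Nat.le_add_right _ _) (Nat.le_add_left _ _)
  gcongr
  · rfl
  · exact_mod_cast h

/-- Divided by N·τ, this says that a sample costs at most one witness trial on average. -/
lemma sum_minDeg_le {τ : ℕ} (hτ : I.out ≤ τ ^ 2) :
    ∑ p ∈ I.result, (I.minDeg p : ℝ) ≤ I.size * τ := by
  refine abs_le_of_sq_le_sq' (I.sum_minDeg_sq_le.trans ?_) (by positivity) |>.2
  rw [mul_pow, mul_comm]
  gcongr
  exact_mod_cast hτ

end Instance

/-! ### The sampling process and its potentials -/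

/-- A state of the sampling process: `n` samples are still to be drawn, `S` samples have been
accepted, and `cur` holds the join result that is being examined together with the number of
witness trials spent on it. -/
structure Sim where
  n : ℕ
  S : ℕ
  cur : Option (JoinTuple × ℕ)

/-- The join result under examination exists, and its trials are not exhausted. -/
def Sim.Wf (I : Instance) (B : ℕ) (σ : Sim) : Prop :=
  ∀ x t, σ.cur = some (x, t) → x ∈ I.joined ∧ t < B

/-- The expected value of `G` after one step of the sampling process. -/
def astep (I : Instance) (τ B : ℕ) (G : Sim → ℝ) : Sim → ℝ
  | ⟨0, S, none⟩ => G ⟨0, S, none⟩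
  | ⟨n + 1, S, none⟩ =>
      (∑ u ∈ Finset.Icc 1 I.size,
        (∑ v ∈ Finset.Icc 1 τ, G ⟨n, S, (I.pick u v).map fun x => (x, 0)⟩) / τ) / I.size
  | ⟨n, S, some (x, t)⟩ =>
      (G ⟨n, S + 1, none⟩ + (I.wit x.ends - 1 : ℝ) * G ⟨n, S, none⟩ +
        (I.minDeg x.ends - I.wit x.ends : ℝ) *
          G ⟨n, S, if t + 1 < B then some (x, t + 1) else none⟩) / I.minDeg x.ends

section

variable {I : Instance} {τ B : ℕ}

/-- A gain proportional to 1/W on every join result averages to a sum over the query result. All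
three potentials are controlled across a draw in this way. -/
lemma avg_pick_le (hN : 0 < I.size) (hτ0 : 0 < τ) (hτ : I.out ≤ τ ^ 2)
    {f : Option JoinTuple → ℝ} {A K : ℝ} {g : ℕ × ℕ → ℝ} (hnone : f none ≤ A)
    (hsome : ∀ x ∈ I.joined, f (some x) ≤ A + K * (g x.ends / I.wit x.ends)) :
    (∑ u ∈ Finset.Icc 1 I.size, (∑ v ∈ Finset.Icc 1 τ, f (I.pick u v)) / τ) / I.size ≤
      A + K * (∑ p ∈ I.result, g p) / (I.size * τ) := by
  have hN' : (0 : ℝ) < I.size := by exact_mod_cast hN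
  have hτ' : (0 : ℝ) < τ := by exact_mod_cast hτ0
  let H : Option JoinTuple → ℝ := fun o => o.elim 0 fun x => K * (g x.ends / I.wit x.ends)
  have h1 : ∀ u v, f (I.pick u v) ≤ A + H (I.pick u v) := by
    intro u v
    cases h : I.pick u v with
    | none => simpa [H] using hnone
    | some x => exact hsome x (I.pick_mem_joined h)
  have h2 : ∑ u ∈ Finset.Icc 1 I.size, ∑ v ∈ Finset.Icc 1 τ, f (I.pick u v) ≤
      I.size * τ * A + K * ∑ p ∈ I.result, g p := by
    calc _ ≤ ∑ u ∈ Finset.Icc 1 I.size, ∑ v ∈ Finset.Icc 1 τ, (A + H (I.pick u v)) :=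
          Finset.sum_le_sum fun u _ => Finset.sum_le_sum fun v _ => h1 u v
      _ = _ := by
        simp only [Finset.sum_add_distrib]
        rw [I.sum_pick τ H rfl (I.min_degree_le hτ), ← I.sum_joined_div_wit, Finset.mul_sum]
        simp [H]
        ring
  rw [← Finset.sum_div, div_div, div_le_iff₀ (by positivity)]
  refine h2.trans (le_of_eq ?_)
  field_simp

lemma wit_bounds {x : JoinTuple} (hx : x ∈ I.joined) :
    (1 : ℝ) ≤ I.wit x.ends ∧ (I.wit x.ends : ℝ) ≤ I.minDeg x.ends :=
  ⟨by exact_mod_cast I.wit_pos hx, by exact_mod_cast I.wit_le_minDeg _⟩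

lemma astep_add (F G : Sim → ℝ) (σ : Sim) :
    astep I τ B (fun σ => F σ + G σ) σ = astep I τ B F σ + astep I τ B G σ := by
  rcases σ with ⟨_ | n, S, _ | ⟨x, t⟩⟩
  · rfl
  · simp only [astep]; ring
  · simp only [astep, Finset.sum_add_distrib, add_div]
  · simp only [astep]; ring

lemma astep_mul (F : Sim → ℝ) (c : ℝ) (σ : Sim) :
    astep I τ B (fun σ => c * F σ) σ = c * astep I τ B F σ := by
  rcases σ with ⟨_ | n, S, _ | ⟨x, t⟩⟩
  · rfl
  · simp only [astep]; ring
  · simp only [astep, ← Finset.mul_sum, mul_div_assoc]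
  · simp only [astep]; ring

/-- The weights of a step have total mass 1; well-formedness guarantees that the smaller degree is
not 0. -/
lemma astep_const (hN : 0 < I.size) (hτ0 : 0 < τ) (c : ℝ) {σ : Sim} (hσ : σ.Wf I B) :
    astep I τ B (fun _ => c) σ = c := by
  have hN' : (0 : ℝ) < I.size := by exact_mod_cast hN
  have hτ' : (0 : ℝ) < τ := by exact_mod_cast hτ0
  rcases σ with ⟨_ | n, S, _ | ⟨x, t⟩⟩
  · rfl
  · have h := wit_bounds (hσ x t rfl).1
    simp only [astep]
    rw [div_eq_iff (by linarith)]; ring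
  · simp [astep]
    field_simp
  · have h := wit_bounds (hσ x t rfl).1
    simp only [astep]
    rw [div_eq_iff (by linarith)]; ring

/-- The potential for the event that too many samples are accepted. -/
def potUpper (I : Instance) (p z : ℝ) : Sim → ℝ
  | ⟨n, S, none⟩ => (1 + p * (z - 1)) ^ n * z ^ S
  | ⟨n, S, some (x, _)⟩ => (1 + p * (z - 1)) ^ n * z ^ S * (1 + (z - 1) / I.wit x.ends)

/-- Without the cut-off a search accepts with probability exactly 1/W, and its potential is
preserved by a trial. The cut-off drops a chance of acceptance, which only lowers the potential as z
≥ 1. Averaging over a draw yields the factor 1 + p(z-1). -/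
lemma astep_potUpper_le (hN : 0 < I.size) (hτ0 : 0 < τ) (hτ : I.out ≤ τ ^ 2) {z : ℝ} (hz : 1 ≤ z)
    {σ : Sim} (hσ : σ.Wf I B) :
    astep I τ B (potUpper I (I.out / (I.size * τ)) z) σ ≤
      potUpper I (I.out / (I.size * τ)) z σ := by
  set p : ℝ := I.out / (I.size * τ) with hp
  have hp0 : 0 ≤ p := by positivity
  have hz1 : 0 ≤ z - 1 := by linarith
  have hz0 : 0 ≤ z := by linarith
  have search : ∀ n S x t, x ∈ I.joined →
      astep I τ B (potUpper I p z) ⟨n, S, some (x, t)⟩ ≤ potUpper I p z ⟨n, S, some (x, t)⟩ := by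
    intro n S x t hx
    obtain ⟨h1, h2⟩ := wit_bounds hx
    have h3 : potUpper I p z ⟨n, S, if t + 1 < B then some (x, t + 1) else none⟩ ≤
        (1 + p * (z - 1)) ^ n * z ^ S * (1 + (z - 1) / I.wit x.ends) := by
      split_ifs
      · exact le_rfl
      · exact le_mul_of_one_le_right
          (show 0 ≤ (1 + p * (z - 1)) ^ n * z ^ S by positivity)
          (le_add_of_nonneg_right (div_nonneg hz1 (by positivity)))
    simp only [astep]
    rw [div_le_iff₀ (by linarith)]
    refine (add_le_add_right (mul_le_mul_of_nonneg_left h3 (by linarith)) _).trans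
      (le_of_eq ?_)
    simp only [potUpper]
    field_simp
    ring
  rcases σ with ⟨_ | n, S, _ | ⟨x, t⟩⟩
  · rfl
  · exact search _ _ _ _ (hσ x t rfl).1
  · simp only [astep]
    refine (avg_pick_le hN hτ0 hτ (f := fun o => potUpper I p z ⟨n, S, o.map fun x => (x, 0)⟩)
      (A := (1 + p * (z - 1)) ^ n * z ^ S) (K := (1 + p * (z - 1)) ^ n * z ^ S * (z - 1))
      (g := fun _ => 1) le_rfl ?_).trans (le_of_eq ?_)
    · intro x _
      simp only [potUpper, Option.map_some]
      exact le_of_eq (by ring)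
    · simp only [potUpper, Finset.sum_const, nsmul_eq_mul, mul_one]
      rw [mul_div_assoc, show ((I.result.card : ℝ) / (I.size * τ)) = p from rfl]
      ring
  · exact search _ _ _ _ (hσ x t rfl).1

/-- The potential for the event that too few samples are accepted. -/
def potLower (I : Instance) (B : ℕ) (p z : ℝ) : Sim → ℝ
  | ⟨n, S, none⟩ => (1 - (1 - z) * p) ^ n * z ^ S
  | ⟨n, S, some (x, t)⟩ => (1 - (1 - z) * p) ^ n * z ^ S *
      (1 - (1 - z) / I.wit x.ends * (1 - (t + I.minDeg x.ends / I.wit x.ends) / B))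

lemma potLower_nonneg {p z : ℝ} (hp : p ≤ 1) (hz0 : 0 ≤ z) (hz : z ≤ 1) {σ : Sim}
    (hσ : σ.Wf I B) : 0 ≤ potLower I B p z σ := by
  have h0 : 0 ≤ 1 - (1 - z) * p := by nlinarith
  rcases σ with ⟨n, S, _ | ⟨x, t⟩⟩
  · simp only [potLower]; positivity
  · obtain ⟨h1, h2⟩ := wit_bounds (hσ x t rfl).1
    have h3 : (1 - z) / I.wit x.ends ≤ 1 := by
      rw [div_le_one (by linarith)]; linarith
    have h4 : 0 ≤ (1 - z) / I.wit x.ends := div_nonneg (by linarith) (by linarith)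
    have h5 : 0 ≤ (t + I.minDeg x.ends / I.wit x.ends : ℝ) / B := by positivity
    simp only [potLower]
    refine mul_nonneg (by positivity) ?_
    nlinarith

/-- Here the cut-off hurts. Writing d for the smaller degree, a search that has used t trials is
expected to use t + d/W in total, so by Markov's inequality it is cut off with probability at most
(t + d/W)/B; the potential reduces the acceptance probability 1/W by this factor. Averaged over a
draw, the loss is at most (∑ d)/B out of OUT, which is the form of `hp`. -/
lemma astep_potLower_le (hN : 0 < I.size) (hτ0 : 0 < τ) (hτ : I.out ≤ τ ^ 2) {z p : ℝ}
    (hz0 : 0 ≤ z) (hz : z ≤ 1) (hp1 : p ≤ 1)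
    (hp : p ≤ (I.out - (∑ q ∈ I.result, (I.minDeg q : ℝ)) / B) / (I.size * τ))
    {σ : Sim} (hσ : σ.Wf I B) :
    astep I τ B (potLower I B p z) σ ≤ potLower I B p z σ := by
  have h0 : 0 ≤ 1 - (1 - z) * p := by nlinarith
  have search : ∀ n S x t, x ∈ I.joined → t < B →
      astep I τ B (potLower I B p z) ⟨n, S, some (x, t)⟩ ≤
        potLower I B p z ⟨n, S, some (x, t)⟩ := by
    intro n S x t hx ht
    obtain ⟨h1, h2⟩ := wit_bounds hx
    have hB : (0 : ℝ) < B := by exact_mod_cast (Nat.zero_le t).trans_lt ht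
    have ht' : (t : ℝ) + 1 ≤ B := by exact_mod_cast ht
    set W : ℝ := (I.wit x.ends : ℝ)
    set d : ℝ := (I.minDeg x.ends : ℝ)
    set A : ℝ := (1 - (1 - z) * p) ^ n * z ^ S with hA
    have hA0 : 0 ≤ A := by positivity
    have hW : 0 < W := by linarith
    have hd : 0 < d := by linarith
    have h3 : potLower I B p z ⟨n, S, if t + 1 < B then some (x, t + 1) else none⟩ ≤
        A * (1 - (1 - z) / W * (1 - ((t + 1) + d / W) / B)) := by
      split_ifs with h
      · simp only [potLower, Nat.cast_add, Nat.cast_one]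
        exact le_rfl
      -- At the cut-off the Markov factor is negative, so the potential formula exceeds the value A
      -- of an abandoned sample.
      · have h4 : (t : ℝ) + 1 = B := by
          have : t + 1 = B := by omega
          exact_mod_cast this
        refine le_mul_of_one_le_right hA0 ?_
        rw [h4, add_div, div_self hB.ne']
        have : 0 ≤ (1 - z) / W * (d / W / B) :=
          mul_nonneg (div_nonneg (by linarith) hW.le) (by positivity)
        linarith
    -- One acceptance, W - 1 rejections and d - W failed trials reproduce the old potential up to a
    -- term of favorable sign.
    have h5 : A * z + (W - 1) * A + (d - W) * (A * (1 - (1 - z) / W * (1 - ((t + 1) + d / W) / B)))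
        = A * (1 - (1 - z) / W * (1 - (t + d / W) / B)) * d
          - A * (1 - z) * (t + 1) / B := by
      field_simp
      ring
    have h6 : 0 ≤ A * (1 - z) * (t + 1) / B :=
      div_nonneg (mul_nonneg (mul_nonneg hA0 (by linarith)) (by positivity)) hB.le
    simp only [astep]
    rw [div_le_iff₀ hd]
    refine (add_le_add_right (mul_le_mul_of_nonneg_left h3 (by linarith)) _).trans ?_
    have h7 : potLower I B p z ⟨n, S + 1, none⟩ = A * z := by
      simp only [potLower, hA, pow_succ]; ring
    rw [h7, show potLower I B p z ⟨n, S, none⟩ = A from rfl, h5,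
      show potLower I B p z ⟨n, S, some (x, t)⟩ = A * (1 - (1 - z) / W * (1 - (t + d / W) / B))
        from rfl]
    linarith
  rcases σ with ⟨_ | n, S, _ | ⟨x, t⟩⟩
  · rfl
  · exact search _ _ _ _ (hσ x t rfl).1 (hσ x t rfl).2
  · have hA0 : 0 ≤ (1 - (1 - z) * p) ^ n * z ^ S := by positivity
    simp only [astep]
    refine (avg_pick_le hN hτ0 hτ (f := fun o => potLower I B p z ⟨n, S, o.map fun x => (x, 0)⟩)
      (A := (1 - (1 - z) * p) ^ n * z ^ S) (K := (1 - (1 - z) * p) ^ n * z ^ S * (1 - z))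
      (g := fun q => I.minDeg q / B - 1) le_rfl ?_).trans ?_
    · intro x hx
      obtain ⟨h1, h2⟩ := wit_bounds hx
      have hW : (0 : ℝ) < I.wit x.ends := by linarith
      simp only [potLower, Option.map_some, Nat.cast_zero, zero_add]
      have h3 : (I.minDeg x.ends : ℝ) / I.wit x.ends ≤ I.minDeg x.ends :=
        div_le_self (by positivity) h1
      have h4 : (1 - (I.minDeg x.ends : ℝ) / B) / I.wit x.ends ≤
          1 / I.wit x.ends * (1 - (I.minDeg x.ends : ℝ) / I.wit x.ends / B) := by
        rw [div_mul_eq_mul_div, one_mul]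
        gcongr
      have h5 := mul_le_mul_of_nonneg_left h4
        (mul_nonneg hA0 (show 0 ≤ 1 - z by linarith))
      have e1 : (1 - (1 - z) * p) ^ n * z ^ S * (1 - (1 - z) / I.wit x.ends *
          (1 - (I.minDeg x.ends : ℝ) / I.wit x.ends / B)) = (1 - (1 - z) * p) ^ n * z ^ S -
          (1 - (1 - z) * p) ^ n * z ^ S * (1 - z) * (1 / I.wit x.ends *
          (1 - (I.minDeg x.ends : ℝ) / I.wit x.ends / B)) := by ring
      have e2 : (1 - (1 - z) * p) ^ n * z ^ S * (1 - z) *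
          ((I.minDeg x.ends / B - 1) / I.wit x.ends) = - ((1 - (1 - z) * p) ^ n * z ^ S * (1 - z) *
          ((1 - (I.minDeg x.ends : ℝ) / B) / I.wit x.ends)) := by ring
      rw [e1, e2]
      linarith
    · rw [mul_div_assoc, Finset.sum_sub_distrib, Finset.sum_const, nsmul_eq_mul, mul_one,
        ← Finset.sum_div, show (I.result.card : ℝ) = I.out from rfl]
      have h5 := mul_le_mul_of_nonneg_left hp
        (mul_nonneg hA0 (show 0 ≤ 1 - z by linarith))
      have e1 : ((∑ q ∈ I.result, (I.minDeg q : ℝ)) / B - I.out) / (I.size * τ) =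
          - ((I.out - (∑ q ∈ I.result, (I.minDeg q : ℝ)) / B) / (I.size * τ)) := by ring
      rw [e1]
      simp only [potLower, pow_succ (1 - (1 - z) * p)]
      linarith
  · exact search _ _ _ _ (hσ x t rfl).1 (hσ x t rfl).2

/-- The potential for the event that the process does not finish in the remaining `R` steps. -/
def potTime (I : Instance) (B : ℕ) (β : ℝ) (R : ℕ) : Sim → ℝ
  | ⟨0, _, none⟩ => 0
  | ⟨n + 1, _, none⟩ => β ^ (n + 1) * (2 : ℝ) ^ (((n + 1 : ℕ) - R : ℝ) / B)
  | ⟨n, _, some (x, t)⟩ => β ^ n * (2 : ℝ) ^ ((n - R - t : ℝ) / B) *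
      (1 + (t + I.minDeg x.ends / I.wit x.ends) / B)

lemma potTime_nonneg {β : ℝ} (hβ : 0 ≤ β) (R : ℕ) (σ : Sim) : 0 ≤ potTime I B β R σ := by
  rcases σ with ⟨_ | n, S, _ | ⟨x, t⟩⟩ <;> simp only [potTime] <;> positivity

lemma potTime_none_le {β : ℝ} (R n S : ℕ) :
    potTime I B β R ⟨n, S, none⟩ ≤ β ^ n * (2 : ℝ) ^ ((n - R : ℝ) / B) := by
  cases n with
  | zero => simp only [potTime]; positivity
  | succ n => exact le_rfl

/-- The chord bound for a convex function. It replaces the exponential moment of the number of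
trials by its mean; the cut-off at B keeps the argument in [0,1]. -/
lemma two_rpow_le {x : ℝ} (h0 : 0 ≤ x) (h1 : x ≤ 1) : (2 : ℝ) ^ x ≤ 1 + x := by
  have := rpow_one_add_le_one_add_mul_self (s := 1) (by norm_num) h0 h1
  rw [mul_one] at this
  norm_num at this ⊢
  exact this

/-- A step multiplies the weight by 2^(1/B), except that the step of a draw is paid by the decrease
of n. During a search n - R - t is frozen, and 1 + (t + d/W)/B stands for the expected factor
2^(trials/B), where d is the smaller degree. Since a sample has at most one trial on average, a draw
raises the potential by at most 1 + 1/B, which the power of β absorbs. -/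
lemma astep_potTime_le (hN : 0 < I.size) (hτ0 : 0 < τ) (hτ : I.out ≤ τ ^ 2) (hB : 0 < B) (R : ℕ)
    {σ : Sim} (hσ : σ.Wf I B) :
    astep I τ B (potTime I B (1 + 1 / B) R) σ ≤ potTime I B (1 + 1 / B) (R + 1) σ := by
  have hB' : (0 : ℝ) < B := by exact_mod_cast hB
  set β : ℝ := 1 + 1 / B with hβ
  have hβ0 : 0 < β := by positivity
  have search : ∀ n S x t, x ∈ I.joined → t < B →
      astep I τ B (potTime I B β R) ⟨n, S, some (x, t)⟩ ≤
        potTime I B β (R + 1) ⟨n, S, some (x, t)⟩ := by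
    intro n S x t hx ht
    obtain ⟨h1, h2⟩ := wit_bounds hx
    have ht' : (t : ℝ) + 1 ≤ B := by exact_mod_cast ht
    set W : ℝ := (I.wit x.ends : ℝ)
    set d : ℝ := (I.minDeg x.ends : ℝ)
    have hW : 0 < W := by linarith
    have hd : 0 < d := by linarith
    set A : ℝ := β ^ n * (2 : ℝ) ^ ((n - (R + 1 : ℕ) - t : ℝ) / B) with hA
    have hA0 : 0 ≤ A := by positivity
    have h3 : ∀ S, potTime I B β R ⟨n, S, none⟩ ≤ A * (1 + (t + 1) / B) := by
      intro S
      refine (potTime_none_le R n S).trans ?_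
      rw [hA, mul_assoc]
      refine mul_le_mul_of_nonneg_left ?_ (by positivity)
      -- The end of the search releases the t + 1 trials that the frozen exponent held back.
      rw [show ((n : ℝ) - R) / B = (n - (R + 1 : ℕ) - t : ℝ) / B + (t + 1) / B by
        push_cast; ring, Real.rpow_add two_pos]
      refine mul_le_mul_of_nonneg_left ?_ (by positivity)
      exact two_rpow_le (by positivity) ((div_le_one hB').2 ht')
    have h4 : potTime I B β R ⟨n, S, if t + 1 < B then some (x, t + 1) else none⟩ ≤
        A * (1 + ((t + 1) + d / W) / B) := by
      split_ifs with h
      · simp only [potTime, hA, Nat.cast_add, Nat.cast_one]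
        rw [show (n : ℝ) - R - (t + 1) = n - (R + 1) - t by ring]
      · refine (h3 S).trans ?_
        gcongr
        · linarith
        · exact (one_le_div hW).2 h2
    simp only [astep]
    rw [div_le_iff₀ hd]
    refine (add_le_add (add_le_add (h3 _) (mul_le_mul_of_nonneg_left (h3 _) (by linarith)))
      (mul_le_mul_of_nonneg_left h4 (by linarith))).trans (le_of_eq ?_)
    rw [show potTime I B β (R + 1) ⟨n, S, some (x, t)⟩ = A * (1 + (t + d / W) / B) by
      simp only [potTime]; rfl]
    field_simp
    ring
  rcases σ with ⟨_ | n, S, _ | ⟨x, t⟩⟩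
  · rfl
  · exact search _ _ _ _ (hσ x t rfl).1 (hσ x t rfl).2
  · simp only [astep]
    refine (avg_pick_le hN hτ0 hτ (f := fun o => potTime I B β R ⟨n, S, o.map fun x => (x, 0)⟩)
      (A := β ^ n * (2 : ℝ) ^ ((n - R : ℝ) / B)) (K := β ^ n * (2 : ℝ) ^ ((n - R : ℝ) / B) / B)
      (g := fun q => I.minDeg q) (potTime_none_le _ _ _) ?_).trans ?_
    · intro x hx
      simp only [potTime, Option.map_some, Nat.cast_zero, sub_zero, zero_add]
      exact le_of_eq (by ring)
    · have hN' : (0 : ℝ) < I.size := by exact_mod_cast hN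
      have hτ' : (0 : ℝ) < τ := by exact_mod_cast hτ0
      have h5 : (∑ p ∈ I.result, (I.minDeg p : ℝ)) / (I.size * τ) ≤ 1 :=
        (div_le_one (by positivity)).2 (I.sum_minDeg_le hτ)
      have h6 := mul_le_mul_of_nonneg_left h5
        (show 0 ≤ β ^ n * (2 : ℝ) ^ ((n - R : ℝ) / B) / B by positivity)
      rw [mul_div_assoc]
      refine (add_le_add_right h6 _).trans (le_of_eq ?_)
      simp only [potTime]
      rw [show ((n + 1 : ℕ) - (R + 1 : ℕ) : ℝ) = n - R by push_cast; ring, pow_succ,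
        hβ]
      ring
  · exact search _ _ _ _ (hσ x t rfl).1 (hσ x t rfl).2

end

/-! ### Tail bounds for one level -/

lemma one_add_pow_le_exp {x : ℝ} (hx : 0 ≤ 1 + x) (k : ℕ) : (1 + x) ^ k ≤ Real.exp (k * x) := by
  rw [Real.exp_nat_mul]
  exact pow_le_pow_left₀ hx (by linarith [Real.add_one_le_exp x]) k

lemma exp_sub_one_le {s : ℝ} (hs : |s| ≤ 1) : Real.exp s - 1 ≤ s + s ^ 2 := by
  have := (abs_le.1 (Real.abs_exp_sub_one_sub_id_le hs)).2
  linarith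

/-- The process ends unfinished, or it stops the search for the right level with a bad estimate, or
it does not stop although it should. -/
def LevelFail (I : Instance) (τ k e h : ℕ) (σ : Sim) : Prop :=
  σ.cur ≠ none ∨ σ.n ≠ 0 ∨
    (h ≤ σ.S ∧ ¬ |(σ.S * (I.size * τ) / k : ℝ) - I.out| ≤ I.out / e) ∨
    (σ.S < h ∧ τ ^ 2 ≤ 4 * I.out)

section

variable {I : Instance}

lemma one_le_potTime_zero {B : ℕ} {β : ℝ} (hβ : 1 ≤ β) {σ : Sim} (hσ : σ.Wf I B)
    (h : σ.cur ≠ none ∨ σ.n ≠ 0) : 1 ≤ potTime I B β 0 σ := by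
  rcases σ with ⟨n, S, _ | ⟨x, t⟩⟩
  · cases n with
    | zero => simp at h
    | succ n =>
      simp only [potTime]
      refine one_le_mul_of_one_le_of_one_le (one_le_pow₀ hβ) (Real.one_le_rpow one_le_two ?_)
      simp only [Nat.cast_zero, sub_zero]
      positivity
  · have ht := (hσ x t rfl).2
    have hB : (0 : ℝ) < B := by exact_mod_cast (Nat.zero_le t).trans_lt ht
    have ht' : (t : ℝ) ≤ B := by exact_mod_cast ht.le
    have h1 : (2 : ℝ) ^ ((t : ℝ) / B) ≤ 1 + t / B :=
      two_rpow_le (by positivity) ((div_le_one hB).2 ht')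
    have h2 : (1 : ℝ) ≤ 2 ^ ((n - (0 : ℕ) - t : ℝ) / B) *
        (1 + (t + I.minDeg x.ends / I.wit x.ends) / B) := by
      calc (1 : ℝ) = 2 ^ (-(t / B : ℝ)) * 2 ^ ((t : ℝ) / B) := by
            rw [← Real.rpow_add two_pos]; simp
        _ ≤ 2 ^ ((n - (0 : ℕ) - t : ℝ) / B) * (1 + t / B) := by
            refine mul_le_mul (Real.rpow_le_rpow_of_exponent_le one_le_two ?_) h1 (by positivity)
              (by positivity)
            rw [← neg_div]
            gcongr
            simp
        _ ≤ _ := by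
            gcongr
            simp only [le_add_iff_nonneg_right]
            positivity
    rw [potTime.eq_3, mul_assoc]
    exact one_le_mul_of_one_le_of_one_le (one_le_pow₀ hβ) h2

/-- The 4k steps leave 3k beyond the draws. They give 2^(-3k/B) ≤ exp(-2k/B) because 3·log 2 > 2,
while the power of β costs at most exp(k/B). -/
lemma potTime_start_le {B k : ℕ} (hB : 0 < B) (hk : 0 < k) (S : ℕ) :
    potTime I B (1 + 1 / B) (4 * k) ⟨k, S, none⟩ ≤ Real.exp (-(k / B)) := by
  have hB' : (0 : ℝ) < B := by exact_mod_cast hB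
  refine (potTime_none_le _ _ _).trans ?_
  have h1 : (1 + 1 / B : ℝ) ^ k ≤ Real.exp (k * (1 / B)) := one_add_pow_le_exp (by positivity) k
  have h2 : (2 : ℝ) ^ ((k - (4 * k : ℕ) : ℝ) / B) ≤ Real.exp (-(2 * (k / B))) := by
    rw [Real.rpow_def_of_pos two_pos]
    gcongr
    rw [show ((k - (4 * k : ℕ) : ℝ) / B) = -(3 * (k / B)) by push_cast; ring]
    have := Real.log_two_gt_d9
    have h3 : (0 : ℝ) ≤ k / B := by positivity
    nlinarith
  calc _ ≤ Real.exp (k * (1 / B)) * Real.exp (-(2 * (k / B))) := by gcongr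
    _ = _ := by rw [← Real.exp_add]; congr 1; ring

lemma potUpper_start_le {p z : ℝ} (hp : 0 ≤ p) (hz : 1 ≤ z) (k : ℕ) :
    potUpper I p z ⟨k, 0, none⟩ ≤ Real.exp (k * (p * (z - 1))) := by
  simp only [potUpper, pow_zero, mul_one]
  exact one_add_pow_le_exp (by nlinarith [mul_nonneg hp (sub_nonneg.2 hz)]) k

lemma potUpper_nonneg {p z : ℝ} (hp : 0 ≤ p) (hz : 1 ≤ z) (σ : Sim) : 0 ≤ potUpper I p z σ := by
  have hz1 : 0 ≤ z - 1 := by linarith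
  have hz0 : 0 ≤ z := by linarith
  rcases σ with ⟨n, S, _ | ⟨x, t⟩⟩ <;> simp only [potUpper]
  · positivity
  · have : 0 ≤ (z - 1) / I.wit x.ends := div_nonneg hz1 (by positivity)
    positivity

/-- A potential `Φ R`, depending on the number `R` of remaining steps, that dominates the failure
of a level and is small at its start. -/
structure IsPotential (I : Instance) (τ k e h B : ℕ) (Φ : ℕ → Sim → ℝ) : Prop where
  step_le : ∀ R σ, σ.Wf I B → astep I τ B (Φ R) σ ≤ Φ (R + 1) σ
  nonneg : ∀ σ, σ.Wf I B → 0 ≤ Φ 0 σ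
  one_le : ∀ σ, σ.Wf I B → LevelFail I τ k e h σ → 1 ≤ Φ 0 σ

/-- The relations between the parameters of a level: there are `k` samples, at most `B` trials per
sample, and the search stops when `h` samples are accepted. -/
structure LevelParams (I : Instance) (τ r e l k B h : ℕ) : Prop where
  size_pos : 0 < I.size
  tau_pos : 0 < τ
  r_pos : 0 < r
  two_le_e : 2 ≤ e
  l_pos : 0 < l
  out_le : I.out ≤ τ ^ 2
  size_le : I.size ≤ r * τ
  k_eq : k = 2048 * e ^ 2 * l * r
  B_eq : B = 16 * e * r
  h_eq : h = 128 * e ^ 2 * l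

namespace LevelParams

variable {τ r e l k B h : ℕ} (P : LevelParams I τ r e l k B h)

include P

lemma k_pos : 0 < k := by
  have := P.two_le_e; have := P.l_pos; have := P.r_pos
  rw [P.k_eq]; positivity

lemma B_pos : 0 < B := by
  have := P.two_le_e; have := P.l_pos; have := P.r_pos
  rw [P.B_eq]; positivity

lemma h_pos : 0 < h := by
  have := P.two_le_e; have := P.l_pos
  rw [P.h_eq]; positivity

lemma potTime_le :
    potTime I B (1 + 1 / B) (4 * k) ⟨k, 0, none⟩ ≤ Real.exp (-(2 * l)) := by
  refine (potTime_start_le P.B_pos P.k_pos 0).trans (Real.exp_le_exp.2 (neg_le_neg ?_))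
  have hB : (0 : ℝ) < B := by exact_mod_cast P.B_pos
  have he : (2 : ℝ) ≤ e := by exact_mod_cast P.two_le_e
  have hr : (0 : ℝ) < r := by exact_mod_cast P.r_pos
  have hl : (0 : ℝ) < l := by exact_mod_cast P.l_pos
  rw [le_div_iff₀ hB, P.k_eq, P.B_eq]
  push_cast
  have : 0 < (l : ℝ) * e * r := by positivity
  nlinarith

/-- A level with a large output is expected to accept many samples. -/
lemma four_mul_h_le (h1 : τ ^ 2 ≤ 4 * I.out) : 4 * (h : ℝ) ≤ k * (I.out / (I.size * τ)) := by
  have hN : (0 : ℝ) < I.size := by exact_mod_cast P.size_pos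
  have hτ : (0 : ℝ) < τ := by exact_mod_cast P.tau_pos
  have hr : (0 : ℝ) < r := by exact_mod_cast P.r_pos
  have he : (2 : ℝ) ≤ e := by exact_mod_cast P.two_le_e
  have hl : (0 : ℝ) < l := by exact_mod_cast P.l_pos
  have h1' : (τ : ℝ) ^ 2 ≤ 4 * I.out := by exact_mod_cast h1
  have hM : (I.size : ℝ) ≤ r * τ := by exact_mod_cast P.size_le
  rw [mul_div_assoc', le_div_iff₀ (by positivity), P.k_eq, P.h_eq]
  push_cast
  have h2 : (I.size : ℝ) * τ ≤ 4 * (r * I.out) := by nlinarith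
  have h3 : 0 < (e : ℝ) ^ 2 * l := by positivity
  nlinarith

lemma abs_estimate_sub_le (S : ℕ)
    (hS : |(S : ℝ) - k * (I.out / (I.size * τ))| ≤ k * (I.out / (I.size * τ)) / e) :
    |(S * (I.size * τ) / k : ℝ) - I.out| ≤ I.out / e := by
  have hN : (0 : ℝ) < I.size := by exact_mod_cast P.size_pos
  have hτ : (0 : ℝ) < τ := by exact_mod_cast P.tau_pos
  have hk : (0 : ℝ) < k := by exact_mod_cast P.k_pos
  have he : (2 : ℝ) ≤ e := by exact_mod_cast P.two_le_e
  have e1 : (S * (I.size * τ) / k : ℝ) - I.out =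
      (S - k * (I.out / (I.size * τ))) * ((I.size * τ) / k) := by
    field_simp
  have e2 : (I.out / e : ℝ) = k * (I.out / (I.size * τ)) / e * ((I.size * τ) / k) := by
    field_simp
  rw [e1, e2, abs_mul, abs_of_pos (show (0 : ℝ) < I.size * τ / k by positivity)]
  gcongr

/-- A level that expects at least h/2 acceptances satisfies Nτ ≤ 32·r·OUT, hence N² ≤ (8r)²·OUT
because N ≤ rτ. In the Cauchy–Schwarz bound N·√OUT this turns N into a multiple of √OUT. With B =
16er the cut-off then loses at most OUT/(2e). -/
lemma sum_minDeg_le (hc : (h : ℝ) / 2 ≤ k * (I.out / (I.size * τ))) :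
    ∑ q ∈ I.result, (I.minDeg q : ℝ) ≤ 8 * r * I.out := by
  have hN : (0 : ℝ) < I.size := by exact_mod_cast P.size_pos
  have hτ : (0 : ℝ) < τ := by exact_mod_cast P.tau_pos
  have hr : (0 : ℝ) < r := by exact_mod_cast P.r_pos
  have he : (2 : ℝ) ≤ e := by exact_mod_cast P.two_le_e
  have hl : (0 : ℝ) < l := by exact_mod_cast P.l_pos
  have hM : (I.size : ℝ) ≤ r * τ := by exact_mod_cast P.size_le
  have hr2 : (I.size : ℝ) ^ 2 ≤ (8 * r) ^ 2 * I.out := by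
    rw [mul_div_assoc', le_div_iff₀ (by positivity), P.k_eq, P.h_eq] at hc
    push_cast at hc
    have h3 : 0 < (e : ℝ) ^ 2 * l := by positivity
    have h4 : (I.size : ℝ) * τ ≤ 32 * r * I.out := by
      have : (e : ℝ) ^ 2 * l * (64 * (I.size * τ)) ≤ (e : ℝ) ^ 2 * l * (2048 * r * I.out) := by
        linarith
      have := le_of_mul_le_mul_left this h3
      linarith
    have h5 : (I.size : ℝ) ^ 2 ≤ I.size * (r * τ) := by rw [sq]; gcongr
    have h6 := mul_le_mul_of_nonneg_left h4 hr.le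
    have h7 : 0 ≤ (r : ℝ) ^ 2 * I.out := by positivity
    linarith
  refine abs_le_of_sq_le_sq' (I.sum_minDeg_sq_le.trans ?_) (by positivity) |>.2
  calc (I.out : ℝ) * (I.size : ℝ) ^ 2 ≤ I.out * ((8 * r) ^ 2 * I.out) := by gcongr
    _ = _ := by ring

lemma out_le_size_mul : (I.out : ℝ) ≤ I.size * τ := by
  refine abs_le_of_sq_le_sq' ?_ (by positivity) |>.2
  have h2 : (I.out : ℝ) ≤ (I.size : ℝ) ^ 2 := by exact_mod_cast I.out_le_size_sq
  have h3 : (I.out : ℝ) ≤ (τ : ℝ) ^ 2 := by exact_mod_cast P.out_le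
  rw [mul_pow, sq (I.out : ℝ)]
  gcongr

omit P in
-- The Chernoff exponent -sμ/e + s²μ is minimal at s = 1/(2e), with value -μ/(4e²) ≤ -16l.
lemma upper_exponent_le {e μ s : ℝ} (he : 2 ≤ e) (hs : s = 1 / (2 * e)) (hμ : 0 ≤ μ) {l : ℝ}
    (hl : 64 * e ^ 2 * l ≤ μ) : -(s * ((1 + 1 / e) * μ)) + μ * (Real.exp s - 1) ≤ -(2 * l) := by
  have he0 : 0 < e := by linarith
  have hs0 : 0 < s := by rw [hs]; positivity
  have hs1 : s ≤ 1 := by rw [hs, div_le_one (by positivity)]; linarith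
  have h1 : μ * (Real.exp s - 1) ≤ μ * (s + s ^ 2) :=
    mul_le_mul_of_nonneg_left (exp_sub_one_le (by rwa [abs_of_pos hs0])) hμ
  have h2 : -(s * ((1 + 1 / e) * μ)) + μ * (s + s ^ 2) = -(1 / (4 * e ^ 2) * μ) := by
    rw [hs]; field_simp; ring
  have h3 : (1 / (4 * e ^ 2) : ℝ) * (64 * e ^ 2 * l) ≤ 1 / (4 * e ^ 2) * μ := by gcongr
  have h4 : (1 / (4 * e ^ 2) : ℝ) * (64 * e ^ 2 * l) = 16 * l := by field_simp; ring
  have h5 : 0 ≤ 1 / (4 * e ^ 2) * μ := by positivity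
  linarith

omit P in
-- The tolerated deviation is 1/e = 4s, of which the cut-off consumes 2s. What remains gives the
-- exponent -s²μ' relative to the true mean μ' ≥ 3μ/4, that is, at most -3l.
lemma lower_exponent_le {e μ μ' s : ℝ} (he : 2 ≤ e) (hs : s = 1 / (4 * e)) (hμ : 0 ≤ μ)
    (hμ' : (1 - 2 * s) * μ ≤ μ') {l : ℝ} (hl : 64 * e ^ 2 * l ≤ μ) :
    s * ((1 - 1 / e) * μ) + μ' * (Real.exp (-s) - 1) ≤ -(2 * l) := by
  have he0 : 0 < e := by linarith
  have hs0 : 0 < s := by rw [hs]; positivity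
  have hs1 : s ≤ 1 / 8 := by
    rw [hs, div_le_div_iff₀ (by positivity) (by norm_num)]; linarith
  have hse : 1 / e = 4 * s := by rw [hs]; field_simp
  have h4 : 3 / 4 * μ ≤ μ' := by nlinarith
  have h1 : μ' * (Real.exp (-s) - 1) ≤ μ' * (-s + s ^ 2) := by
    refine mul_le_mul_of_nonneg_left ?_ (by linarith)
    have := exp_sub_one_le (s := -s) (by rw [abs_neg, abs_of_pos hs0]; linarith)
    rwa [neg_sq] at this
  have h2 : (1 - 4 * s) * μ ≤ (1 - 2 * s) * μ' := by
    have h5 : (1 - 2 * s) * ((1 - 2 * s) * μ) ≤ (1 - 2 * s) * μ' :=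
      mul_le_mul_of_nonneg_left hμ' (by linarith)
    have h6 := mul_nonneg (sq_nonneg s) hμ
    linarith
  have h3 := mul_le_mul_of_nonneg_left h2 hs0.le
  have h7 : s ^ 2 * (3 / 4 * (64 * e ^ 2 * l)) ≤ s ^ 2 * μ' := by
    refine mul_le_mul_of_nonneg_left ?_ (sq_nonneg s)
    linarith
  have h8 : s ^ 2 * (3 / 4 * (64 * e ^ 2 * l)) = 3 * l := by
    rw [hs]; field_simp; norm_num
  have h9 : 0 ≤ s ^ 2 * μ' := mul_nonneg (sq_nonneg s) (by linarith)
  rw [hse]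
  linarith

/-- The mean number of acceptances is large enough for two-sided concentration within the factor 1 ±
1/e. The three potentials, for time, upper and lower tail, each contribute exp(-2l). -/
lemma exists_potential_of_le {p : ℝ} (hp : p = I.out / (I.size * τ)) (hc : (h : ℝ) / 2 ≤ k * p) :
    ∃ Φ, IsPotential I τ k e h B Φ ∧ Φ (4 * k) ⟨k, 0, none⟩ ≤ 3 * Real.exp (-(2 * l)) := by
  have hN : (0 : ℝ) < I.size := by exact_mod_cast P.size_pos
  have hτ : (0 : ℝ) < τ := by exact_mod_cast P.tau_pos
  have hr : (0 : ℝ) < r := by exact_mod_cast P.r_pos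
  have he : (2 : ℝ) ≤ e := by exact_mod_cast P.two_le_e
  have hB : (0 : ℝ) < B := by exact_mod_cast P.B_pos
  have hp0 : 0 ≤ p := by rw [hp]; positivity
  have hkp0 : 0 ≤ k * p := by positivity
  have hhl : 64 * (e : ℝ) ^ 2 * l ≤ k * p := by
    refine le_trans (le_of_eq ?_) hc
    rw [P.h_eq]; push_cast; ring
  have hβ : (1 : ℝ) ≤ 1 + 1 / B := by
    have : (0 : ℝ) ≤ 1 / B := by positivity
    linarith
  obtain ⟨s, hs⟩ : ∃ s : ℝ, s = 1 / (2 * e) := ⟨_, rfl⟩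
  obtain ⟨s', hs'⟩ : ∃ s : ℝ, s = 1 / (4 * e) := ⟨_, rfl⟩
  have hs0 : 0 < s := by rw [hs]; positivity
  have hs'0 : 0 < s' := by rw [hs']; positivity
  obtain ⟨p', hp'⟩ : ∃ p' : ℝ,
    p' = (I.out - (∑ q ∈ I.result, (I.minDeg q : ℝ)) / B) / (I.size * τ) := ⟨_, rfl⟩
  -- 8·r·OUT divided by B = 16er is OUT/(2e), which equals 2s'·OUT.
  have hDB : (∑ q ∈ I.result, (I.minDeg q : ℝ)) / B ≤ 2 * s' * I.out := by
    rw [div_le_iff₀ hB]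
    refine (P.sum_minDeg_le (hp ▸ hc)).trans (le_of_eq ?_)
    rw [P.B_eq, hs']
    push_cast
    field_simp
    ring
  have hμ' : (1 - 2 * s') * (k * p) ≤ k * p' := by
    have : (1 - 2 * s') * p ≤ p' := by
      rw [hp', hp, mul_div_assoc']
      gcongr
      linarith
    have := mul_le_mul_of_nonneg_left this (Nat.cast_nonneg k)
    linarith
  have hp1 : p' ≤ 1 := by
    rw [hp', div_le_one (by positivity)]
    have : 0 ≤ (∑ q ∈ I.result, (I.minDeg q : ℝ)) / B := by positivity
    linarith [P.out_le_size_mul]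
  have hz : 1 ≤ Real.exp s := Real.one_le_exp hs0.le
  have hy : Real.exp (-s') ≤ 1 := Real.exp_le_one_iff.2 (by linarith)
  refine ⟨fun R σ => potTime I B (1 + 1 / B) R σ +
    (Real.exp (-(s * ((1 + 1 / e) * (k * p)))) * potUpper I p (Real.exp s) σ +
      Real.exp (s' * ((1 - 1 / e) * (k * p))) * potLower I B p' (Real.exp (-s')) σ),
    ⟨?_, ?_, ?_⟩, ?_⟩
  · intro R σ hσ
    rw [astep_add, astep_add, astep_mul, astep_mul]
    have h1 := astep_potTime_le P.size_pos P.tau_pos P.out_le P.B_pos R hσ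
    have h2 := astep_potUpper_le P.size_pos P.tau_pos P.out_le hz hσ
    have h3 := astep_potLower_le P.size_pos P.tau_pos P.out_le (Real.exp_pos _).le hy hp1 hp'.le hσ
    rw [← hp] at h2
    gcongr
  · intro σ hσ
    have h1 := potTime_nonneg (I := I) (B := B) (zero_le_one.trans hβ) 0 σ
    have h2 := potUpper_nonneg (I := I) hp0 hz σ
    have h3 := potLower_nonneg hp1 (Real.exp_pos _).le hy hσ
    positivity
  · intro σ hσ hf
    have h1 := potTime_nonneg (I := I) (B := B) (zero_le_one.trans hβ) 0 σ
    have h2 := mul_nonneg (Real.exp_pos (-(s * ((1 + 1 / e) * (k * p))))).le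
      (potUpper_nonneg (I := I) hp0 hz σ)
    have h3 := mul_nonneg (Real.exp_pos (s' * ((1 - 1 / e) * (k * p)))).le
      (potLower_nonneg hp1 (Real.exp_pos _).le hy hσ)
    by_cases hfin : σ.cur ≠ none ∨ σ.n ≠ 0
    · have := one_le_potTime_zero hβ hσ hfin
      linarith
    push Not at hfin
    obtain ⟨n, S, cur⟩ := σ
    obtain ⟨rfl, rfl⟩ := hfin
    have hS : ¬ |(S : ℝ) - k * p| ≤ k * p / e := by
      intro hS
      rcases hf with hf | hf | hf | hf
      · exact hf rfl
      · exact hf rfl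
      · exact hf.2 (P.abs_estimate_sub_le S (hp ▸ hS))
      -- A mean of at least 4h with a deviation of at most half the mean is incompatible with S < h.
      · have h4 := P.four_mul_h_le hf.2
        rw [← hp] at h4
        have h5 : (S : ℝ) < h := by exact_mod_cast hf.1
        have h6 := (abs_le.1 hS).1
        have h7 : k * p / e ≤ k * p / 2 := by gcongr
        have h8 : (0 : ℝ) < h := by exact_mod_cast P.h_pos
        linarith
    rw [abs_le, not_and_or, not_le, not_le] at hS
    rcases hS with hS | hS
    · have : 1 ≤ Real.exp (s' * ((1 - 1 / e) * (k * p))) *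
          potLower I B p' (Real.exp (-s')) ⟨0, S, none⟩ := by
        simp only [potLower, pow_zero, one_mul]
        rw [← Real.exp_nat_mul, ← Real.exp_add]
        refine Real.one_le_exp ?_
        have : (S : ℝ) ≤ (1 - 1 / e) * (k * p) := by
          have e1 : (1 - 1 / e) * (k * p) = k * p - k * p / e := by ring
          rw [e1]; linarith
        have := mul_le_mul_of_nonneg_left this hs'0.le
        linarith
      linarith
    · have : 1 ≤ Real.exp (-(s * ((1 + 1 / e) * (k * p)))) *
          potUpper I p (Real.exp s) ⟨0, S, none⟩ := by
        simp only [potUpper, pow_zero, one_mul]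
        rw [← Real.exp_nat_mul, ← Real.exp_add]
        refine Real.one_le_exp ?_
        have : (1 + 1 / e) * (k * p) ≤ S := by
          have e1 : (1 + 1 / e) * (k * p) = k * p + k * p / e := by ring
          rw [e1]; linarith
        have := mul_le_mul_of_nonneg_left this hs0.le
        linarith
      linarith
  · have hU : Real.exp (-(s * ((1 + 1 / e) * (k * p)))) * potUpper I p (Real.exp s) ⟨k, 0, none⟩ ≤
        Real.exp (-(2 * l)) := by
      refine (mul_le_mul_of_nonneg_left (potUpper_start_le hp0 hz k)
        (Real.exp_pos _).le).trans ?_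
      rw [← Real.exp_add, ← mul_assoc (k : ℝ)]
      exact Real.exp_le_exp.2 (upper_exponent_le he hs hkp0 hhl)
    have hL : Real.exp (s' * ((1 - 1 / e) * (k * p))) *
        potLower I B p' (Real.exp (-s')) ⟨k, 0, none⟩ ≤ Real.exp (-(2 * l)) := by
      have h0 : potLower I B p' (Real.exp (-s')) ⟨k, 0, none⟩ ≤
          Real.exp (k * (p' * (Real.exp (-s') - 1))) := by
        simp only [potLower, pow_zero, mul_one]
        rw [show 1 - (1 - Real.exp (-s')) * p' = 1 + p' * (Real.exp (-s') - 1) by ring]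
        refine one_add_pow_le_exp ?_ k
        have := Real.exp_pos (-s')
        nlinarith
      refine (mul_le_mul_of_nonneg_left h0 (Real.exp_pos _).le).trans ?_
      rw [← Real.exp_add, ← mul_assoc (k : ℝ)]
      exact Real.exp_le_exp.2 (lower_exponent_le he hs' hkp0 hμ' hhl)
    linarith [P.potTime_le]

/-- With a mean below h/2 the level ought to continue: τ² ≤ 4·OUT would force a mean of at least 4h.
Apart from time, only S ≥ h can go wrong, and the exponential moment at s = 1/2 bounds it by
exp(-h/8). -/
lemma exists_potential_of_lt {p : ℝ} (hp : p = I.out / (I.size * τ)) (hc : k * p < (h : ℝ) / 2) :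
    ∃ Φ, IsPotential I τ k e h B Φ ∧ Φ (4 * k) ⟨k, 0, none⟩ ≤ 3 * Real.exp (-(2 * l)) := by
  have he : (2 : ℝ) ≤ e := by exact_mod_cast P.two_le_e
  have hl : (0 : ℝ) < l := by exact_mod_cast P.l_pos
  have hB : (0 : ℝ) < B := by exact_mod_cast P.B_pos
  have hh : (0 : ℝ) < h := by exact_mod_cast P.h_pos
  have hp0 : 0 ≤ p := by rw [hp]; positivity
  have hβ : (1 : ℝ) ≤ 1 + 1 / B := by
    have : (0 : ℝ) ≤ 1 / B := by positivity
    linarith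
  have hz : 1 ≤ Real.exp (1 / 2) := Real.one_le_exp (by norm_num)
  refine ⟨fun R σ => potTime I B (1 + 1 / B) R σ +
    Real.exp (-(1 / 2 * h)) * potUpper I p (Real.exp (1 / 2)) σ, ⟨?_, ?_, ?_⟩, ?_⟩
  · intro R σ hσ
    rw [astep_add, astep_mul]
    have h1 := astep_potTime_le P.size_pos P.tau_pos P.out_le P.B_pos R hσ
    have h2 := astep_potUpper_le P.size_pos P.tau_pos P.out_le hz hσ
    rw [← hp] at h2
    gcongr
  · intro σ hσ
    have h1 := potTime_nonneg (I := I) (B := B) (zero_le_one.trans hβ) 0 σ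
    have h2 := potUpper_nonneg (I := I) hp0 hz σ
    positivity
  · intro σ hσ hf
    have h1 := potTime_nonneg (I := I) (B := B) (zero_le_one.trans hβ) 0 σ
    have h2 := mul_nonneg (Real.exp_pos (-(1 / 2 * (h : ℝ)))).le
      (potUpper_nonneg (I := I) hp0 hz σ)
    by_cases hfin : σ.cur ≠ none ∨ σ.n ≠ 0
    · have := one_le_potTime_zero hβ hσ hfin
      linarith
    push Not at hfin
    obtain ⟨n, S, cur⟩ := σ
    obtain ⟨rfl, rfl⟩ := hfin
    have hS : h ≤ S := by
      rcases hf with hf | hf | hf | hf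
      · exact absurd rfl hf
      · exact absurd rfl hf
      · exact hf.1
      · have h4 := P.four_mul_h_le hf.2
        rw [← hp] at h4
        linarith
    have hS' : (h : ℝ) ≤ S := by exact_mod_cast hS
    have : 1 ≤ Real.exp (-(1 / 2 * h)) * potUpper I p (Real.exp (1 / 2)) ⟨0, S, none⟩ := by
      simp only [potUpper, pow_zero, one_mul]
      rw [← Real.exp_nat_mul, ← Real.exp_add]
      refine Real.one_le_exp ?_
      linarith
    linarith
  · have hU : Real.exp (-(1 / 2 * h)) * potUpper I p (Real.exp (1 / 2)) ⟨k, 0, none⟩ ≤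
        Real.exp (-(2 * l)) := by
      refine (mul_le_mul_of_nonneg_left (potUpper_start_le hp0 hz k)
        (Real.exp_pos _).le).trans ?_
      rw [← Real.exp_add]
      refine Real.exp_le_exp.2 ?_
      have h1 : k * (p * (Real.exp (1 / 2) - 1)) ≤ k * p * (1 / 2 + (1 / 2) ^ 2) := by
        rw [← mul_assoc]
        exact mul_le_mul_of_nonneg_left
          (exp_sub_one_le (by rw [abs_of_pos] <;> norm_num)) (by positivity)
      have h3 : 16 * (l : ℝ) ≤ h / 8 := by
        rw [P.h_eq]
        push_cast
        nlinarith [mul_le_mul_of_nonneg_right (show (1 : ℝ) ≤ e ^ 2 by nlinarith) hl.le]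
      linarith
    have := Real.exp_pos (-(2 * (l : ℝ)))
    linarith [P.potTime_le]

theorem exists_potential :
    ∃ Φ, IsPotential I τ k e h B Φ ∧ Φ (4 * k) ⟨k, 0, none⟩ ≤ 3 * Real.exp (-(2 * l)) := by
  rcases le_or_gt ((h : ℝ) / 2) (k * (I.out / (I.size * τ))) with hc | hc
  · exact P.exists_potential_of_le rfl hc
  · exact P.exists_potential_of_lt rfl hc

end LevelParams

end

/-! ### The sampling program -/

def block : List Program → Program
  | [] => .skip
  | P :: l => .seq P (block l)

/-- `x ← n` -/
def setConst (x n : ℕ) : Program := .op .add x (.const n) (.const 0)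

/-- Extends the tuple of `R₁` with number `reg 20` by the `reg 21`-th matching tuple of `R₂`. -/
def drawLeft : Program := block
  [.neighbor .R₁ none none (.reg 20) 16 17,
   .degree .R₁ none (some (.reg 17)) 22,
   .degree .R₂ (some (.reg 17)) none 23,
   .ite .lt (.reg 22) (.reg 23) .skip
    (.ite .lt (.reg 23) (.reg 21) .skip
      (block [.neighbor .R₂ (some (.reg 17)) none (.reg 21) 24 18, setConst 14 1, setConst 15 0]))]

/-- Extends the tuple of `R₂` with number `reg 20 - reg 2` by the `reg 21`-th matching tuple of
`R₁`. -/
def drawRight : Program := block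
  [.op .sub 20 (.reg 20) (.reg 2),
   .neighbor .R₂ none none (.reg 20) 17 18,
   .degree .R₁ none (some (.reg 17)) 22,
   .degree .R₂ (some (.reg 17)) none 23,
   .ite .lt (.reg 22) (.reg 23)
    (.ite .lt (.reg 22) (.reg 21) .skip
      (block [.neighbor .R₁ none (some (.reg 17)) (.reg 21) 16 24, setConst 14 1, setConst 15 0]))
    .skip]

/-- Draws a random join result. -/
def draw : Program := block
  [.op .sub 11 (.reg 11) (.const 1),
   .randInt 20 (.const 1) (.reg 3),
   .randInt 21 (.const 1) (.reg 7),
   .ite .lt (.reg 2) (.reg 20) drawRight drawLeft]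

/-- Evaluates a witness trial with outcome `reg 24`. -/
def judge : Program := block
  [.op .add 15 (.reg 15) (.const 1),
   .ite .eq (.reg 26) (.const 1)
    (block [setConst 14 0, .ite .eq (.reg 24) (.reg 17) (.op .add 13 (.reg 13) (.const 1)) .skip])
    (.ite .lt (.reg 15) (.reg 9) .skip (setConst 14 0))]

/-- Performs a witness trial for the current join result. -/
def search : Program := block
  [.degree .R₁ (some (.reg 16)) none 22,
   .degree .R₂ none (some (.reg 18)) 23,
   .ite .lt (.reg 22) (.reg 23)
    (block [.randInt 21 (.const 1) (.reg 22), .neighbor .R₁ (some (.reg 16)) none (.reg 21) 25 24,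
      .test .R₂ (.reg 24) (.reg 18) 26, judge])
    (block [.randInt 21 (.const 1) (.reg 23), .neighbor .R₂ none (some (.reg 18)) (.reg 21) 24 25,
      .test .R₁ (.reg 16) (.reg 24) 26, judge])]

/-- One step of the sampling process. -/
def body : Program :=
  .ite .eq (.reg 14) (.const 0) (.ite .lt (.const 0) (.reg 11) draw .skip) search

/-- The registers that the sampling program only reads. -/
structure Frame where
  flag : ℕ
  τ : ℕ
  k : ℕ
  B : ℕ
  h : ℕ
  R : ℕ

/-- The registers that describe the join result under examination. -/
def CurInv (s : Store) : Option (JoinTuple × ℕ) → Prop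
  | none => s.reg 14 = 0
  | some (x, t) => s.reg 14 = 1 ∧ s.reg 15 = t ∧ s.reg 16 = x.1.1 ∧ s.reg 17 = x.1.2 ∧
      s.reg 18 = x.2.2

/-- The store represents the state `σ` of the sampling process. -/
def Inv (I : Instance) (f : Frame) (σ : Sim) (s : Store) : Prop :=
  s.reg 2 = I.R₁.tuples.card ∧ s.reg 3 = I.size ∧ s.reg 4 = f.flag ∧ s.reg 7 = f.τ ∧
  s.reg 8 = f.k ∧ s.reg 9 = f.B ∧ s.reg 10 = f.h ∧ s.reg 12 = f.R ∧ s.reg 11 = σ.n ∧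
  s.reg 13 = σ.S ∧ CurInv s σ.cur

/-- The number of samples that are drawn or still to be drawn is bounded, and the join result
under examination is valid. -/
def Sim.Valid (I : Instance) (f : Frame) (σ : Sim) : Prop :=
  σ.Wf I f.B ∧ σ.S + σ.n + (if σ.cur = none then 0 else 1) ≤ f.k

structure WordBounds (w : ℕ) (I : Instance) (f : Frame) : Prop where
  fits : I.FitsWord w
  size_pos : 0 < I.size
  tau_pos : 0 < f.τ
  B_pos : 0 < f.B
  size_lt : I.size < 2 ^ w
  tau_lt : f.τ < 2 ^ w
  k_lt : f.k < 2 ^ w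
  B_lt : f.B < 2 ^ w

lemma setReg_of_lt {w : ℕ} {s : Store} {x v : ℕ} (h : v < 2 ^ w) :
    s.setReg w x v = ⟨Function.update s.reg x v, s.mem⟩ := by
  simp [Store.setReg, Nat.mod_eq_of_lt h]

section

variable {w : ℕ} {I : Instance} {f : Frame}

namespace WordBounds

variable (hw : WordBounds w I f)

include hw

lemma one_lt : 1 < 2 ^ w := by
  have := hw.size_pos; have := hw.size_lt; omega

lemma degree₁_lt (p q : Option ℕ) : I.R₁.degree p q < 2 ^ w :=
  (I.R₁.degree_le p q).trans_lt ((Nat.le_add_right _ _).trans_lt hw.size_lt)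

lemma degree₂_lt (p q : Option ℕ) : I.R₂.degree p q < 2 ^ w :=
  (I.R₂.degree_le p q).trans_lt ((Nat.le_add_left _ _).trans_lt hw.size_lt)

lemma fst₁_lt {t : ℕ × ℕ} (ht : t ∈ I.R₁.tuples) : t.1 < 2 ^ w := (hw.fits .R₁ t ht).1
lemma snd₁_lt {t : ℕ × ℕ} (ht : t ∈ I.R₁.tuples) : t.2 < 2 ^ w := (hw.fits .R₁ t ht).2
lemma fst₂_lt {t : ℕ × ℕ} (ht : t ∈ I.R₂.tuples) : t.1 < 2 ^ w := (hw.fits .R₂ t ht).1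
lemma snd₂_lt {t : ℕ × ℕ} (ht : t ∈ I.R₂.tuples) : t.2 < 2 ^ w := (hw.fits .R₂ t ht).2

end WordBounds

lemma wp_neighbor {r : RelName} {p q : Option Operand} {j : Operand} {x y i : ℕ} {s : Store}
    {t : ℕ × ℕ} (F : Store → ℝ) (hj : j.eval w s = i + 1)
    (ht : ((I.rel r).nbrs (p.map (Operand.eval w s)) (q.map (Operand.eval w s)))[i]? = some t) :
    wp w I (.neighbor r p q j x y) F s = F ((s.setReg w x t.1).setReg w y t.2) := by
  simp only [wp, hj, ht]

lemma wp_setConst (hw : WordBounds w I f) {x n : ℕ} (hn : n ≤ 1) (F : Store → ℝ) (s : Store) :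
    wp w I (setConst x n) F s = F ⟨Function.update s.reg x n, s.mem⟩ := by
  have h : n < 2 ^ w := hn.trans_lt hw.one_lt
  simp [setConst, wp, BinOp.eval, Operand.eval, Nat.mod_eq_of_lt h, setReg_of_lt h]

lemma wp_drawLeft_le (hw : WordBounds w I f) {F : Store → ℝ} {G : Option JoinTuple → ℝ}
    {s : Store} {n S u v : ℕ} (hs : Inv I f ⟨n, S, none⟩ s)
    (hu0 : 1 ≤ u) (hu : u ≤ I.R₁.tuples.card) (hv0 : 1 ≤ v) (hsu : s.reg 20 = u)
    (hsv : s.reg 21 = v)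
    (hF : ∀ o s', (∀ x, o = some x → x ∈ I.joined) →
      Inv I f ⟨n, S, o.map fun x => (x, 0)⟩ s' → F s' ≤ G o) :
    wp w I drawLeft F s ≤ G (I.pick u v) := by
  obtain ⟨i, rfl⟩ : ∃ i, u = i + 1 := ⟨u - 1, by omega⟩
  obtain ⟨j, rfl⟩ : ∃ j, v = j + 1 := ⟨v - 1, by omega⟩
  obtain ⟨t, ht⟩ : ∃ t, (I.R₁.nbrs none none)[i]? = some t :=
    ⟨_, List.getElem?_eq_getElem (by rw [StoredRel.length_nbrs_none]; omega)⟩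
  have htm := ((I.R₁.mem_nbrs _ _ _).1 (List.mem_of_getElem? ht)).1
  have hp : I.pick (i + 1) (j + 1) =
      if I.R₁.degree none (some t.2) < I.R₂.degree (some t.2) none then none
      else (I.R₂.nbrs (some t.2) none)[j]?.map fun t' => (t, t') := by
    simp [Instance.pick, Nat.not_lt.2 hu, ht]
  have hpj : ∀ x, I.pick (i + 1) (j + 1) = some x → x ∈ I.joined := fun x hx => I.pick_mem_joined hx
  obtain ⟨h2, h3, h4, h7, h8, h9, h10, h12, h11, h13, h14⟩ := hs
  simp only [CurInv] at h14
  simp only at h11 h13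
  rw [drawLeft, block, wp, wp_neighbor (i := i) (t := t) _
    (show Operand.eval w s (.reg 20) = i + 1 from hsu) (by simpa [Instance.rel] using ht),
    setReg_of_lt (hw.fst₁_lt htm), setReg_of_lt (hw.snd₁_lt htm)]
  simp only [block, wp, wp_setConst hw le_rfl, wp_setConst hw zero_le_one, Instance.rel,
    Option.map_none, Option.map_some, Operand.eval,
    setReg_of_lt (hw.degree₁_lt _ _), setReg_of_lt (hw.degree₂_lt _ _), Function.update_apply,
    Cmp.eval, decide_eq_true_eq]
  norm_num [hsv]
  rw [hp] at hpj ⊢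
  split_ifs at hpj ⊢ with c1 c2
  · refine hF _ _ (by simp) ?_
    simp [Inv, CurInv, *]
  -- The test of v against the degree is needed as an access past the end leaves the registers
  -- unchanged and would go unnoticed.
  · rw [List.getElem?_eq_none (by rw [← StoredRel.degree_eq_length]; exact c2)]
    refine hF _ _ (by simp) ?_
    simp [Inv, CurInv, *]
  · obtain ⟨t', ht'⟩ : ∃ t', (I.R₂.nbrs (some t.2) none)[j]? = some t' :=
      ⟨_, List.getElem?_eq_getElem (by rw [← StoredRel.degree_eq_length]; omega)⟩
    have htm' := ((I.R₂.mem_nbrs _ _ _).1 (List.mem_of_getElem? ht')).1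
    rw [ht'] at hpj ⊢
    refine hF _ _ hpj ?_
    simp only [setReg_of_lt (hw.fst₂_lt htm'), setReg_of_lt (hw.snd₂_lt htm')]
    simp [Inv, CurInv, *]

lemma wp_drawRight_le (hw : WordBounds w I f) {F : Store → ℝ} {G : Option JoinTuple → ℝ}
    {s : Store} {n S u v : ℕ} (hs : Inv I f ⟨n, S, none⟩ s)
    (hu0 : I.R₁.tuples.card < u) (hu : u ≤ I.size) (hv0 : 1 ≤ v) (hsu : s.reg 20 = u)
    (hsv : s.reg 21 = v)
    (hF : ∀ o s', (∀ x, o = some x → x ∈ I.joined) →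
      Inv I f ⟨n, S, o.map fun x => (x, 0)⟩ s' → F s' ≤ G o) :
    wp w I drawRight F s ≤ G (I.pick u v) := by
  obtain ⟨i, rfl⟩ : ∃ i, u = I.R₁.tuples.card + i + 1 := ⟨u - I.R₁.tuples.card - 1, by omega⟩
  obtain ⟨j, rfl⟩ : ∃ j, v = j + 1 := ⟨v - 1, by omega⟩
  obtain ⟨t, ht⟩ : ∃ t, (I.R₂.nbrs none none)[i]? = some t :=
    ⟨_, List.getElem?_eq_getElem (by
      rw [StoredRel.length_nbrs_none]; unfold Instance.size at hu; omega)⟩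
  have htm := ((I.R₂.mem_nbrs _ _ _).1 (List.mem_of_getElem? ht)).1
  have hp : I.pick (I.R₁.tuples.card + i + 1) (j + 1) =
      if I.R₁.degree none (some t.1) < I.R₂.degree (some t.1) none then
        (I.R₁.nbrs none (some t.1))[j]?.map fun t' => (t', t)
      else none := by
    simp [Instance.pick, hu0, show I.R₁.tuples.card + i + 1 - I.R₁.tuples.card - 1 = i by omega, ht]
  have hpj : ∀ x, I.pick (I.R₁.tuples.card + i + 1) (j + 1) = some x → x ∈ I.joined :=
    fun x hx => I.pick_mem_joined hx
  obtain ⟨h2, h3, h4, h7, h8, h9, h10, h12, h11, h13, h14⟩ := hs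
  simp only [CurInv] at h14
  simp only at h11 h13
  have hsz := hw.size_lt
  -- Machine subtraction adds 2^w, which the truncation to a word removes.
  have hsub : s.setReg w 20 (I.R₁.tuples.card + i + 1 + (2 ^ w - I.R₁.tuples.card)) =
      ⟨Function.update s.reg 20 (i + 1), s.mem⟩ := by
    rw [Store.setReg, show I.R₁.tuples.card + i + 1 + (2 ^ w - I.R₁.tuples.card) =
      i + 1 + 2 ^ w by omega, Nat.add_mod_right, Nat.mod_eq_of_lt (by omega)]
  rw [drawRight, block, wp, wp]
  simp only [Operand.eval, BinOp.eval, hsu, h2, hsub]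
  rw [block, wp, wp_neighbor (i := i) (t := t) _
    (show Operand.eval w ⟨Function.update s.reg 20 (i + 1), s.mem⟩ (.reg 20) = i + 1 by
      simp [Operand.eval]) (by simpa [Instance.rel] using ht),
    setReg_of_lt (hw.fst₂_lt htm), setReg_of_lt (hw.snd₂_lt htm)]
  simp only [block, wp, wp_setConst hw le_rfl, wp_setConst hw zero_le_one, Instance.rel,
    Option.map_none, Option.map_some, Operand.eval,
    setReg_of_lt (hw.degree₁_lt _ _), setReg_of_lt (hw.degree₂_lt _ _), Function.update_apply,
    Cmp.eval, decide_eq_true_eq]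
  norm_num [hsv]
  rw [hp] at hpj ⊢
  split_ifs at hpj ⊢ with c1 c2
  · rw [List.getElem?_eq_none (by rw [← StoredRel.degree_eq_length]; exact c2)]
    refine hF _ _ (by simp) ?_
    simp [Inv, CurInv, *]
  · obtain ⟨t', ht'⟩ : ∃ t', (I.R₁.nbrs none (some t.1))[j]? = some t' :=
      ⟨_, List.getElem?_eq_getElem (by rw [← StoredRel.degree_eq_length]; omega)⟩
    have htm' := (I.R₁.mem_nbrs _ _ _).1 (List.mem_of_getElem? ht')
    have h5 : t'.2 = t.1 := htm'.2.2 _ rfl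
    rw [ht'] at hpj ⊢
    refine hF _ _ hpj ?_
    simp only [setReg_of_lt (hw.fst₁_lt htm'.1), setReg_of_lt (hw.snd₁_lt htm'.1)]
    simp [Inv, CurInv, *]
  · refine hF _ _ (by simp) ?_
    simp [Inv, CurInv, *]

lemma wp_draw_le (hw : WordBounds w I f) {F : Store → ℝ} {G : Option JoinTuple → ℝ}
    {s : Store} {n S : ℕ} (hn : n < 2 ^ w) (hs : Inv I f ⟨n + 1, S, none⟩ s)
    (hF : ∀ o s', (∀ x, o = some x → x ∈ I.joined) →
      Inv I f ⟨n, S, o.map fun x => (x, 0)⟩ s' → F s' ≤ G o) :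
    wp w I draw F s ≤
      (∑ u ∈ Finset.Icc 1 I.size, (∑ v ∈ Finset.Icc 1 f.τ, G (I.pick u v)) / f.τ) / I.size := by
  obtain ⟨h2, h3, h4, h7, h8, h9, h10, h12, h11, h13, h14⟩ := hs
  simp only [CurInv] at h14
  simp only at h11 h13
  have h1 := Nat.mod_eq_of_lt hw.one_lt
  have hsub : s.setReg w 11 (n + 1 + (2 ^ w - 1)) = ⟨Function.update s.reg 11 n, s.mem⟩ := by
    rw [Store.setReg, show n + 1 + (2 ^ w - 1) = n + 2 ^ w by have := hw.one_lt; omega,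
      Nat.add_mod_right, Nat.mod_eq_of_lt hn]
  have e1 : (Finset.Icc 1 I.size).Nonempty := Finset.nonempty_Icc.2 hw.size_pos
  have e2 : (Finset.Icc 1 f.τ).Nonempty := Finset.nonempty_Icc.2 hw.tau_pos
  rw [draw, block, wp, wp]
  simp only [Operand.eval, BinOp.eval, h11, h1, hsub]
  simp only [block, wp, Operand.eval, h1, Function.update_apply]
  norm_num [h3, e1]
  refine div_le_div_of_nonneg_right (Finset.sum_le_sum fun u hu => ?_) (by positivity)
  rw [Finset.mem_Icc] at hu
  rw [setReg_of_lt (hu.2.trans_lt hw.size_lt)]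
  norm_num [h7, e2]
  rw [if_pos (Nat.one_le_iff_ne_zero.2 hw.tau_pos.ne')]
  refine div_le_div_of_nonneg_right (Finset.sum_le_sum fun v hv => ?_) (by positivity)
  rw [Finset.mem_Icc] at hv
  rw [setReg_of_lt (hv.2.trans_lt hw.tau_lt)]
  simp only [Cmp.eval, decide_eq_true_eq]
  norm_num [h2]
  split_ifs with hc
  · refine wp_drawRight_le hw ?_ hc hu.2 hv.1 (by simp) (by simp) hF
    simp [Inv, CurInv, *]
  · refine wp_drawLeft_le hw ?_ hu.1 (not_lt.1 hc) hv.1 (by simp) (by simp) hF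
    simp [Inv, CurInv, *]

/-- The state after a witness trial that found the `B`-value `y`. -/
def trial (B n S : ℕ) (x : JoinTuple) (t y : ℕ) (isWit : Prop) [Decidable isWit] : Sim :=
  if isWit then (if y = x.1.2 then ⟨n, S + 1, none⟩ else ⟨n, S, none⟩)
  else ⟨n, S, if t + 1 < B then some (x, t + 1) else none⟩

lemma wp_judge_le (hw : WordBounds w I f) {F : Store → ℝ} {s : Store} {n S t y : ℕ}
    {x : JoinTuple} {isWit : Prop} [Decidable isWit] (hs : Inv I f ⟨n, S, some (x, t)⟩ s)
    (hS : S + 1 < 2 ^ w) (ht : t < f.B) (hy : s.reg 24 = y)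
    (hwit : s.reg 26 = if isWit then 1 else 0) {G : Sim → ℝ}
    (hF : ∀ s', Inv I f (trial f.B n S x t y isWit) s' → F s' ≤ G (trial f.B n S x t y isWit)) :
    wp w I judge F s ≤ G (trial f.B n S x t y isWit) := by
  obtain ⟨h2, h3, h4, h7, h8, h9, h10, h12, h11, h13, h14, h15, h16, h17, h18⟩ := hs
  simp only at h11 h13
  have h1 := Nat.mod_eq_of_lt hw.one_lt
  have htB : t + 1 < 2 ^ w :=
    (show t + 1 ≤ f.B from ht).trans_lt hw.B_lt
  simp only [judge, block, wp, Operand.eval, BinOp.eval, h1, h15, setReg_of_lt htB,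
    wp_setConst hw zero_le_one, Function.update_apply, Cmp.eval, decide_eq_true_eq]
  norm_num [hwit, hy, h17, h9, h13, setReg_of_lt hS]
  unfold trial at hF ⊢
  split_ifs at hF ⊢ with c1 c2 c3
  all_goals
    refine hF _ ?_
    simp [Inv, CurInv, *]

/-- An index drawn from [1,d], with d the exact degree, gives a uniform neighbor, so no access fails
here. -/
lemma wp_access_le {r : RelName} {p q : Option Operand} {p' q' : Option ℕ} {x y d : ℕ}
    {F : Store → ℝ} {G : ℕ × ℕ → ℝ} {s : Store} (hw1 : 1 < 2 ^ w)
    (hd0 : 0 < d) (hdw : d < 2 ^ w) (z : ℕ) (hz : s.reg z = d)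
    (hd : ((I.rel r).nbrs p' q').length = d)
    (hp : ∀ v, p.map (Operand.eval w ⟨Function.update s.reg 21 v, s.mem⟩) = p')
    (hq : ∀ v, q.map (Operand.eval w ⟨Function.update s.reg 21 v, s.mem⟩) = q')
    (hF : ∀ v t, t ∈ (I.rel r).nbrs p' q' →
      F ((Store.setReg w ⟨Function.update s.reg 21 v, s.mem⟩ x t.1).setReg w y t.2) ≤ G t) :
    wp w I (.randInt 21 (.const 1) (.reg z)) (wp w I (.neighbor r p q (.reg 21) x y) F) s ≤
      (∑ t ∈ ((I.rel r).nbrs p' q').toFinset, G t) / d := by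
  have h1 := Nat.mod_eq_of_lt hw1
  have e1 : (Finset.Icc 1 d).Nonempty := Finset.nonempty_Icc.2 hd0
  rw [wp]
  simp only [Operand.eval, hz, h1, if_pos e1, Nat.card_Icc, Nat.add_sub_cancel]
  have key : ∑ t ∈ ((I.rel r).nbrs p' q').toFinset, G t =
      ∑ v ∈ Finset.Icc 1 d, (((I.rel r).nbrs p' q')[v - 1]?).elim 0 G :=
    (sum_Icc_getElem? _ ((I.rel r).nbrs_nodup p' q') d hd.le (fun o => o.elim 0 G) rfl).symm
  rw [key]
  refine div_le_div_of_nonneg_right (Finset.sum_le_sum fun v hv => ?_) (by positivity)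
  rw [Finset.mem_Icc] at hv
  obtain ⟨i, rfl⟩ : ∃ i, v = i + 1 := ⟨v - 1, by omega⟩
  obtain ⟨t, ht⟩ : ∃ t, ((I.rel r).nbrs p' q')[i]? = some t :=
    ⟨_, List.getElem?_eq_getElem (by omega)⟩
  rw [setReg_of_lt (hv.2.trans_lt hdw), wp_neighbor (i := i) (t := t) _ (by simp [Operand.eval])
    (by rw [hp, hq, ht]), Nat.add_sub_cancel, ht]
  exact hF _ _ (List.mem_of_getElem? ht)

lemma sum_ite_ite {α : Type*} [DecidableEq α] (s : Finset α) (P : α → Prop) [DecidablePred P]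
    {t₀ : α} (h₀ : t₀ ∈ s) (hP : P t₀) (A B C : ℝ) :
    ∑ t ∈ s, (if P t then (if t = t₀ then A else B) else C) =
      A + ((s.filter P).card - 1 : ℝ) * B + (s.card - (s.filter P).card : ℝ) * C := by
  rw [Finset.sum_ite, Finset.sum_const, nsmul_eq_mul,
    ← Finset.add_sum_erase _ _ (Finset.mem_filter.2 ⟨h₀, hP⟩),
    Finset.sum_congr rfl (g := fun _ => B)
      (fun t ht => if_neg (Finset.ne_of_mem_erase ht)), Finset.sum_const, nsmul_eq_mul,
    Finset.card_erase_of_mem (Finset.mem_filter.2 ⟨h₀, hP⟩), if_pos rfl]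
  have h1 : 0 < (s.filter P).card := Finset.card_pos.2 ⟨t₀, Finset.mem_filter.2 ⟨h₀, hP⟩⟩
  have h2 := Finset.card_filter_add_card_filter_not (s := s) P
  rw [Nat.cast_sub h1, Nat.cast_one]
  have h3 : ((s.filter fun t => ¬ P t).card : ℝ) = s.card - (s.filter P).card := by
    rw [← h2]; push_cast; ring
  rw [h3]

/-- Among the tuples at the endpoint, one is the tuple of x itself and leads to acceptance, the
other W - 1 witnesses lead to rejection, and the rest are failed trials. -/
lemma sum_trial_left {n S t B : ℕ} {x : JoinTuple} (hx : x ∈ I.joined) (G : Sim → ℝ) :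
    ∑ y ∈ I.R₁.tuples.filter (fun y => y.1 = x.1.1),
        G (trial B n S x t y.2 ((y.2, x.2.2) ∈ I.R₂.tuples)) =
      G ⟨n, S + 1, none⟩ + (I.wit x.ends - 1 : ℝ) * G ⟨n, S, none⟩ +
        (I.R₁.degree (some x.1.1) none - I.wit x.ends : ℝ) *
          G ⟨n, S, if t + 1 < B then some (x, t + 1) else none⟩ := by
  obtain ⟨⟨h1, h2⟩, h3⟩ := I.mem_joined.1 hx
  rw [JoinTuple.ends, I.wit_eq_left, I.R₁.degree_left, ← sum_ite_ite _ _ (t₀ := x.1)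
    (by simpa using h1) (by rw [h3]; exact h2)]
  refine Finset.sum_congr rfl fun y hy => ?_
  rw [Finset.mem_filter] at hy
  simp only [trial, Prod.ext_iff, hy.2, true_and]
  split_ifs <;> rfl

lemma sum_trial_right {n S t B : ℕ} {x : JoinTuple} (hx : x ∈ I.joined) (G : Sim → ℝ) :
    ∑ y ∈ I.R₂.tuples.filter (fun y => y.2 = x.2.2),
        G (trial B n S x t y.1 ((x.1.1, y.1) ∈ I.R₁.tuples)) =
      G ⟨n, S + 1, none⟩ + (I.wit x.ends - 1 : ℝ) * G ⟨n, S, none⟩ +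
        (I.R₂.degree none (some x.2.2) - I.wit x.ends : ℝ) *
          G ⟨n, S, if t + 1 < B then some (x, t + 1) else none⟩ := by
  obtain ⟨⟨h1, h2⟩, h3⟩ := I.mem_joined.1 hx
  rw [JoinTuple.ends, I.wit_eq_right, I.R₂.degree_right, ← sum_ite_ite _ _ (t₀ := x.2)
    (by simpa using h2) (by rw [← h3]; exact h1)]
  refine Finset.sum_congr rfl fun y hy => ?_
  rw [Finset.mem_filter] at hy
  simp only [trial, Prod.ext_iff, hy.2, and_true, h3]
  split_ifs <;> rfl

lemma wp_search_le (hw : WordBounds w I f) {F : Store → ℝ} {s : Store} {n S t : ℕ} {x : JoinTuple}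
    (hs : Inv I f ⟨n, S, some (x, t)⟩ s) (hx : x ∈ I.joined)
    (hS : S + 1 < 2 ^ w) (ht : t < f.B) {G : Sim → ℝ}
    (hF : ∀ (isWit : Prop) [Decidable isWit] y s', Inv I f (trial f.B n S x t y isWit) s' →
      F s' ≤ G (trial f.B n S x t y isWit)) :
    wp w I search F s ≤ astep I f.τ f.B G ⟨n, S, some (x, t)⟩ := by
  have hs' := hs
  obtain ⟨h2, h3, h4, h7, h8, h9, h10, h12, h11, h13, h14, h15, h16, h17, h18⟩ := hs
  simp only at h11 h13
  obtain ⟨hx12, hx3⟩ := I.mem_joined.1 hx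
  have hpos := I.wit_pos hx
  have hle := I.wit_le_minDeg x.ends
  have h1 := Nat.mod_eq_of_lt hw.one_lt
  have hd1 := hw.degree₁_lt (some x.1.1) none
  have hd2 := hw.degree₂_lt none (some x.2.2)
  rw [search, block, wp, block, wp, block, wp]
  simp only [wp, Option.map_none, Option.map_some, Operand.eval, Instance.rel, h16,
    setReg_of_lt hd1, h18, Function.update_apply]
  norm_num [h18, setReg_of_lt hd2, Cmp.eval]
  -- Registers from 20 on are scratch; agreement below 20 preserves the invariant.
  have judge_le : ∀ (isWit : Prop) [Decidable isWit] (y : ℕ) (g : ℕ → ℕ),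
      (∀ i < 20, g i = s.reg i) → g 24 = y → g 26 = (if isWit then 1 else 0) →
      wp w I (block [judge]) (wp w I (block []) F) ⟨g, s.mem⟩ ≤ G (trial f.B n S x t y isWit) := by
    intro isWit _ y g hg hy hz
    refine wp_judge_le hw ?_ hS ht hy hz (hF isWit y)
    simp [Inv, CurInv, *]
  have hite : ∀ (c : Prop) [Decidable c], (if c then 1 else 0) < 2 ^ w := by
    intro c _
    have := hw.one_lt
    split_ifs <;> omega
  have hlt : ∀ i, i < 20 → i ≠ 21 ∧ i ≠ 22 ∧ i ≠ 23 ∧ i ≠ 24 ∧ i ≠ 25 ∧ i ≠ 26 := by omega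
  by_cases hc : I.R₁.degree (some x.1.1) none < I.R₂.degree none (some x.2.2)
  · have hm : I.minDeg x.ends = I.R₁.degree (some x.1.1) none := min_eq_left hc.le
    rw [hm] at hle
    rw [if_pos hc]
    simp only [astep, hm]
    rw [← sum_trial_left hx, ← StoredRel.toFinset_nbrs_left]
    refine wp_access_le (r := .R₁) (p' := some x.1.1) (q' := none) hw.one_lt (hpos.trans_le hle)
      hd1 22 (by simp) (I.R₁.degree_eq_length _ _).symm (by simp [Operand.eval, h16]) (by simp) ?_
    intro v y hy
    have hym := ((I.R₁.mem_nbrs _ _ _).1 hy).1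
    rw [setReg_of_lt (hw.fst₁_lt hym), setReg_of_lt (hw.snd₁_lt hym)]
    change wp w I (.test .R₂ (.reg 24) (.reg 18) 26)
      (wp w I (block [judge]) (wp w I (block []) F)) _ ≤ _
    simp only [wp, Operand.eval, Instance.rel]
    refine judge_le _ _ _ (fun i hi => ?_) (by simp)
      (by simp [h18]; exact Nat.mod_eq_of_lt (hite _))
    obtain ⟨i1, i2, i3, i4, i5, i6⟩ := hlt i hi
    simp [*]
  · have hm : I.minDeg x.ends = I.R₂.degree none (some x.2.2) := min_eq_right (not_lt.1 hc)
    rw [hm] at hle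
    rw [if_neg hc]
    simp only [astep, hm]
    rw [← sum_trial_right hx, ← StoredRel.toFinset_nbrs_right]
    refine wp_access_le (r := .R₂) (p' := none) (q' := some x.2.2) hw.one_lt (hpos.trans_le hle)
      hd2 23 (by simp) (I.R₂.degree_eq_length _ _).symm (by simp) (by simp [Operand.eval, h18]) ?_
    intro v y hy
    have hym := ((I.R₂.mem_nbrs _ _ _).1 hy).1
    rw [setReg_of_lt (hw.fst₂_lt hym), setReg_of_lt (hw.snd₂_lt hym)]
    change wp w I (.test .R₁ (.reg 16) (.reg 24) 26)
      (wp w I (block [judge]) (wp w I (block []) F)) _ ≤ _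
    simp only [wp, Operand.eval, Instance.rel]
    refine judge_le _ _ _ (fun i hi => ?_) (by simp)
      (by simp [h16]; exact Nat.mod_eq_of_lt (hite _))
    obtain ⟨i1, i2, i3, i4, i5, i6⟩ := hlt i hi
    simp [*]

lemma Sim.Valid.trial {n S t y : ℕ} {x : JoinTuple} {isWit : Prop} [Decidable isWit]
    (h : Sim.Valid I f ⟨n, S, some (x, t)⟩) : (trial f.B n S x t y isWit).Valid I f := by
  obtain ⟨h1, h2⟩ := h
  have h3 := h1 x t rfl
  simp only [reduceCtorEq, if_false] at h2
  unfold MatrixCount.trial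
  split_ifs with c1 c2 c3
  · exact ⟨by simp [Sim.Wf], by simp; omega⟩
  · exact ⟨by simp [Sim.Wf], by simp; omega⟩
  · refine ⟨?_, by simp; omega⟩
    intro x' t' h
    simp only [Option.some.injEq, Prod.mk.injEq] at h
    obtain ⟨rfl, rfl⟩ := h
    exact ⟨h3.1, c3⟩
  · exact ⟨by simp [Sim.Wf], by simp; omega⟩

/-- The body of the sampling loop performs one step of the sampling process. -/
theorem wp_body_le (hw : WordBounds w I f) {F : Store → ℝ} {s : Store} {σ : Sim}
    (hs : Inv I f σ s) (hσ : σ.Valid I f) {G : Sim → ℝ}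
    (hF : ∀ σ' s', Sim.Valid I f σ' → Inv I f σ' s' → F s' ≤ G σ') :
    wp w I body F s ≤ astep I f.τ f.B G σ := by
  have h0 : 0 % 2 ^ w = 0 := Nat.zero_mod _
  have hs' := hs
  obtain ⟨h2, h3, h4, h7, h8, h9, h10, h12, h11, h13, h14⟩ := hs'
  rcases σ with ⟨n, S, _ | ⟨x, t⟩⟩
  · simp only [CurInv] at h14
    cases n with
    | zero =>
      simp only [body, wp, Operand.eval, Cmp.eval, h14, h0, h11]
      exact hF _ _ hσ hs
    | succ n =>
      simp only [body, wp, Operand.eval, Cmp.eval, h14, h0, h11]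
      norm_num
      have hk := hσ.2
      simp only [if_true] at hk
      have hkw := hw.k_lt
      refine wp_draw_le hw (by omega) hs (G := fun o => G ⟨n, S, o.map fun x => (x, 0)⟩) ?_
      intro o s' ho hs'
      refine hF _ _ ⟨?_, ?_⟩ hs'
      · intro x t h
        simp only [Option.map_eq_some_iff, Prod.mk.injEq] at h
        obtain ⟨x', rfl, rfl, rfl⟩ := h
        exact ⟨ho _ rfl, hw.B_pos⟩
      · cases o <;> simp <;> omega
  · have hx := hσ.1 x t rfl
    have hk := hσ.2
    simp only [reduceCtorEq, if_false] at hk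
    have hkw := hw.k_lt
    simp only [CurInv] at h14
    simp only [body, wp, Operand.eval, Cmp.eval, h14.1, h0]
    norm_num
    exact wp_search_le hw hs hx.1 (by omega) hx.2 fun isWit _ y s' hs' => hF _ _ hσ.trial hs'

end

/-! ### The search for the right level -/

/-- The number of passes is fixed in advance by register 12. Once all samples are processed, the
remaining passes idle, and a run that is too slow ends unfinished and counts as a failure. -/
def sampleLoop : Program :=
  .loop .lt (.const 0) (.reg 12) (.seq body (.op .sub 12 (.reg 12) (.const 1)))

def levelInit : Program := block
  [.op .add 11 (.reg 8) (.const 0), .op .mul 12 (.reg 8) (.const 4), setConst 13 0, setConst 14 0]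

/-- Either continues with the next level or writes the output and stops the search. -/
def levelEnd : Program :=
  .ite .lt (.reg 13) (.reg 10)
    (block [.op .div 7 (.reg 7) (.const 2), .op .mul 8 (.reg 8) (.const 2),
      .op .mul 9 (.reg 9) (.const 2), setConst 0 0, setConst 1 1])
    (block [.op .mul 0 (.reg 13) (.reg 3), .op .mul 0 (.reg 0) (.reg 7),
      .op .add 1 (.reg 8) (.const 0), setConst 7 0])

def level : Program := .seq levelInit (.seq sampleLoop levelEnd)

def levels : Program := .loop .lt (.const 0) (.reg 7) level

/-- Rounds the output to the nearest integer if the flag is set. -/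
def finish : Program :=
  .ite .eq (.reg 4) (.const 1)
    (block [.op .mul 0 (.reg 0) (.const 2), .op .add 0 (.reg 0) (.reg 1),
      .op .mul 1 (.reg 1) (.const 2), .op .div 0 (.reg 0) (.reg 1), setConst 1 1])
    .skip

/-- The state at the start of a level. -/
def LevelInv (I : Instance) (f : Frame) (s : Store) : Prop :=
  s.reg 2 = I.R₁.tuples.card ∧ s.reg 3 = I.size ∧ s.reg 4 = f.flag ∧ s.reg 7 = f.τ ∧
  s.reg 8 = f.k ∧ s.reg 9 = f.B ∧ s.reg 10 = f.h

/-- The search has stopped, and the estimate for the output size is accurate. -/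
def Stopped (w : ℕ) (I : Instance) (flag e : ℕ) (s : Store) : Prop :=
  s.reg 7 = 0 ∧ s.reg 4 = flag ∧ 0 < s.reg 1 ∧ 2 * s.reg 0 + s.reg 1 < 2 ^ w ∧
  2 * s.reg 1 < 2 ^ w ∧ |(s.reg 0 : ℝ) / s.reg 1 - I.out| ≤ I.out / e

section

variable {w : ℕ} {I : Instance} {ε : ℝ} {f : Frame}

lemma bad_seq (P Q : Program) (k : List Program) (T : ℕ) (s : Store) :
    bad w I ε (T + 1) ⟨.seq P Q :: k, s⟩ = bad w I ε T ⟨P :: Q :: k, s⟩ :=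
  bad_succ_of_step_pure rfl

lemma WordBounds.withR (hw : WordBounds w I f) (R : ℕ) : WordBounds w I { f with R := R } :=
  ⟨hw.1, hw.2, hw.3, hw.4, hw.5, hw.6, hw.7, hw.8⟩

/-- The potential bounds the failure of this level and the constant β that of everything after it; a
step of the process preserves such a constant. The overhead 3 per pass is the loop test, the
sequencing and the decrement. -/
lemma bad_sampleLoop_le {e : ℕ} {Φ : ℕ → Sim → ℝ} (hw : WordBounds w I f)
    (hΦ : IsPotential I f.τ f.k e f.h f.B Φ) {K : List Program} {T : ℕ} {β : ℝ}
    (hend : ∀ σ s', Sim.Valid I f σ → Inv I { f with R := 0 } σ s' →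
      bad w I ε T ⟨K, s'⟩ ≤ Φ 0 σ + β)
    (R : ℕ) (hR : R < 2 ^ w) {σ : Sim} {s : Store} (hσ : σ.Valid I f)
    (hs : Inv I { f with R := R } σ s) :
    bad w I ε (T + 1 + R * (cost body + 3)) ⟨sampleLoop :: K, s⟩ ≤ Φ R σ + β := by
  induction R generalizing σ s with
  | zero =>
    rw [Nat.zero_mul, Nat.add_zero, sampleLoop, bad_loop_of_false]
    · exact hend σ s hσ hs
    · simp [Operand.eval, Cmp.eval, hs.2.2.2.2.2.2.2.1]
  | succ R ih =>
    have h12 : s.reg 12 = R + 1 := hs.2.2.2.2.2.2.2.1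
    rw [show T + 1 + (R + 1) * (cost body + 3) = (T + 1 + R * (cost body + 3)) +
      cost (.seq body (.op .sub 12 (.reg 12) (.const 1))) + 1 by simp only [cost]; ring,
      sampleLoop, bad_loop_of_true (by simp [Operand.eval, Cmp.eval, h12])]
    refine (bad_le_wp _ _ _ _).trans ?_
    rw [wp]
    refine (wp_body_le (hw.withR (R + 1)) hs hσ (G := fun σ => Φ R σ + β) ?_).trans ?_
    · intro σ' s' hσ' hs'
      have h12' : s'.reg 12 = R + 1 := hs'.2.2.2.2.2.2.2.1
      have hsub : s'.setReg w 12 (R + 1 + (2 ^ w - 1)) = ⟨Function.update s'.reg 12 R, s'.mem⟩ := by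
        rw [Store.setReg, show R + 1 + (2 ^ w - 1) = R + 2 ^ w by have := hw.one_lt; omega,
          Nat.add_mod_right, Nat.mod_eq_of_lt (by omega)]
      simp only [wp, Operand.eval, BinOp.eval, h12', Nat.mod_eq_of_lt hw.one_lt, hsub]
      refine ih (by omega) hσ' ?_
      obtain ⟨h2, h3, h4, h7, h8, h9, h10, h12, h11, h13, h14⟩ := hs'
      refine ⟨?_, ?_, ?_, ?_, ?_, ?_, ?_, ?_, ?_, ?_, ?_⟩
      case refine_11 =>
        rcases σ' with ⟨n, S, _ | ⟨x, t⟩⟩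
        · simpa [CurInv] using h14
        · simpa [CurInv] using h14
      all_goals simp [*]
    · rw [astep_add, astep_const hw.size_pos hw.tau_pos _ hσ.1]
      gcongr
      exact hΦ.step_le R σ hσ.1

/-- If e was truncated to 4N², then OUT ≤ N² makes the absolute error at most 1/4, and rounding
returns OUT exactly, whatever ε is. Otherwise 1/e ≤ ε suffices. -/
lemma bad_finish_le (hε : 0 < ε) (hw : 1 < 2 ^ w) (hN : 0 < I.size) {flag e : ℕ}
    {s : Store} (h0 : flag ≠ 1 → 1 / (e : ℝ) ≤ ε) (h1 : flag = 1 → e = 4 * I.size ^ 2)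
    (hs : Stopped w I flag e s) :
    bad w I ε (cost finish) ⟨[finish], s⟩ ≤ 0 := by
  obtain ⟨h7, h4, hpos, hlt, hlt', happ⟩ := hs
  have hgood : ∀ T s', Good ε I ⟨[], s'⟩ → bad w I ε T ⟨[], s'⟩ ≤ 0 :=
    fun T s' h => (bad_nil_of_good h).le
  have hpos' : (0 : ℝ) < s.reg 1 := by exact_mod_cast hpos
  refine (Nat.zero_add (cost finish) ▸ bad_le_wp finish [] 0 s).trans ?_
  have e1 := Nat.mod_eq_of_lt hw
  simp only [finish, wp, Operand.eval, Cmp.eval, h4, e1, decide_eq_true_eq]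
  split_ifs with hf
  · have e2 : 2 % 2 ^ w = 2 := Nat.mod_eq_of_lt (by omega)
    have e0 : 0 % 2 ^ w = 0 := Nat.zero_mod _
    -- Rounding a/b to the nearest integer is the floor of a/b + 1/2.
    have hE : (2 * s.reg 0 + s.reg 1) / (2 * s.reg 1) = I.out := by
      have hout : (I.out : ℝ) / e ≤ 1 / 4 := by
        have h2 : (I.out : ℝ) ≤ (I.size : ℝ) ^ 2 := by exact_mod_cast I.out_le_size_sq
        have hN' : (0 : ℝ) < I.size := by exact_mod_cast hN
        rw [h1 hf]
        push_cast
        rw [div_le_iff₀ (by positivity)]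
        linarith
      have h2 := abs_le.1 (happ.trans hout)
      have h3 : (I.out : ℝ) - 1 / 4 ≤ s.reg 0 / s.reg 1 := by linarith
      have h4 : (s.reg 0 : ℝ) / s.reg 1 ≤ I.out + 1 / 4 := by linarith
      rw [le_div_iff₀ hpos'] at h3
      rw [div_le_iff₀ hpos'] at h4
      refine Nat.div_eq_of_lt_le ?_ ?_
      · have : (I.out * (2 * s.reg 1) : ℝ) ≤ 2 * s.reg 0 + s.reg 1 := by linarith
        exact_mod_cast this
      · have : (2 * s.reg 0 + s.reg 1 : ℝ) < (I.out + 1) * (2 * s.reg 1) := by linarith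
        exact_mod_cast this
    have hout2 : I.out < 2 ^ w := by
      rw [← hE]; exact (Nat.div_le_self _ _).trans_lt hlt
    have e3 : (s.reg 0 * 2 % 2 ^ w) = 2 * s.reg 0 := by
      rw [mul_comm, Nat.mod_eq_of_lt (by omega)]
    have e4 : (s.reg 1 * 2 % 2 ^ w) = 2 * s.reg 1 := by
      rw [mul_comm, Nat.mod_eq_of_lt (by omega)]
    have e5 := Nat.mod_eq_of_lt hlt
    have e6 := Nat.mod_eq_of_lt hout2
    simp only [block, wp, setConst, Operand.eval, BinOp.eval, Store.setReg, e0, e1, e2]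
    refine hgood _ _ ⟨rfl, ?_, ?_⟩
    · simp
    · simp only [Function.update_apply]
      norm_num [e1, e3, e4, e5, hE, e6]
      constructor <;> nlinarith [(Nat.cast_nonneg I.out : (0 : ℝ) ≤ I.out)]
  · refine hgood _ _ ⟨rfl, hpos.ne', ?_⟩
    have h2 : (I.out : ℝ) / e ≤ ε * I.out := by
      rw [div_eq_mul_one_div, mul_comm ε]
      exact mul_le_mul_of_nonneg_left (h0 hf) (Nat.cast_nonneg _)
    have h3 := abs_le.1 (happ.trans h2)
    constructor <;> simp only <;> linarith

lemma trials_le_samples {e l : ℕ} (he : 1 ≤ e) (hl : 1 ≤ l) (r : ℕ) :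
    16 * e * r ≤ 2048 * e ^ 2 * l * r := by
  calc 16 * e * r = 16 * e ^ 1 * 1 * r := by ring
    _ ≤ 2048 * e ^ 2 * l * r := by gcongr <;> omega

lemma bad_levelEnd_le {r e l : ℕ} (P : LevelParams I f.τ r e l f.k f.B f.h)
    (hw : WordBounds w I f) (hbig : 4 * (f.k * I.size * f.τ) < 2 ^ w) {K : List Program} {T : ℕ}
    {β : ℝ} {S : ℕ} (hS : S ≤ f.k)
    (hest : f.h ≤ S → |(S * (I.size * f.τ) / f.k : ℝ) - I.out| ≤ I.out / e)
    (hstopped : ∀ s', Stopped w I f.flag e s' → bad w I ε T ⟨K, s'⟩ ≤ β)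
    (hcont : S < f.h → ∀ s',
      LevelInv I { f with τ := f.τ / 2, k := f.k * 2, B := f.B * 2 } s' →
      s'.reg 0 = 0 → s'.reg 1 = 1 → bad w I ε T ⟨K, s'⟩ ≤ β)
    {s' : Store} (hs' : Inv I { f with R := 0 } ⟨0, S, none⟩ s') :
    bad w I ε (T + cost levelEnd) ⟨levelEnd :: K, s'⟩ ≤ β := by
  have hk := P.k_pos
  have hN := hw.size_pos
  have hτ := hw.tau_pos
  have h0 : 0 % 2 ^ w = 0 := Nat.zero_mod _
  have e5 : f.k ≤ f.k * I.size * f.τ := by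
    rw [mul_assoc]; exact Nat.le_mul_of_pos_right _ (Nat.mul_pos hN hτ)
  have h2 : 2 % 2 ^ w = 2 := Nat.mod_eq_of_lt (by omega)
  obtain ⟨q2, q3, q4, q7, q8, q9, q10, q12, q11, q13, q14⟩ := hs'
  simp only at q2 q3 q4 q7 q8 q9 q10 q12 q11 q13
  refine (bad_le_wp _ _ _ _).trans ?_
  simp only [levelEnd, wp, Operand.eval, Cmp.eval, decide_eq_true_eq, q13, q10]
  split_ifs with hc
  · have hBk : f.B ≤ f.k := by
      rw [P.k_eq, P.B_eq]
      exact trials_le_samples (by have := P.two_le_e; omega) P.l_pos r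
    simp only [block, wp, wp_setConst hw zero_le_one, wp_setConst hw le_rfl, Operand.eval,
      BinOp.eval, h2, Store.setReg, Function.update_apply]
    norm_num [q7, q8, q9]
    have e3 : f.τ / 2 % 2 ^ w = f.τ / 2 :=
      Nat.mod_eq_of_lt ((Nat.div_le_self _ _).trans_lt hw.tau_lt)
    have e4 : f.k * 2 % 2 ^ w = f.k * 2 := Nat.mod_eq_of_lt (by omega)
    have e5 : f.B * 2 % 2 ^ w = f.B * 2 := Nat.mod_eq_of_lt (by omega)
    rw [e3, e4, e5]
    refine hcont hc _ ?_ (by simp) (by simp)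
    simp [LevelInv, *]
  · have e3 : S * I.size * f.τ ≤ f.k * I.size * f.τ := by gcongr
    have e4 : S * I.size ≤ S * I.size * f.τ := Nat.le_mul_of_pos_right _ hτ
    have e2 : f.k % 2 ^ w = f.k := Nat.mod_eq_of_lt hw.k_lt
    have e6 : S * I.size % 2 ^ w = S * I.size := Nat.mod_eq_of_lt (by omega)
    have e7 : S * I.size * f.τ % 2 ^ w = S * I.size * f.τ := Nat.mod_eq_of_lt (by omega)
    simp only [block, wp, wp_setConst hw zero_le_one, Operand.eval, BinOp.eval, h0, Store.setReg,
      Function.update_apply]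
    norm_num [q3, q7, q8, q13, e2, e6, e7]
    refine hstopped _ ⟨by simp, by simp [q4], by simpa using hk, ?_, ?_, ?_⟩
    · simp only [Function.update_apply]
      norm_num
      omega
    · simp only [Function.update_apply]
      norm_num
      omega
    · simp only [Function.update_apply]
      norm_num
      rw [mul_assoc]
      exact hest (not_lt.1 hc)

/-- A union bound over one level and its continuation. The continuation is needed only for τ² >
4·OUT, since continuing with a smaller τ is one of the failures that the potential covers. -/
lemma bad_level_le {r e l : ℕ} (P : LevelParams I f.τ r e l f.k f.B f.h) (hw : WordBounds w I f)
    (hbig : 4 * (f.k * I.size * f.τ) < 2 ^ w) {K : List Program} {T : ℕ} {β : ℝ} (hβ : 0 ≤ β)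
    (hstopped : ∀ s', Stopped w I f.flag e s' → bad w I ε T ⟨K, s'⟩ ≤ β)
    (hcont : ¬ f.τ ^ 2 ≤ 4 * I.out → ∀ s',
      LevelInv I { f with τ := f.τ / 2, k := f.k * 2, B := f.B * 2 } s' →
      s'.reg 0 = 0 → s'.reg 1 = 1 → bad w I ε T ⟨K, s'⟩ ≤ β)
    {s : Store} (hs : LevelInv I f s) :
    bad w I ε (T + f.k * (4 * cost body + cost levelEnd + cost levelInit + 15)) ⟨level :: K, s⟩ ≤
      3 * Real.exp (-(2 * l)) + β := by
  obtain ⟨Φ, hΦ, hΦk⟩ := P.exists_potential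
  have hk := P.k_pos
  have hkk : 4 * f.k < 2 ^ w := by
    have e5 : f.k ≤ f.k * I.size * f.τ := by
      rw [mul_assoc]; exact Nat.le_mul_of_pos_right _ (Nat.mul_pos hw.size_pos hw.tau_pos)
    omega
  have h4 : 4 % 2 ^ w = 4 := Nat.mod_eq_of_lt (by omega)
  have h0 : 0 % 2 ^ w = 0 := Nat.zero_mod _
  refine le_trans (bad_antitone _ (?_ : ((T + cost levelEnd + 1 + (4 * f.k) * (cost body + 3)) + 1
    + cost levelInit) + 1 ≤ _)) ?_
  · have : 1 * (cost levelEnd + cost levelInit + 3) ≤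
      f.k * (cost levelEnd + cost levelInit + 3) := Nat.mul_le_mul_right _ hk
    linarith
  beta_reduce
  rw [level, bad_seq]
  refine (bad_le_wp _ _ _ _).trans ?_
  obtain ⟨r2, r3, r4, r7, r8, r9, r10⟩ := hs
  have e1 : 4 * f.k % 2 ^ w = 4 * f.k := Nat.mod_eq_of_lt hkk
  have e2 : f.k % 2 ^ w = f.k := Nat.mod_eq_of_lt hw.k_lt
  simp only [levelInit, block, wp, wp_setConst hw zero_le_one, Operand.eval, BinOp.eval, h0, h4,
    Store.setReg, Function.update_apply]
  norm_num [r8, mul_comm f.k 4, e1, e2]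
  rw [bad_seq]
  refine (bad_sampleLoop_le (σ := ⟨f.k, 0, none⟩) (β := β) hw hΦ ?_ (4 * f.k) hkk
    ⟨by simp [Sim.Wf], by simp⟩ ?_).trans (by linarith)
  · intro σ s' hσ hs'
    -- In a failed state the potential is at least 1 and the bound is trivial; otherwise the level
    -- ends correctly and only β is charged.
    by_cases hf : LevelFail I f.τ f.k e f.h σ
    · exact (bad_le_one _ _).trans (by linarith [hΦ.one_le σ hσ.1 hf])
    · have hΦ0 := hΦ.nonneg σ hσ.1
      suffices bad w I ε (T + cost levelEnd) ⟨levelEnd :: K, s'⟩ ≤ β by linarith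
      simp only [LevelFail, not_or, not_not, not_and] at hf
      obtain ⟨n, S, cur⟩ := σ
      obtain ⟨rfl, rfl, hf3, hf4⟩ := hf
      exact bad_levelEnd_le P hw hbig (by simpa using hσ.2) hf3 hstopped
        (fun hc => hcont (hf4 hc)) hs'
  · simp [Inv, CurInv, *]

/-- The cost of the levels per sample of the first level. -/
def levelCost : ℕ := 4 * cost body + cost levelEnd + cost levelInit + 16

def levelFrame (flag e l r τ : ℕ) : Frame where
  flag := flag
  τ := τ
  k := 2048 * e ^ 2 * l * r
  B := 16 * e * r
  h := 128 * e ^ 2 * l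
  R := 0

theorem bad_levels_le (hε : 0 < ε) (hN : 0 < I.size) (hfit : I.FitsWord w) {flag e l : ℕ}
    (he : 2 ≤ e) (hl : 0 < l)
    (h0 : flag ≠ 1 → 1 / (e : ℝ) ≤ ε) (h1 : flag = 1 → e = 4 * I.size ^ 2)
    {i₀ : ℕ} (hi₀ : I.out ≤ 4 ^ i₀) (hmin : ∀ i, i + 1 = i₀ → 4 ^ i < I.out) (d : ℕ) :
    ∀ (r : ℕ) (s : Store), 0 < r → I.size ≤ r * 2 ^ (i₀ + d) →
      4 * (2048 * e ^ 2 * l * r * I.size * 2 ^ (i₀ + d)) < 2 ^ w →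
      LevelInv I (levelFrame flag e l r (2 ^ (i₀ + d))) s →
      bad w I ε (cost finish + 1 + 2048 * e ^ 2 * l * r * (2 * 2 ^ d - 1) * levelCost)
        ⟨[levels, finish], s⟩ ≤ (d + 1) * (3 * Real.exp (-(2 * l))) := by
  have hstopped : ∀ (k : ℕ) (s' : Store), 1 < 2 ^ w → Stopped w I flag e s' →
      bad w I ε (cost finish + 1 + k) ⟨[levels, finish], s'⟩ ≤ 0 := by
    intro k s' h1w hs'
    refine (bad_antitone _ (Nat.le_add_right _ _)).trans ?_
    simp only
    rw [levels, bad_loop_of_false]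
    · exact bad_finish_le hε h1w hN h0 h1 hs'
    · simp [Operand.eval, Cmp.eval, hs'.1]
  have main : ∀ (d r c : ℕ) (s : Store) (β : ℝ), 0 ≤ β → 0 < r → I.size ≤ r * 2 ^ (i₀ + d) →
      4 * (2048 * e ^ 2 * l * r * I.size * 2 ^ (i₀ + d)) < 2 ^ w →
      LevelInv I (levelFrame flag e l r (2 ^ (i₀ + d))) s →
      (∀ s', ¬ (2 ^ (i₀ + d)) ^ 2 ≤ 4 * I.out →
        LevelInv I (levelFrame flag e l (r * 2) (2 ^ (i₀ + d) / 2)) s' →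
        s'.reg 0 = 0 → s'.reg 1 = 1 →
        bad w I ε (cost finish + 1 + c) ⟨[levels, finish], s'⟩ ≤ β) →
      bad w I ε (cost finish + 1 + (c + 2048 * e ^ 2 * l * r * levelCost)) ⟨[levels, finish], s⟩ ≤
        3 * Real.exp (-(2 * l)) + β := by
    intro d r c s β hβ hr hM hbig hs hcont
    have hp : 0 < 2 ^ (i₀ + d) := by positivity
    have hk : 0 < 2048 * e ^ 2 * l * r := by positivity
    have hP : LevelParams I (2 ^ (i₀ + d)) r e l (2048 * e ^ 2 * l * r) (16 * e * r)
        (128 * e ^ 2 * l) := by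
      refine ⟨hN, hp, hr, he, hl, ?_, hM, rfl, rfl, rfl⟩
      calc I.out ≤ 4 ^ i₀ := hi₀
        _ ≤ 4 ^ (i₀ + d) := Nat.pow_le_pow_right (by norm_num) (by omega)
        _ = _ := by rw [← pow_mul, mul_comm, pow_mul]; norm_num
    have b1 : 2048 * e ^ 2 * l * r ≤ 2048 * e ^ 2 * l * r * I.size * 2 ^ (i₀ + d) := by
      rw [mul_assoc _ I.size]; exact Nat.le_mul_of_pos_right _ (Nat.mul_pos hN hp)
    have b3 : 1 * 2 ^ (i₀ + d) ≤ 2048 * e ^ 2 * l * r * I.size * 2 ^ (i₀ + d) :=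
      Nat.mul_le_mul_right _ (Nat.mul_pos hk hN)
    have b2 : 1 * I.size * 1 ≤ 2048 * e ^ 2 * l * r * I.size * 2 ^ (i₀ + d) :=
      Nat.mul_le_mul (Nat.mul_le_mul_right _ hk) hp
    have b4 : 16 * e * r ≤ 2048 * e ^ 2 * l * r := trials_le_samples (by omega) hl r
    have hw : WordBounds w I (levelFrame flag e l r (2 ^ (i₀ + d))) :=
      ⟨hfit, hN, hp, by simp only [levelFrame]; positivity, by omega,
        by simp only [levelFrame]; omega, by simp only [levelFrame]; omega,
        by simp only [levelFrame]; omega⟩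
    refine (bad_antitone _ (?_ : (cost finish + 1 + c + 2048 * e ^ 2 * l * r *
      (4 * cost body + cost levelEnd + cost levelInit + 15)) + 1 ≤ _)).trans ?_
    · unfold levelCost
      linarith
    simp only
    rw [levels, bad_loop_of_true (by simp [Operand.eval, Cmp.eval, hs.2.2.2.1, levelFrame])]
    refine bad_level_le (f := levelFrame flag e l r (2 ^ (i₀ + d))) hP hw hbig hβ ?_ ?_ hs
    · exact fun s' hs' => (hstopped c s' hw.one_lt hs').trans hβ
    · intro hτ s' hs' e0 e1
      refine hcont s' hτ ?_ e0 e1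
      simp only [levelFrame] at hs' ⊢
      rwa [← mul_assoc, ← mul_assoc]
  induction d with
  | zero =>
    intro r s hr hM hbig hs
    have := main 0 r 0 s 0 le_rfl hr hM hbig hs ?_
    · simpa using this
    · intro s' hτ hs' e0 e1
      have h1w : 2 < 2 ^ w := by
        refine lt_of_le_of_lt ?_ hbig
        have : 0 < 2048 * e ^ 2 * l * r := by positivity
        calc 2 ≤ 4 * (1 * 1 * 1) := by norm_num
          _ ≤ _ := by gcongr; exacts [this, hN, Nat.one_le_two_pow]
      refine hstopped 0 s' (by omega) ?_
      rcases i₀ with _ | i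
      -- An empty result: τ = 1 is halved to 0, which ends the loop with the preset output 0/1.
      · have hout : I.out = 0 := by
          simp at hτ; omega
        have h7 : s'.reg 7 = 0 := hs'.2.2.2.1
        exact ⟨h7, hs'.2.2.1, by omega, by omega, by omega, by simp [hout, e0]⟩
      -- By minimality of i₀ the last level has τ² = 4^i₀ ≤ 4·OUT, so it may not continue.
      · exfalso
        apply hτ
        have := hmin i rfl
        rw [Nat.add_zero, ← pow_mul, mul_comm, pow_mul, pow_succ]
        norm_num
        omega
  | succ d ih =>
    intro r s hr hM hbig hs
    have e1 : 2 ^ (i₀ + (d + 1)) / 2 = 2 ^ (i₀ + d) := by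
      rw [← add_assoc, pow_succ]; simp
    have e2 : 2048 * e ^ 2 * l * r * (2 * 2 ^ (d + 1) - 1) * levelCost =
        2048 * e ^ 2 * l * (r * 2) * (2 * 2 ^ d - 1) * levelCost +
          2048 * e ^ 2 * l * r * levelCost := by
      have : 2 * 2 ^ (d + 1) - 1 = 2 * (2 * 2 ^ d - 1) + 1 := by
        have := Nat.one_le_two_pow (n := d)
        rw [pow_succ]; omega
      rw [this]; ring
    rw [e2]
    refine (main (d + 1) r _ s ((d + 1) * (3 * Real.exp (-(2 * l)))) (by positivity) hr hM hbig hs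
      ?_).trans (le_of_eq (by push_cast; ring))
    intro s' _ hs' _ _
    refine ih (r * 2) s' (by omega) ?_ ?_ (e1 ▸ hs')
    · refine hM.trans (le_of_eq ?_)
      rw [← add_assoc, pow_succ]; ring
    · refine lt_of_le_of_lt (le_of_eq ?_) hbig
      rw [← add_assoc, pow_succ]; ring

end

/-! ### The complete program -/

/-- Adds the number of binary digits of `reg 6` to `reg 5` and doubles `reg d` for every digit. -/
def halve (d : ℕ) : Program :=
  .loop .lt (.const 0) (.reg 6) (block [.op .div 6 (.reg 6) (.const 2),
    .op .add 5 (.reg 5) (.const 1), .op .mul d (.reg d) (.const 2)])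

/-- Computes the input size and bounds `reg 0` by four times its square. -/
def readInput : Program := block
  [.degree .R₁ none none 2, .degree .R₂ none none 20, .op .add 3 (.reg 2) (.reg 20),
   .op .mul 20 (.reg 3) (.reg 3), .op .mul 20 (.reg 20) (.const 4),
   .ite .lt (.reg 20) (.reg 0) (block [.op .add 0 (.reg 20) (.const 0), setConst 4 1]) .skip,
   setConst 7 1, .op .add 6 (.reg 3) (.const 0)]

/-- Computes the parameters of the first level. -/
def setParams : Program := block
  [.op .mul 10 (.reg 0) (.reg 0), .op .mul 10 (.reg 10) (.reg 5),
   .op .mul 10 (.reg 10) (.const 128), .op .mul 8 (.reg 10) (.const 16),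
   .op .mul 9 (.reg 0) (.const 16)]

/-- The first halving loop leaves 2^(size of N) in register 7, the initial τ, and the two loops
together leave l, the sum of the binary lengths of N and of the second parameter, in register 5. The
doubling of register 20 in the second loop has no use. -/
def countProgram : Program :=
  .seq readInput (.seq (halve 7) (.seq (.op .add 6 (.reg 1) (.const 0)) (.seq (halve 20)
    (.seq setParams (.seq levels finish)))))

lemma size_eq_size_half {x : ℕ} (hx : 0 < x) : x.size = (x / 2).size + 1 := by
  refine le_antisymm ?_ ?_
  · rw [Nat.size_le, pow_succ]
    have := Nat.lt_size_self (x / 2)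
    omega
  · by_contra h
    obtain ⟨j, hj⟩ : ∃ j, x.size = j + 1 :=
      ⟨x.size - 1, by have := Nat.size_pos.2 hx; omega⟩
    have h1 : x.size ≤ j + 1 := hj.le
    rw [Nat.size_le, pow_succ] at h1
    have h2 : (x / 2).size ≤ j := Nat.size_le.2 (by omega)
    omega

lemma two_pow_size_le {x : ℕ} (hx : 0 < x) : 2 ^ x.size ≤ 2 * x := by
  obtain ⟨j, hj⟩ : ∃ j, x.size = j + 1 := ⟨x.size - 1, by have := Nat.size_pos.2 hx; omega⟩
  have : 2 ^ j ≤ x := Nat.lt_size.1 (by omega)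
  rw [hj, pow_succ]
  omega

section

variable {w : ℕ} {I : Instance} {ε : ℝ}

/-- The cost of one step of the halving loop. -/
def halveCost : ℕ := 8

/-- The doubled register is described only modulo 2^w, because the scratch register of the second
use may overflow. -/
lemma bad_halve_le {d : ℕ} (h5 : d ≠ 5) (h6 : d ≠ 6) (hw : 2 < 2 ^ w) {K : List Program} {T : ℕ}
    {β : ℝ} (x : ℕ) :
    ∀ (l : ℕ) (s : Store), s.reg 6 = x → s.reg 5 = l → x < 2 ^ w → l + x.size < 2 ^ w →
      s.reg d < 2 ^ w →
      (∀ s' : Store, (∀ i, i ≠ 5 → i ≠ 6 → i ≠ d → s'.reg i = s.reg i) →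
        s'.reg 5 = l + x.size → s'.reg d = s.reg d * 2 ^ x.size % 2 ^ w →
        bad w I ε T ⟨K, s'⟩ ≤ β) →
      bad w I ε (T + 1 + x.size * halveCost) ⟨halve d :: K, s⟩ ≤ β := by
  have e0 : 0 % 2 ^ w = 0 := Nat.zero_mod _
  have e1 : 1 % 2 ^ w = 1 := Nat.mod_eq_of_lt (by omega)
  have e2 : 2 % 2 ^ w = 2 := Nat.mod_eq_of_lt hw
  induction x using Nat.strong_induction_on with
  | _ x ih =>
    intro l s hx hl hxw hlw hd hend
    rcases Nat.eq_zero_or_pos x with rfl | hpos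
    · rw [halve, Nat.size_zero, Nat.zero_mul, Nat.add_zero, bad_loop_of_false]
      · exact hend s (fun _ _ _ _ => rfl) (by simpa using hl) (by simp [Nat.mod_eq_of_lt hd])
      · simp [Operand.eval, Cmp.eval, hx]
    · have hsz := size_eq_size_half hpos
      rw [hsz, show T + 1 + ((x / 2).size + 1) * halveCost =
        T + 1 + (x / 2).size * halveCost + cost (block [.op .div 6 (.reg 6) (.const 2),
          .op .add 5 (.reg 5) (.const 1), .op .mul d (.reg d) (.const 2)]) + 1 by
          simp only [cost, block, halveCost]; ring, halve,
        bad_loop_of_true (by simp [Operand.eval, Cmp.eval, hx, hpos])]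
      refine (bad_le_wp _ _ _ _).trans ?_
      have q1 : x / 2 % 2 ^ w = x / 2 :=
        Nat.mod_eq_of_lt ((Nat.div_le_self _ _).trans_lt hxw)
      have q2 : (l + 1) % 2 ^ w = l + 1 := Nat.mod_eq_of_lt (by omega)
      simp only [block, wp, Operand.eval, BinOp.eval, e1, e2, Store.setReg, Function.update_apply,
        hx, q1]
      norm_num [hl, q2, h5, h6]
      refine ih (x / 2) (by omega) (l + 1) _ ?_ ?_ (by omega) (by omega) ?_ ?_
      · simp [h6.symm]
      · simp [h5.symm]
      · simp only [Function.update_self]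
        exact Nat.mod_lt _ (by omega)
      · intro s' hs' hl' hd'
        refine hend s' ?_ (by omega) ?_
        · intro i i5 i6 id
          rw [hs' i i5 i6 id]
          simp [i5, i6, id]
        · rw [hd']
          simp only [Function.update_self]
          rw [Nat.mod_mul_mod, hsz, pow_succ]
          congr 1
          ring

lemma wp_setParams {e l : ℕ} {s : Store} (F : Store → ℝ) (he : 1 ≤ e) (hl : 1 ≤ l)
    (hlt : 2048 * e ^ 2 * l < 2 ^ w) (h0 : s.reg 0 = e) (h5 : s.reg 5 = l) :
    ∃ g : ℕ → ℕ, wp w I setParams F s = F ⟨g, s.mem⟩ ∧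
      (∀ i, i ≠ 8 → i ≠ 9 → i ≠ 10 → g i = s.reg i) ∧ g 8 = 2048 * e ^ 2 * l ∧ g 9 = 16 * e ∧
      g 10 = 128 * e ^ 2 * l := by
  have hee : 1 * 1 ≤ e * e := Nat.mul_le_mul he he
  have h1 : e * e ≤ e * e * l := Nat.le_mul_of_pos_right _ hl
  have h2 : e ≤ e * e := Nat.le_mul_of_pos_right _ he
  rw [mul_assoc, sq] at hlt
  have e1 : e * e % 2 ^ w = e * e := Nat.mod_eq_of_lt (by omega)
  have e2 : e * e * l % 2 ^ w = e * e * l := Nat.mod_eq_of_lt (by omega)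
  have e3 : e * e * l * 128 % 2 ^ w = e * e * l * 128 := Nat.mod_eq_of_lt (by omega)
  have e4 : e * e * l * 128 * 16 % 2 ^ w = e * e * l * 128 * 16 := Nat.mod_eq_of_lt (by omega)
  have e5 : e * 16 % 2 ^ w = e * 16 := Nat.mod_eq_of_lt (by omega)
  have e6 : 128 % 2 ^ w = 128 := Nat.mod_eq_of_lt (by omega)
  have e7 : 16 % 2 ^ w = 16 := Nat.mod_eq_of_lt (by omega)
  refine ⟨_, by
    simp only [setParams, block, wp, Operand.eval, BinOp.eval, e6, e7, Store.setReg,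
      Function.update_apply]
    norm_num [h0, h5, e1, e2, e3, e4, e5]
    rfl, ?_, ?_, ?_, ?_⟩
  · intro i i8 i9 i10
    simp [i8, i9, i10]
  · simp; ring
  · simp; ring
  · simp; ring

/-- The program's bound for `1 / ε`, and the flag that tells whether it is smaller than `E`. -/
def clamp (N E : ℕ) : ℕ := if 4 * N ^ 2 < E then 4 * N ^ 2 else E

def clampFlag (N E : ℕ) : ℕ := if 4 * N ^ 2 < E then 1 else 0

lemma wp_readInput {E D : ℕ} (hN : 0 < I.size) (hlt : 4 * I.size ^ 2 < 2 ^ w)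
    (F : Store → ℝ) :
    ∃ g : ℕ → ℕ, wp w I readInput F (start .skip E D).st = F ⟨g, (start .skip E D).st.mem⟩ ∧
      g 0 = clamp I.size E ∧ g 1 = D ∧ g 2 = I.R₁.tuples.card ∧ g 3 = I.size ∧
      g 4 = clampFlag I.size E ∧ g 5 = 0 ∧ g 6 = I.size ∧ g 7 = 1 ∧ g 20 < 2 ^ w := by
  have hs : I.size ≤ I.size ^ 2 := Nat.le_self_pow two_ne_zero _
  have hsz : I.R₁.tuples.card + I.R₂.tuples.card = I.size := rfl
  have e0 : 0 % 2 ^ w = 0 := Nat.zero_mod _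
  have e1 : 1 % 2 ^ w = 1 := Nat.mod_eq_of_lt (by omega)
  have e4 : 4 % 2 ^ w = 4 := by
    have : 1 ≤ I.size ^ 2 := Nat.one_le_pow _ _ hN
    rcases Nat.lt_or_ge 4 (2 ^ w) with h | h
    · exact Nat.mod_eq_of_lt h
    · omega
  have q1 : I.R₁.degree none none = I.R₁.tuples.card := by
    rw [StoredRel.degree_eq_length, StoredRel.length_nbrs_none]
  have q2 : I.R₂.degree none none = I.R₂.tuples.card := by
    rw [StoredRel.degree_eq_length, StoredRel.length_nbrs_none]
  have m1 : I.R₁.tuples.card % 2 ^ w = I.R₁.tuples.card := Nat.mod_eq_of_lt (by omega)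
  have m2 : I.R₂.tuples.card % 2 ^ w = I.R₂.tuples.card := Nat.mod_eq_of_lt (by omega)
  have m3 : I.size % 2 ^ w = I.size := Nat.mod_eq_of_lt (by omega)
  have m4 : I.size * I.size % 2 ^ w = I.size * I.size := by
    rw [← sq]; exact Nat.mod_eq_of_lt (by omega)
  have m5 : I.size * I.size * 4 % 2 ^ w = 4 * I.size ^ 2 := by
    rw [← sq, mul_comm]; exact Nat.mod_eq_of_lt hlt
  have m6 : 4 * I.size ^ 2 % 2 ^ w = 4 * I.size ^ 2 := Nat.mod_eq_of_lt hlt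
  simp only [readInput, block, wp, setConst, Operand.eval, BinOp.eval, Cmp.eval, Store.setReg,
    Function.update_apply, e0, e1, e4, Instance.rel, Option.map_none, q1, q2, m1, m2,
    decide_eq_true_eq, start]
  norm_num [hsz, m3, m4, m5, m6, e1]
  unfold clamp clampFlag
  split_ifs with hc
  · refine ⟨_, rfl, ?_, ?_, ?_, ?_, ?_, ?_, ?_, ?_, ?_⟩ <;> simp [hlt]
  · refine ⟨_, rfl, ?_, ?_, ?_, ?_, ?_, ?_, ?_, ?_, ?_⟩ <;> simp [hlt]

end

/-! ### Bounds for the word length, the failure probability and the running time -/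

lemma sq_lt_two_pow {w : ℕ} (hw : 5 ≤ w) : w ^ 2 < 2 ^ w := by
  induction w, hw using Nat.le_induction with
  | base => norm_num
  | succ w hw ih => rw [pow_succ 2 w]; nlinarith

lemma le_of_pow_le {N w κ : ℕ} (hN : 1 ≤ N) (h : (N + 1) ^ κ ≤ 2 ^ w) : κ ≤ w :=
  (Nat.pow_le_pow_iff_right one_lt_two).1 ((Nat.pow_le_pow_left (by omega) κ).trans h)

/-- Half of the exponent 50 covers the polynomial in N, as 2^19 ≤ (N+1)^19; the other half covers
the factor w. Comparing squares makes this precise, with w² < 2^w. -/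
lemma pow_mul_lt {N w : ℕ} (hN : 1 ≤ N) (h : (N + 1) ^ 50 ≤ 2 ^ w) :
    2 ^ 19 * N ^ 6 * w < 2 ^ w := by
  have h1 : 2 ^ 19 * N ^ 6 ≤ (N + 1) ^ 25 := by
    calc 2 ^ 19 * N ^ 6 ≤ (N + 1) ^ 19 * (N + 1) ^ 6 := by gcongr <;> omega
      _ = _ := by rw [← pow_add]
  have hw : 50 ≤ w := le_of_pow_le hN h
  refine lt_of_pow_lt_pow_left₀ 2 (Nat.zero_le _) ?_
  calc (2 ^ 19 * N ^ 6 * w) ^ 2 ≤ ((N + 1) ^ 25 * w) ^ 2 := by gcongr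
    _ = (N + 1) ^ 50 * w ^ 2 := by ring
    _ < 2 ^ w * 2 ^ w := by
      refine Nat.mul_lt_mul_of_le_of_lt h (sq_lt_two_pow (by omega)) (by positivity)
    _ = (2 ^ w) ^ 2 := (sq _).symm

lemma four_mul_sq_lt {N w : ℕ} (hN : 1 ≤ N) (h : (N + 1) ^ 50 ≤ 2 ^ w) : 4 * N ^ 2 < 2 ^ w := by
  have hw : 50 ≤ w := le_of_pow_le hN h
  have h1 : 4 ≤ 2 ^ 19 := by norm_num
  have h2 := Nat.mul_le_mul (Nat.mul_le_mul h1
    (Nat.pow_le_pow_right hN (show 2 ≤ 6 by norm_num))) (show 1 ≤ w by omega)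
  rw [mul_one] at h2
  exact h2.trans_lt (pow_mul_lt hN h)

lemma clamp_le (N E : ℕ) : clamp N E ≤ 4 * N ^ 2 := by
  unfold clamp; split_ifs <;> omega

lemma clamp_le_right (N E : ℕ) : clamp N E ≤ E := by
  unfold clamp; split_ifs <;> omega

lemma two_le_clamp {N E : ℕ} (hN : 1 ≤ N) (hE : 2 ≤ E) : 2 ≤ clamp N E := by
  have := Nat.one_le_pow 2 N hN
  unfold clamp; split_ifs <;> omega

/-- The decisive quantity is 4·k·N·τ. It is at most 2^19·N^6·w since e ≤ 4N², l ≤ 2w and τ ≤ 2N;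
without the cap on e it would have no bound in terms of N and w. -/
lemma level_numbers_lt {N w l E : ℕ} (hN : 1 ≤ N) (h : (N + 1) ^ 50 ≤ 2 ^ w) (hl : l ≤ 2 * w) :
    4 * (2048 * clamp N E ^ 2 * l * 1 * N * 2 ^ N.size) < 2 ^ w := by
  refine lt_of_le_of_lt ?_ (pow_mul_lt hN h)
  calc 4 * (2048 * clamp N E ^ 2 * l * 1 * N * 2 ^ N.size) ≤
        4 * (2048 * (4 * N ^ 2) ^ 2 * (2 * w) * 1 * N * (2 * N)) := by
        gcongr
        · exact clamp_le N E
        · exact two_pow_size_le hN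
    _ = 2 ^ 19 * N ^ 6 * w := by ring

/-- As exp(-2l) ≤ 2^(-l)·2^(-l), one factor pays for the union over 3(d+1) events and the other is
at most δ. -/
lemma failure_le {m D d : ℕ} {δ : ℝ} (hδ : 1 / δ ≤ D) (hδ0 : 0 < δ) (hD : 2 ≤ D) (hd : d ≤ m) :
    (d + 1) * (3 * Real.exp (-(2 * ((m + D.size : ℕ) : ℝ)))) ≤ δ := by
  obtain ⟨l, hl⟩ : ∃ l, l = m + D.size := ⟨_, rfl⟩
  rw [← hl]
  have h1 : Real.exp (-(2 * (l : ℝ))) ≤ (1 / 2) ^ (2 * l) := by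
    rw [show -(2 * (l : ℝ)) = ((2 * l : ℕ) : ℝ) * (-1) by push_cast; ring, Real.exp_nat_mul]
    refine pow_le_pow_left₀ (Real.exp_pos _).le ?_ _
    rw [Real.exp_neg, one_div]
    exact inv_anti₀ two_pos (by linarith [Real.add_one_le_exp 1])
  have hDs : D < 2 ^ D.size := Nat.lt_size_self D
  have h2 : (d + 1) * 3 ≤ 2 ^ l := by
    have h3 : d + 1 ≤ 2 ^ m := (Nat.succ_le_succ hd).trans Nat.lt_two_pow_self
    have h4 : 2 ≤ D.size := Nat.lt_size.2 (by simpa using hD)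
    have h5 : 2 ^ 2 ≤ 2 ^ D.size := Nat.pow_le_pow_right two_pos h4
    rw [hl, pow_add]
    exact Nat.mul_le_mul h3 (by omega)
  have h2' : ((d : ℝ) + 1) * 3 ≤ 2 ^ l := by exact_mod_cast h2
  have h6 : 1 / δ ≤ 2 ^ l := by
    refine hδ.trans ?_
    have : D ≤ 2 ^ l := hDs.le.trans (Nat.pow_le_pow_right two_pos (by omega))
    exact_mod_cast this
  calc (d + 1) * (3 * Real.exp (-(2 * (l : ℝ)))) ≤ (d + 1) * (3 * (1 / 2) ^ (2 * l)) := by gcongr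
    _ = ((d + 1) * 3) * (1 / 2) ^ (2 * l) := by ring
    _ ≤ 2 ^ l * (1 / 2) ^ (2 * l) := by gcongr
    _ = 1 / 2 ^ l := by
      rw [two_mul, pow_add, one_div, inv_pow]
      field_simp
    _ ≤ δ := by
      rw [div_le_iff₀ hδ0] at h6
      rw [div_le_iff₀ (by positivity)]
      linarith

lemma size_le_logb {x : ℕ} (hx : 0 < x) {y : ℝ} (hxy : (x : ℝ) ≤ y) :
    (x.size : ℝ) ≤ Real.logb 2 y + 1 := by
  have h1 : (2 : ℝ) ^ x.size ≤ 2 * x := by exact_mod_cast two_pow_size_le hx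
  have hx' : (0 : ℝ) < x := by exact_mod_cast hx
  have hy : 0 < y := hx'.trans_le hxy
  have h2 : (2 : ℝ) ^ (x.size : ℝ) ≤ 2 * y := by
    rw [Real.rpow_natCast]; linarith
  have h3 := (Real.le_logb_iff_rpow_le one_lt_two (by positivity)).2 h2
  rw [Real.logb_mul two_ne_zero hy.ne', Real.logb_self_eq_one one_lt_two] at h3
  linarith

lemma size_add_size_le {N D : ℕ} {δ : ℝ} (hN : 1 ≤ N) (hD : 0 < D) (hδ0 : 0 < δ) (hδ1 : δ < 1)
    (hDδ : (D : ℝ) ≤ 2 / δ) :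
    ((N.size + D.size : ℕ) : ℝ) ≤ 3 * Real.logb 2 (2 * N / δ) := by
  have hN' : (1 : ℝ) ≤ N := by exact_mod_cast hN
  have h1 := size_le_logb (x := N) hN le_rfl
  have h2 := size_le_logb hD hDδ
  have h3 : Real.logb 2 (2 * N / δ) = Real.logb 2 N + Real.logb 2 (2 / δ) := by
    rw [← Real.logb_mul (by positivity) (by positivity)]
    congr 1
    ring
  have h4 : 1 ≤ Real.logb 2 (2 * N / δ) := by
    rw [Real.le_logb_iff_rpow_le one_lt_two (by positivity), Real.rpow_one,
      le_div_iff₀ hδ0]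
    nlinarith
  push_cast
  linarith

/-- The number of samples on the last level is of the order e²·l·2^d, with 2^d ≤ 2N/√(max 1 OUT)
because 2^i₀ ≥ √(max 1 OUT). There is room to spare: the argument gives ε^(-2) and a single
logarithm, and log(2/δ) is only used to be at least 1. The constant 24 is 4·3·2. -/
lemma steps_le_timeBound {N OUT e D i₀ d : ℕ} {ε δ : ℝ} (hN : 1 ≤ N) (hε0 : 0 < ε) (hε1 : ε < 1)
    (hδ0 : 0 < δ) (hδ1 : δ < 1) (he : (e : ℝ) ≤ 2 / ε) (hD0 : 0 < D) (hD : (D : ℝ) ≤ 2 / δ)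
    (hi₀ : OUT ≤ 4 ^ i₀) (hid : i₀ + d = N.size) :
    ((e ^ 2 * (N.size + D.size) * 2 ^ d : ℕ) : ℝ) ≤ 24 * timeBound N OUT ε δ := by
  have hN' : (1 : ℝ) ≤ N := by exact_mod_cast hN
  have hl := size_add_size_le hN hD0 hδ0 hδ1 hD
  have hlog : 0 ≤ Real.logb 2 (2 * N / δ) := by
    have : (0 : ℝ) ≤ ((N.size + D.size : ℕ) : ℝ) := Nat.cast_nonneg _
    linarith
  have hlog2 : 1 ≤ Real.logb 2 (2 / δ) := by
    rw [Real.le_logb_iff_rpow_le one_lt_two (by positivity), Real.rpow_one,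
      le_div_iff₀ hδ0]
    linarith
  have hM : (0 : ℝ) < √(max 1 (OUT : ℝ)) := Real.sqrt_pos.2 (lt_max_of_lt_left one_pos)
  have hsqrt : √(max 1 (OUT : ℝ)) ≤ 2 ^ i₀ := by
    rw [Real.sqrt_le_left (by positivity), ← pow_mul, mul_comm, pow_mul]
    norm_num
    exact ⟨one_le_pow₀ (by norm_num), by exact_mod_cast hi₀⟩
  have h2d : (2 : ℝ) ^ d ≤ 2 * N / √(max 1 (OUT : ℝ)) := by
    rw [le_div_iff₀ hM]
    calc (2 : ℝ) ^ d * √(max 1 (OUT : ℝ)) ≤ 2 ^ d * 2 ^ i₀ := by gcongr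
      _ = 2 ^ N.size := by rw [← hid, pow_add, mul_comm]
      _ ≤ 2 * N := by exact_mod_cast two_pow_size_le hN
  have hee : (e : ℝ) ^ 2 ≤ 4 / ε ^ (5 / 2 : ℝ) := by
    calc (e : ℝ) ^ 2 ≤ (2 / ε) ^ 2 := by gcongr
      _ = 4 / ε ^ 2 := by rw [div_pow]; norm_num
      _ ≤ 4 / ε ^ (5 / 2 : ℝ) := by
        have h1 : 0 < ε ^ (5 / 2 : ℝ) := by positivity
        gcongr
        rw [← Real.rpow_two]
        exact Real.rpow_le_rpow_of_exponent_ge hε0 hε1.le (by norm_num)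
  have hεp : 0 < ε ^ (5 / 2 : ℝ) := by positivity
  calc ((e ^ 2 * (N.size + D.size) * 2 ^ d : ℕ) : ℝ)
      = (e : ℝ) ^ 2 * ((N.size + D.size : ℕ) : ℝ) * 2 ^ d := by push_cast; ring
    _ ≤ (4 / ε ^ (5 / 2 : ℝ)) * (3 * Real.logb 2 (2 * N / δ)) * (2 * N / √(max 1 (OUT : ℝ))) := by
        gcongr
    _ = 24 * (N * Real.logb 2 (2 * N / δ) * 1 / (ε ^ (5 / 2 : ℝ) * √(max 1 (OUT : ℝ)))) := by
        field_simp
        ring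
    _ ≤ 24 * timeBound N OUT ε δ := by
        unfold timeBound
        gcongr

section

variable {w : ℕ} {I : Instance} {ε : ℝ}

/-- The cost of the preparations, without the halving loops. -/
def prepareCost : ℕ := cost setParams + cost readInput + 9

theorem bad_countProgram_le (hε : 0 < ε) (hN : 1 ≤ I.size) (hfit : I.FitsWord w)
    (hw : (I.size + 1) ^ 50 ≤ 2 ^ w) {E D : ℕ} (hE : 2 ≤ E) (hD : 2 ≤ D) (hEε : 1 / ε ≤ E)
    (hDw : D < 2 ^ w) {i₀ d : ℕ} (hi₀ : I.out ≤ 4 ^ i₀)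
    (hmin : ∀ i, i + 1 = i₀ → 4 ^ i < I.out) (hid : i₀ + d = I.size.size) :
    bad w I ε (cost finish + 1 + 2048 * clamp I.size E ^ 2 * (I.size.size + D.size) * 1 *
        (2 * 2 ^ d - 1) * levelCost + (I.size.size + D.size) * halveCost + prepareCost)
        (start countProgram E D) ≤
      (d + 1) * (3 * Real.exp (-(2 * ((I.size.size + D.size : ℕ) : ℝ)))) := by
  have h50 : 50 ≤ w := le_of_pow_le hN hw
  have h2w : 2 < 2 ^ w := (show 2 < 2 ^ 2 by norm_num).trans_le
    (Nat.pow_le_pow_right two_pos (by omega))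
  have hNw : I.size < 2 ^ w := by
    refine lt_of_lt_of_le ?_ hw
    exact (Nat.lt_succ_self _).trans_le (Nat.le_self_pow (by norm_num) _)
  have hsN : I.size.size ≤ w := Nat.size_le.2 hNw
  have hsD : D.size ≤ w := Nat.size_le.2 hDw
  have hlw : I.size.size + D.size < 2 ^ w := by
    have := sq_lt_two_pow (show 5 ≤ w by omega)
    nlinarith
  have hl : 0 < I.size.size + D.size := by
    have := Nat.size_pos.2 (show 0 < D by omega)
    omega
  have hnum := level_numbers_lt (E := E) hN hw (show I.size.size + D.size ≤ 2 * w by omega)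
  have hc2 := two_le_clamp hN hE
  have h4N : 4 * I.size ^ 2 < 2 ^ w := four_mul_sq_lt hN hw
  have hflag0 : clampFlag I.size E ≠ 1 → 1 / (clamp I.size E : ℝ) ≤ ε := by
    unfold clampFlag clamp
    split_ifs with hc
    · simp
    · intro _
      have hE' : (0 : ℝ) < E := by exact_mod_cast (by omega : 0 < E)
      rw [div_le_iff₀ hε] at hEε
      rw [div_le_iff₀ hE']
      linarith
  have hflag1 : clampFlag I.size E = 1 → clamp I.size E = 4 * I.size ^ 2 := by
    unfold clampFlag clamp
    split_ifs <;> simp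
  set e := clamp I.size E with he
  set flag := clampFlag I.size E with hflag
  set l := I.size.size + D.size with hldef
  set T₀ := cost finish + 1 + 2048 * e ^ 2 * l * 1 * (2 * 2 ^ d - 1) * levelCost with hT₀
  have e0 : 0 % 2 ^ w = 0 := Nat.zero_mod _
  obtain ⟨g, hg, g0, g1, g2, g3, g4, g5, g6, g7, g20⟩ := wp_readInput (I := I) (w := w) (E := E)
    (D := D) hN h4N (fun s => bad w I ε (((((T₀ + 1 + cost setParams) + 1) + 1 +
      D.size * halveCost + 1) + 1 + 1) + 1 + I.size.size * halveCost + 1)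
      ⟨[.seq (halve 7) (.seq (.op .add 6 (.reg 1) (.const 0)) (.seq (halve 20)
        (.seq setParams (.seq levels finish))))], s⟩)
  rw [show T₀ + l * halveCost + prepareCost = (((((T₀ + 1 + cost setParams) + 1) + 1 +
      D.size * halveCost + 1) + 1 + 1) + 1 + I.size.size * halveCost + 1) + cost readInput + 1 by
      simp only [prepareCost, hldef]; ring, start, countProgram, bad_seq]
  refine (bad_le_wp _ _ _ _).trans (hg.le.trans ?_)
  rw [bad_seq]
  refine bad_halve_le (d := 7) (by norm_num) (by norm_num) h2w I.size 0 _ g6 g5 hNw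
    (by omega) (by simp only [g7]; omega) ?_
  intro s₁ f₁ f₁5 f₁7
  simp only [g7] at f₁7
  have hM : 2 ^ I.size.size < 2 ^ w := by
    refine lt_of_le_of_lt ?_ hnum
    have : 0 < 2048 * e ^ 2 * l * 1 * I.size := by positivity
    calc 2 ^ I.size.size ≤ 2048 * e ^ 2 * l * 1 * I.size * 2 ^ I.size.size :=
          Nat.le_mul_of_pos_left _ this
      _ ≤ _ := by omega
  rw [one_mul, Nat.mod_eq_of_lt hM] at f₁7
  have r1 : s₁.reg 1 = D := by rw [f₁ 1 (by norm_num) (by norm_num) (by norm_num)]; exact g1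
  rw [bad_seq]
  refine (bad_le_wp (.op .add 6 (.reg 1) (.const 0)) _ _ _).trans ?_
  simp only [wp, Operand.eval, BinOp.eval, e0, r1, Nat.add_zero, setReg_of_lt hDw]
  rw [bad_seq]
  -- The counter in register 5 is not reset, so it continues from the binary length of N.
  refine bad_halve_le (d := 20) (by norm_num) (by norm_num) h2w D I.size.size _ (by simp)
    (by simp [f₁5]) hDw hlw ?_ ?_
  · simp only [Function.update_apply]
    norm_num
    rw [f₁ 20 (by norm_num) (by norm_num) (by norm_num)]
    exact g20
  intro s₂ f₂ f₂5 _
  have keep : ∀ i, i ≠ 5 → i ≠ 6 → i ≠ 7 → i ≠ 20 → s₂.reg i = g i := by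
    intro i i5 i6 i7 i20
    rw [f₂ i i5 i6 i20]
    simp only [Function.update_of_ne i6]
    exact f₁ i i5 i6 i7
  have k0 := keep 0 (by norm_num) (by norm_num) (by norm_num) (by norm_num)
  have k2 := keep 2 (by norm_num) (by norm_num) (by norm_num) (by norm_num)
  have k3 := keep 3 (by norm_num) (by norm_num) (by norm_num) (by norm_num)
  have k4 := keep 4 (by norm_num) (by norm_num) (by norm_num) (by norm_num)
  have k7 : s₂.reg 7 = 2 ^ I.size.size := by
    rw [f₂ 7 (by norm_num) (by norm_num) (by norm_num)]
    simpa using f₁7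
  rw [bad_seq]
  refine (bad_le_wp _ _ _ _).trans ?_
  have hK : 2048 * e ^ 2 * l < 2 ^ w := by
    refine lt_of_le_of_lt ?_ hnum
    have h1 : 2048 * e ^ 2 * l ≤ 2048 * e ^ 2 * l * 1 * I.size * 2 ^ I.size.size := by
      rw [mul_one, mul_assoc _ I.size]
      exact Nat.le_mul_of_pos_right _ (Nat.mul_pos hN (by positivity))
    omega
  obtain ⟨g', hg', f', g8', g9', g10'⟩ := wp_setParams (w := w) (I := I) (e := e) (l := l) (s := s₂)
    (fun s' => bad w I ε (T₀ + 1) ⟨[.seq levels finish], s'⟩) (by omega) hl hK (k0.trans g0) f₂5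
  refine hg'.le.trans ?_
  rw [bad_seq]
  refine bad_levels_le hε hN hfit hc2 hl hflag0 hflag1 hi₀ hmin d 1 _ one_pos ?_ ?_ ?_
  · rw [hid, one_mul]; exact (Nat.lt_size_self _).le
  · rw [hid]; exact hnum
  · rw [hid]
    refine ⟨?_, ?_, ?_, ?_, ?_, ?_, ?_⟩
    · exact (f' 2 (by norm_num) (by norm_num) (by norm_num)).trans (k2.trans g2)
    · exact (f' 3 (by norm_num) (by norm_num) (by norm_num)).trans (k3.trans g3)
    · exact (f' 4 (by norm_num) (by norm_num) (by norm_num)).trans (k4.trans g4)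
    · exact (f' 7 (by norm_num) (by norm_num) (by norm_num)).trans k7
    · simp [levelFrame, g8']
    · simp [levelFrame, g9']
    · simp [levelFrame, g10']

end

lemma two_le_ceil_inv {x : ℝ} (h0 : 0 < x) (h1 : x < 1) : 2 ≤ ⌈1 / x⌉₊ := by
  have : (1 : ℝ) < 1 / x := by rwa [lt_div_iff₀ h0, one_mul]
  exact Nat.lt_ceil.2 (by exact_mod_cast this)

lemma ceil_inv_le {x : ℝ} (h0 : 0 < x) (h1 : x < 1) : (⌈1 / x⌉₊ : ℝ) ≤ 2 / x := by
  have h2 := (Nat.ceil_lt_add_one (show 0 ≤ 1 / x by positivity)).le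
  have h3 : 1 ≤ 1 / x := by rw [le_div_iff₀ h0]; linarith
  refine h2.trans ?_
  rw [show 2 / x = 1 / x + 1 / x by ring]
  linarith

/-- The constant of the running time. -/
def timeConst : ℕ := cost finish + 1 + 4096 * levelCost + halveCost + prepareCost

lemma steps_le (e l d : ℕ) (he : 1 ≤ e) (hl : 1 ≤ l) :
    cost finish + 1 + 2048 * e ^ 2 * l * 1 * (2 * 2 ^ d - 1) * levelCost + l * halveCost +
      prepareCost ≤ timeConst * (e ^ 2 * l * 2 ^ d) := by
  have he2 : 1 ≤ e ^ 2 := Nat.one_le_pow _ _ he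
  have hd : 1 ≤ 2 ^ d := Nat.one_le_two_pow
  have h1 : l ≤ e ^ 2 * l * 2 ^ d := by
    calc l = 1 * l * 1 := by ring
      _ ≤ _ := by gcongr
  have h2 : 2048 * e ^ 2 * l * 1 * (2 * 2 ^ d - 1) * levelCost ≤
      4096 * levelCost * (e ^ 2 * l * 2 ^ d) := by
    calc _ ≤ 2048 * e ^ 2 * l * 1 * (2 * 2 ^ d) * levelCost := by
          gcongr; exact Nat.sub_le _ _
      _ = _ := by ring
  have h3 : l * halveCost ≤ halveCost * (e ^ 2 * l * 2 ^ d) := by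
    rw [mul_comm]; gcongr
  have h4 : cost finish + 1 + prepareCost ≤
      (cost finish + 1 + prepareCost) * (e ^ 2 * l * 2 ^ d) :=
    Nat.le_mul_of_pos_right _ (by omega)
  unfold timeConst
  linarith

end MatrixCount

end

theorem mainTheorem2 :
    ∃ (P : MatrixCount.Program) (C : ℝ) (κ : ℕ),
      ∀ (ε δ : ℝ), 0 < ε → ε < 1 → 0 < δ → δ < 1 →
      ∀ (I : MatrixCount.Instance), 1 ≤ I.size →
      ∀ (w : ℕ), I.FitsWord w → (I.size + 1) ^ κ ≤ 2 ^ w →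
        ⌈1 / ε⌉₊ < 2 ^ w → ⌈1 / δ⌉₊ < 2 ^ w →
        ENNReal.ofReal (1 - δ) ≤
          (MatrixCount.run w I ⌊C * MatrixCount.timeBound I.size I.out ε δ⌋₊
            (MatrixCount.start P ⌈1 / ε⌉₊ ⌈1 / δ⌉₊)).toOuterMeasure
              {c | MatrixCount.Good ε I c} := by
  refine ⟨MatrixCount.countProgram, MatrixCount.timeConst * 24, 50, ?_⟩
  intro ε δ hε0 hε1 hδ0 hδ1 I hN w hfit hw _ hδw
  apply MatrixCount.one_sub_bad_le
  -- The program does not know i₀; it is used only in the analysis. Since OUT ≤ N², it is at most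
  -- the binary length of N, the exponent of the initial τ, and d counts the halvings in between.
  have hex : ∃ i, I.out ≤ 4 ^ i := ⟨I.out, (Nat.lt_pow_self (by norm_num)).le⟩
  have hi₀ := Nat.find_spec hex
  have hle : Nat.find hex ≤ I.size.size := by
    refine Nat.find_min' hex (I.out_le_size_sq.trans ?_)
    calc I.size ^ 2 ≤ (2 ^ I.size.size) ^ 2 := by gcongr; exact (Nat.lt_size_self _).le
      _ = 4 ^ I.size.size := by rw [← pow_mul, mul_comm, pow_mul]; norm_num
  obtain ⟨d, hd⟩ := Nat.exists_eq_add_of_le hle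
  have hE := MatrixCount.two_le_ceil_inv hε0 hε1
  have hD := MatrixCount.two_le_ceil_inv hδ0 hδ1
  refine le_trans (MatrixCount.bad_antitone _ ?_) ((MatrixCount.bad_countProgram_le hε0 hN hfit hw
    hE hD (Nat.le_ceil _) hδw hi₀ (fun i hi => ?_) hd.symm).trans
    (MatrixCount.failure_le (Nat.le_ceil _) hδ0 hD (by omega)))
  · refine Nat.le_floor ?_
    have hc := MatrixCount.two_le_clamp hN hE
    have hl := Nat.size_pos.2 (show 0 < ⌈1 / δ⌉₊ by omega)
    have h1 := MatrixCount.steps_le (MatrixCount.clamp I.size ⌈1 / ε⌉₊)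
      (I.size.size + (⌈1 / δ⌉₊).size) d (by omega) (by omega)
    have hce : (MatrixCount.clamp I.size ⌈1 / ε⌉₊ : ℝ) ≤ 2 / ε :=
      le_trans (by exact_mod_cast MatrixCount.clamp_le_right _ _)
        (MatrixCount.ceil_inv_le hε0 hε1)
    have h2 := MatrixCount.steps_le_timeBound hN hε0 hε1 hδ0 hδ1 hce (by omega)
      (MatrixCount.ceil_inv_le hδ0 hδ1) hi₀ hd.symm
    have h1' : ((_ : ℕ) : ℝ) ≤ ((_ : ℕ) : ℝ) := Nat.cast_le.2 h1
    refine h1'.trans ?_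
    rw [Nat.cast_mul, mul_assoc (MatrixCount.timeConst : ℝ)]
    exact mul_le_mul_of_nonneg_left h2 (Nat.cast_nonneg _)
  · exact not_le.1 (Nat.find_min hex (by omega))
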